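/- **Corollary 4.3 (Approximation of regular minimizers).** Let $L>0$ and $V=H^2(0,L;\mathbb{R}^3)\times H^1(0,L;\mathbb{R}^3)$, and write $\|\cdot\|$ for the norm of $L^2(0,L)$. Let $L_{\rm bc}$ be a bounded linear operator from $V$ into a normed space such that $L_{\rm bc}[y,b]$ depends only on the boundary values of $y,y',b$ at $0$ and $L$, and let $\ell_{\rm bc}$ be an element of that space. *Continuous problem.* Let $$\mathcal{A}_{\rm frame}=\{(y,b)\in V:\ [y',b,y'\times b]\in SO(3)\ \text{a.e. in }(0,L),\ L_{\rm bc}[y,b]=\ell_{\rm bc}\}$$ and $$E[y,b]=\int_0^L\overline Q(|y''|,|b'|)\,dx,\qquad \overline Q(\alpha,\beta)=\begin{cases}(\alpha^2+\beta^2)^2/\alpha^2,&|\alpha|\ge|\beta|,\ \alpha\neq 0,\\ 4\beta^2,&|\alpha|\le|\beta|.\end{cases}$$ The constrained functional is the restriction of $E$ to $\mathcal{A}=\{(y,b)\in\mathcal{A}_{\rm frame}: y'\cdot b'=0 \text{ a.e.}\}$. *Regularization.* For every $\delta\ge0$ let $|\cdot|_\delta:\mathbb{R}\to\mathbb{R}_{\ge0}$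 satisfy $\big||x|_\delta-|x|\big|\le c_{\rm uni}\delta$ for all $x$, and for $\delta>0$ let $|\cdot|_\delta\in C^2(\mathbb{R})$ with $|\cdot|_\delta\ge c_0\delta$, $|\cdot|_\delta'\le c_1$, $|\cdot|_\delta''\le c_2\delta^{-1}$, where $c_0>0$ and the constants do not depend on $\delta$ and $x$. Put $\psi_\delta(r,s)=|r-s|_\delta+\dfrac{4s^2}{r+s+|r-s|_\delta}$ (the quotient being $0$ if $r+s+|r-s|_\delta=0$) and $$E_{\delta,\varepsilon}[y,b]=\frac12\int_0^L|y''|^2+5|b'|^2+\psi_\delta(|y''|^2,|b'|^2)\,dx+\frac1{2\varepsilon_1}\int_0^L(y'\cdot b)^2\,dx+\frac1{2\varepsilon_2}\int_0^L(y'\cdot b')^2\,dx .$$ *Discrete problem.* For a partitioning $\mathcal{T}$: $0=x_0<x_1<\dots<x_N=L$ with maximal mesh-size $h$, a pair $(y_h,b_h)$ is discretely admissible if $y_h$ is $C^1$ and piecewise cubic, $b_h$ is continuous and piecewise linear with respect to $\mathcal{T}$, $|y_h'(x_j)|^2=|b_h(x_j)|^2=1$ for $j=0,\dots,N$, and $L_{\rm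 bc}[y_h,b_h]=\ell_{\rm bc}$. *Claim.* Let $(\mathcal{T}_n)_{n\in\mathbb{N}}$ be quasiuniform partitionings (every element of $\mathcal{T}_n$ has length at least $c\,h_n$, with $c>0$ independent of $n$) with maximal mesh-sizes $h_n\to0$, let $\delta_n\ge0$, $\varepsilon_{1,n},\varepsilon_{2,n}>0$ and $\varepsilon_{{\rm tol},n}$ tend to $0$, and let $(y_n,b_n)$ be discretely admissible for $\mathcal{T}_n$ with $$E_{\delta_n,\varepsilon_n}[y_n,b_n]\le E_{\delta_n,\varepsilon_n}[w_n,r_n]+\varepsilon_{{\rm tol},n}\quad\text{for all }(w_n,r_n)\text{ discretely admissible for }\mathcal{T}_n .$$ Suppose that some weak accumulation point $(\bar y,\bar b)\in V$ of the sequence (the weak limit in $V$ of a subsequence) has the following property: there are $\sigma_n>0$ with $\sigma_n\to0$ and pairs $(\bar y_{\sigma_n},\bar b_{\sigma_n})\in \mathcal{A}_{\rm frame}$, with $\bar y_{\sigma_n}\in C^\infty(0,L;\mathbb{R}^3)\cap H^3(0,L;\mathbb{R}^3)$ and $\bar b_{\sigma_n}\in C^\infty(0,L;\mathbb{R}^3)\cap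 H^2(0,L;\mathbb{R}^3)$, such that $$\|\bar y-\bar y_{\sigma_n}\|_{H^2(0,L)}+\|\bar b-\bar b_{\sigma_n}\|_{H^1(0,L)}+\|\bar y_{\sigma_n}'\cdot\bar b_{\sigma_n}'\|\le\sigma_n$$ for all $n$ and, with $[\bar y,\bar b]_{\sigma_n}=\|\bar y_{\sigma_n}\|_{H^3(0,L)}+\|\bar b_{\sigma_n}\|_{H^2(0,L)}$, $$\frac{h_n^2}{\varepsilon_{1,n}}+\frac{\sigma_n^2}{\varepsilon_{2,n}}+\frac{h_n^2[\bar y,\bar b]_{\sigma_n}^2}{\varepsilon_{2,n}}\to0\quad(n\to\infty).$$ Then every weak accumulation point $(y,b)\in V$ of the sequence $(y_n,b_n)$ belongs to $\mathcal{A}$ and satisfies $E[y,b]\le E[w,r]$ for all $(w,r)\in\mathcal{A}$. -/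

import Mathlib

open MeasureTheory Filter Topology Set
open scoped ENNReal ContDiff Matrix

noncomputable section

namespace Ribbon

/-- Euclidean three-space. -/
abbrev R3 := EuclideanSpace ℝ (Fin 3)

/-- Lebesgue measure on the interval `(0,L)`. -/
abbrev leb (L : ℝ) : Measure ℝ := volume.restrict (Ioo 0 L)

/-- The Lebesgue space `L²(0,L;ℝ³)`. -/
abbrev L2 (L : ℝ) := Lp R3 2 (leb L)

/-- `v` is the weak derivative of `u` on `(0,L)`: `∫ φ' u = - ∫ φ v` for all test functions
`φ ∈ C_c^∞(0,L)`. -/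
def IsWeakDeriv {L : ℝ} (u v : L2 L) : Prop :=
  ∀ φ : ℝ → ℝ, ContDiff ℝ ∞ φ → HasCompactSupport φ → tsupport φ ⊆ Ioo 0 L →
    ∫ x, deriv φ x • u x ∂(leb L) = - ∫ x, φ x • v x ∂(leb L)

theorem integrable_smul_of_test {L : ℝ} {ψ : ℝ → ℝ} (hc : Continuous ψ)
    (hs : HasCompactSupport ψ) (u : L2 L) : Integrable (fun x => ψ x • u x) (leb L) := by
  obtain ⟨C, hC⟩ := hc.bounded_above_of_compact_support hs
  have hu : Integrable (fun x => u x) (leb L) := (Lp.memLp u).integrable (by norm_num)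
  exact hu.bdd_smul C hc.aestronglyMeasurable (Filter.Eventually.of_forall hC)

theorem IsWeakDeriv.zero {L : ℝ} : IsWeakDeriv (0 : L2 L) 0 := by
  intro φ _ _ _
  have h0 : ∀ ψ : ℝ → ℝ, ∫ x, ψ x • (0 : L2 L) x ∂(leb L) = 0 := by
    intro ψ
    refine integral_eq_zero_of_ae ?_
    filter_upwards [Lp.coeFn_zero R3 2 (leb L)] with x hx
    exact (congrArg (ψ x • ·) hx).trans (smul_zero _)
  rw [h0, h0, neg_zero]

theorem IsWeakDeriv.add {L : ℝ} {u v u' v' : L2 L} (h : IsWeakDeriv u v)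
    (h' : IsWeakDeriv u' v') : IsWeakDeriv (u + u') (v + v') := by
  intro φ h1 h2 h3
  have key : ∀ ψ : ℝ → ℝ, Continuous ψ → HasCompactSupport ψ → ∀ a c : L2 L,
      ∫ x, ψ x • (a + c) x ∂(leb L)
        = ∫ x, ψ x • a x ∂(leb L) + ∫ x, ψ x • c x ∂(leb L) := by
    intro ψ hc hs a c
    rw [← integral_add (integrable_smul_of_test hc hs a) (integrable_smul_of_test hc hs c)]
    refine integral_congr_ae ?_
    filter_upwards [Lp.coeFn_add a c] with x hx
    rw [hx, Pi.add_apply, smul_add]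
  rw [key _ (h1.continuous_deriv (by simp)) h2.deriv, key _ h1.continuous h2,
    h φ h1 h2 h3, h' φ h1 h2 h3]
  abel

theorem IsWeakDeriv.smul {L : ℝ} {u v : L2 L} (c : ℝ) (h : IsWeakDeriv u v) :
    IsWeakDeriv (c • u) (c • v) := by
  intro φ h1 h2 h3
  have key : ∀ ψ : ℝ → ℝ, ∀ a : L2 L,
      ∫ x, ψ x • (c • a) x ∂(leb L) = c • ∫ x, ψ x • a x ∂(leb L) := by
    intro ψ a
    rw [← integral_smul]
    refine integral_congr_ae ?_
    filter_upwards [Lp.coeFn_smul c a] with x hx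
    rw [hx, Pi.smul_apply, smul_comm]
  rw [key, key, h φ h1 h2 h3, smul_neg]

/-- The Sobolev space `H^k(0,L;ℝ³)`. An element is the tuple `(u, u', …, u^{(k)})` of an
`L²` function and its weak derivatives up to order `k` (which `u` determines), and the norm
inherited from the `ℓ²` product is `‖u‖_{H^k} = (∑_{j ≤ k} ‖u^{(j)}‖²_{L²})^{1/2}`. -/
def Hk (L : ℝ) (k : ℕ) : Submodule ℝ (PiLp 2 fun _ : Fin (k + 1) => L2 L) where
  carrier := {u | ∀ j : Fin k, IsWeakDeriv (u j.castSucc) (u j.succ)}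
  zero_mem' := fun _ => IsWeakDeriv.zero
  add_mem' := fun hu hv j => (hu j).add (hv j)
  smul_mem' := fun c _ hu j => (hu j).smul c

/-- The `j`-th weak derivative of an element of `H^k`. -/
def wd {L : ℝ} {k : ℕ} (u : Hk L k) (j : Fin (k + 1)) : L2 L :=
  (u : PiLp 2 fun _ : Fin (k + 1) => L2 L) j

/-- The inclusion of `H^{k+1}` into `H^k`. -/
def incl {L : ℝ} {k : ℕ} (u : Hk L (k + 1)) : Hk L k :=
  ⟨WithLp.toLp 2 (fun j => wd u j.castSucc), fun j => u.2 j.castSucc⟩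

/-- The space `V = H²(0,L;ℝ³) × H¹(0,L;ℝ³)` of pairs `(y,b)`. -/
abbrev V (L : ℝ) := Hk L 2 × Hk L 1

section Components

variable {L : ℝ}

/-- The first component `y`. -/
def V.y (v : V L) : L2 L := wd v.1 0
/-- The derivative `y'`. -/
def V.dy (v : V L) : L2 L := wd v.1 1
/-- The second derivative `y''`. -/
def V.ddy (v : V L) : L2 L := wd v.1 2
/-- The second component `b`. -/
def V.b (v : V L) : L2 L := wd v.2 0
/-- The derivative `b'`. -/
def V.db (v : V L) : L2 L := wd v.2 1

end Components

/-- The continuous representative of `f` takes the values `a` at `0` and `c` at `L`. -/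
def HasEndpointValues {L : ℝ} (f : L2 L) (a c : R3) : Prop :=
  ∃ g : ℝ → R3, ContinuousOn g (Icc 0 L) ∧ f =ᵐ[leb L] g ∧ g 0 = a ∧ g L = c

/-- The boundary values of `y`, `y'` and `b` at `0` and `L` coincide for `v` and `w`. -/
def SameBoundaryValues {L : ℝ} (v w : V L) : Prop :=
  (∃ a c, HasEndpointValues v.y a c ∧ HasEndpointValues w.y a c) ∧
  (∃ a c, HasEndpointValues v.dy a c ∧ HasEndpointValues w.dy a c) ∧
  (∃ a c, HasEndpointValues v.b a c ∧ HasEndpointValues w.b a c)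

/-- The matrix with columns `t`, `b` and `t × b`. -/
def frameMatrix (t b : R3) : Matrix (Fin 3) (Fin 3) ℝ :=
  (Matrix.of ![t.ofLp, b.ofLp, t.ofLp ⨯₃ b.ofLp])ᵀ

/-- The set of admissible frames: `[y', b, y' × b] ∈ SO(3)` almost everywhere in `(0,L)` and
`L_bc[y,b] = ℓ_bc`. -/
def frames {L : ℝ} {W : Type*} [NormedAddCommGroup W] [NormedSpace ℝ W]
    (Lbc : V L →L[ℝ] W) (lbc : W) : Set (V L) :=
  {v | (∀ᵐ x ∂(leb L), frameMatrix (v.dy x) (v.b x) ∈ Matrix.specialOrthogonalGroup (Fin 3) ℝ) ∧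
    Lbc v = lbc}

/-- The admissible set of the constrained functional `E`: frames with `y' · b' = 0`. -/
def ribbons {L : ℝ} {W : Type*} [NormedAddCommGroup W] [NormedSpace ℝ W]
    (Lbc : V L →L[ℝ] W) (lbc : W) : Set (V L) :=
  {v | v ∈ frames Lbc lbc ∧ ∀ᵐ x ∂(leb L), inner ℝ (v.dy x) (v.db x) = 0}

/-- The corrected Sadowsky density. -/
def Qbar (α β : ℝ) : ℝ :=
  if |β| ≤ |α| then (α ^ 2 + β ^ 2) ^ 2 / α ^ 2 else 4 * β ^ 2

/-- The elastic energy `E[y,b] = ∫ Qbar(|y''|,|b'|)`. -/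
def energy {L : ℝ} (v : V L) : ℝ := ∫ x, Qbar ‖v.ddy x‖ ‖v.db x‖ ∂(leb L)

/-- A family `m δ = |·|_δ`, `δ ≥ 0`, of regularized modulus functions. The conditions on
derivatives concern `δ > 0`; for `δ = 0` the uniform estimate forces `m 0 x = |x|`. -/
structure IsRegularizedModulus (m : ℝ → ℝ → ℝ) : Prop where
  nonneg : ∀ δ, 0 ≤ δ → ∀ x, 0 ≤ m δ x
  contDiff : ∀ δ, 0 < δ → ContDiff ℝ 2 (m δ)
  bounds : ∃ c₀ c₁ c₂ : ℝ, 0 < c₀ ∧ ∀ δ, 0 < δ → ∀ x,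
    c₀ * δ ≤ m δ x ∧ deriv (m δ) x ≤ c₁ ∧ deriv (deriv (m δ)) x ≤ c₂ * δ⁻¹
  uniform : ∃ c : ℝ, ∀ δ, 0 ≤ δ → ∀ x, |m δ x - abs x| ≤ c * δ

/-- `ψ_δ(r,s) = |r-s|_δ + 4 s² / (r + s + |r-s|_δ)`. -/
def psi (m : ℝ → ℝ → ℝ) (δ r s : ℝ) : ℝ :=
  m δ (r - s) + 4 * s ^ 2 / (r + s + m δ (r - s))

/-- The penalty functional `P_ε`. -/
def penalty {L : ℝ} (ε₁ ε₂ : ℝ) (v : V L) : ℝ :=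
  1 / (2 * ε₁) * ∫ x, inner ℝ (v.dy x) (v.b x) ^ 2 ∂(leb L) +
  1 / (2 * ε₂) * ∫ x, inner ℝ (v.dy x) (v.db x) ^ 2 ∂(leb L)

/-- The regularized and penalized energy `E_{δ,ε}` (whose restriction to the finite element
space is `E_{δ,ε,h}`). -/
def penEnergy {L : ℝ} (m : ℝ → ℝ → ℝ) (δ ε₁ ε₂ : ℝ) (v : V L) : ℝ :=
  1 / 2 * ∫ x, (‖v.ddy x‖ ^ 2 + 5 * ‖v.db x‖ ^ 2
      + psi m δ (‖v.ddy x‖ ^ 2) (‖v.db x‖ ^ 2)) ∂(leb L)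
    + penalty ε₁ ε₂ v

/-- A partitioning `0 = x_0 < x_1 < ⋯ < x_N = L` of the interval. -/
structure Mesh (L : ℝ) where
  N : ℕ
  node : Fin (N + 1) → ℝ
  strictMono : StrictMono node
  first : node 0 = 0
  last : node (Fin.last N) = L

/-- The length of the `j`-th element. -/
def Mesh.len {L : ℝ} (T : Mesh L) (j : Fin T.N) : ℝ := T.node j.succ - T.node j.castSucc

/-- The maximal mesh-size. -/
def Mesh.size {L : ℝ} (T : Mesh L) : ℝ := ⨆ j : Fin T.N, T.len j

/-- `g ∈ S^{p,r}(T)³`: `g` is of class `C^r`, and a polynomial of degree at most `p` on each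
element. -/
def IsSpline {L : ℝ} (T : Mesh L) (p r : ℕ) (g : ℝ → R3) : Prop :=
  ContDiffOn ℝ r g (Icc 0 L) ∧
  ∀ j : Fin T.N, ∃ c : Fin (p + 1) → R3,
    ∀ x ∈ Icc (T.node j.castSucc) (T.node j.succ), g x = ∑ i : Fin (p + 1), x ^ (i : ℕ) • c i

/-- The admissible pairs of the discrete problem: `(y_h,b_h) ∈ S^{3,1}(T)³ × S^{1,0}(T)³` with
`|y_h'|² = |b_h|² = 1` at the nodes (i.e. the piecewise linear nodal interpolants of `|y_h'|²`
and `|b_h|²` are `1`) and `L_bc[y_h,b_h] = ℓ_bc`. -/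
def discreteAdmissible {L : ℝ} {W : Type*} [NormedAddCommGroup W] [NormedSpace ℝ W]
    (Lbc : V L →L[ℝ] W) (lbc : W) (T : Mesh L) : Set (V L) :=
  {v | (∃ g r : ℝ → R3, IsSpline T 3 1 g ∧ IsSpline T 1 0 r ∧
      v.y =ᵐ[leb L] g ∧ v.b =ᵐ[leb L] r ∧
      ∀ j, ‖derivWithin g (Icc 0 L) (T.node j)‖ ^ 2 = 1 ∧ ‖r (T.node j)‖ ^ 2 = 1) ∧
    Lbc v = lbc}

/-- The smooth frame `(Y,B) ∈ H³ × H²` is a smooth `σ`-approximation `(y_σ,b_σ)` of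
`v = (y,b)`: it is an admissible frame of class `C^∞(0,L)` with
`‖y - y_σ‖_{H²} + ‖b - b_σ‖_{H¹} + ‖y_σ' · b_σ'‖_{L²} ≤ σ`. -/
structure IsSmoothApprox {L : ℝ} {W : Type*} [NormedAddCommGroup W] [NormedSpace ℝ W]
    (Lbc : V L →L[ℝ] W) (lbc : W) (v : V L) (σ : ℝ) (Y : Hk L 3) (B : Hk L 2) : Prop where
  smooth_y : ∃ g : ℝ → R3, ContDiffOn ℝ ∞ g (Ioo 0 L) ∧ wd Y 0 =ᵐ[leb L] g
  smooth_b : ∃ g : ℝ → R3, ContDiffOn ℝ ∞ g (Ioo 0 L) ∧ wd B 0 =ᵐ[leb L] g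
  frame : ((incl Y, incl B) : V L) ∈ frames Lbc lbc
  close : ‖v.1 - incl Y‖ + ‖v.2 - incl B‖
    + √(∫ x, inner ℝ (wd Y 1 x) (wd B 1 x) ^ 2 ∂(leb L)) ≤ σ

/-- `v` is a weak accumulation point of the sequence `u`: the limit of a subsequence in the
weak topology of `V`. -/
def IsWeakAccPt {L : ℝ} (u : ℕ → V L) (v : V L) : Prop :=
  ∃ φ : ℕ → ℕ, StrictMono φ ∧
    Tendsto (fun n => toWeakSpace ℝ (V L) (u (φ n))) atTop (𝓝 (toWeakSpace ℝ (V L) v))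

end Ribbon

end

noncomputable section

namespace Ribbon


/-! ### Sobolev functions on the interval as primitives -/

/-! The proof plays a lower semicontinuity inequality along the given almost-minimizers against
recovery sequences for arbitrary competitors. The smooth approximations contribute one competitor of
finite energy and a rate for the mesh-size.

Density: `Qbar α β` is the maximum over `l ∈ [0,1]` of the forms `(1 - l²) α² + (2 + 2l) β²`
(`Qbar_eq`, `quad_le_Qbar`). Freezing the optimal `l` at a weak limit and linearizing the form gives
weak lower semicontinuity (`eventually_energy_le_of_weak`). The regularized density differs from
`Qbar` by `O(δ)`, uniformly in its arguments (`abs_regularized_sub_Qbar_le`).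

Recovery: competitors carry no smooth approximations, and smoothing by convolution would destroy the
frame and ribbon constraints. Reparametrization respects both. `exists_timeChange_density` chooses a
time change that runs slowly where `|y''| + |b'|` is large and preserves both `L` and `∫ y'`. The
curve becomes Lipschitz, keeps all boundary values, and gains arbitrarily little energy
(`IsRibbonCurve.exists_bounded`). Nodal interpolants of a Lipschitz ribbon violate the constraints
by `O(h)` (`IsRibbonCurve.exists_interpolant`), so their penalty is `O(h²/ε₁ + h²/ε₂)`, and their
energies converge by dominated convergence (`exists_recovery`).

Rate and bounds: a unit director has `L²` norm `√L`, so the regularity factor in the rate hypothesis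
is bounded below and `h²/ε₂ → 0`. The approximated accumulation point is itself a ribbon
(`mem_ribbons_of_isSmoothApprox`). Comparing with its recovery sequence bounds the energies
eventually and makes the penalty integrals `O(ε₁)` and `O(ε₂)`.

Limits: weak convergence in `V` gives pointwise convergence of the continuous representatives of
`y'` and `b`. Unit length holds at the nodes and fails elsewhere by at most a multiple of `√h`; the
ribbon constraint passes to the limit as a product of a bounded, pointwise convergent factor and a
weakly convergent one (`ae_inner_eq_zero_of_weak`, `mem_ribbons_of_weak`). -/

/-- Integration by parts for a primitive against a `C¹` function vanishing at the endpoints. -/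
theorem integral_deriv_mul_primitive {L : ℝ} {w : ℝ → ℝ}
    (hw : IntervalIntegrable w volume 0 L) (c : ℝ) {φ : ℝ → ℝ} (hφ : ContDiff ℝ 1 φ)
    (h0 : φ 0 = 0) (h1 : φ L = 0) :
    ∫ x in 0..L, deriv φ x * (c + ∫ s in 0..x, w s) = -∫ x in 0..L, φ x * w x := by
  set W : ℝ → ℝ := fun x => c + ∫ s in 0..x, w s with hW
  have hWac : AbsolutelyContinuousOnInterval W 0 L := by
    have h2 := hw.absolutelyContinuousOnInterval_intervalIntegral (c := 0) left_mem_uIcc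
    have h3 : AbsolutelyContinuousOnInterval (fun _ : ℝ => c) 0 L :=
      (contDiff_const.contDiffOn).absolutelyContinuousOnInterval
    exact h3.fun_add h2
  have hφac : AbsolutelyContinuousOnInterval φ 0 L := hφ.contDiffOn.absolutelyContinuousOnInterval
  have hdφ : Continuous (deriv φ) := hφ.continuous_deriv le_rfl
  have hi1 : IntervalIntegrable (fun x => deriv φ x * W x) volume 0 L :=
    (hdφ.continuousOn.mul hWac.continuousOn).intervalIntegrable
  have hi2 : IntervalIntegrable (fun x => φ x * w x) volume 0 L :=
    hw.continuousOn_mul hφ.continuous.continuousOn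
  have hi : IntervalIntegrable (fun x => deriv φ x * W x + φ x * w x) volume 0 L := hi1.add hi2
  -- The product minus the integral of its formal derivative is absolutely continuous with
  -- derivative zero almost everywhere, hence constant; comparing the two endpoints gives the
  -- formula.
  have hac := (hφac.fun_mul hWac).fun_sub
    (hi.absolutelyContinuousOnInterval_intervalIntegral (c := 0) left_mem_uIcc)
  obtain ⟨C, hC⟩ := hac.const_of_ae_hasDerivAt_zero (by
    filter_upwards [hi.ae_hasDerivAt_integral, hw.ae_hasDerivAt_integral] with x hx1 hx2 hx
    have e1 := hx1 hx 0 left_mem_uIcc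
    have e2 : HasDerivAt W (w x) x := (hx2 hx 0 left_mem_uIcc).const_add c
    have e3 := ((hφ.differentiable one_ne_zero x).hasDerivAt.mul e2).sub e1
    refine e3.congr_deriv ?_
    ring)
  have a0 := hC 0 left_mem_uIcc
  have aL := hC L right_mem_uIcc
  simp only [h0, h1, zero_mul, intervalIntegral.integral_same, sub_zero] at a0 aL
  rw [← a0, intervalIntegral.integral_add hi1 hi2] at aL
  linarith

theorem intervalIntegral_apply {a b : ℝ} {f : ℝ → R3} (hf : IntervalIntegrable f volume a b)
    (i : Fin 3) : (∫ x in a..b, f x) i = ∫ x in a..b, f x i :=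
  ((EuclideanSpace.proj (𝕜 := ℝ) i : R3 →L[ℝ] ℝ).intervalIntegral_comp_comm hf).symm

theorem IntervalIntegrable.apply {a b : ℝ} {f : ℝ → R3} (hf : IntervalIntegrable f volume a b)
    (i : Fin 3) : IntervalIntegrable (fun x => f x i) volume a b :=
  ⟨(EuclideanSpace.proj (𝕜 := ℝ) i : R3 →L[ℝ] ℝ).integrable_comp hf.1,
    (EuclideanSpace.proj (𝕜 := ℝ) i : R3 →L[ℝ] ℝ).integrable_comp hf.2⟩

theorem continuousOn_primitive {L : ℝ} {w : ℝ → R3} (hw : IntervalIntegrable w volume 0 L)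
    (c : R3) : ContinuousOn (fun x => c + ∫ s in 0..x, w s) (uIcc 0 L) := by
  refine continuousOn_const.add (intervalIntegral.continuousOn_primitive_interval' hw ?_)
  exact left_mem_uIcc

/-- Integration by parts for a vector-valued primitive. -/
theorem integral_deriv_smul_primitive {L : ℝ} {w : ℝ → R3}
    (hw : IntervalIntegrable w volume 0 L) (c : R3) {φ : ℝ → ℝ} (hφ : ContDiff ℝ 1 φ)
    (h0 : φ 0 = 0) (h1 : φ L = 0) :
    ∫ x in 0..L, deriv φ x • (c + ∫ s in 0..x, w s) = -∫ x in 0..L, φ x • w x := by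
  have hdφ : Continuous (deriv φ) := hφ.continuous_deriv le_rfl
  ext i
  have key := integral_deriv_mul_primitive (IntervalIntegrable.apply hw i) (c i) hφ h0 h1
  have hi1 : IntervalIntegrable (fun x => deriv φ x • (c + ∫ s in 0..x, w s)) volume 0 L :=
    (hdφ.continuousOn.smul (continuousOn_primitive hw c)).intervalIntegrable
  rw [PiLp.neg_apply, intervalIntegral_apply hi1,
    intervalIntegral_apply (hw.continuousOn_smul hφ.continuous.continuousOn)]
  simp only [PiLp.smul_apply, PiLp.add_apply, smul_eq_mul]
  rw [← key]
  refine intervalIntegral.integral_congr fun x hx => ?_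
  simp only
  rw [intervalIntegral_apply (hw.mono_set (uIcc_subset_uIcc left_mem_uIcc hx))]

theorem integral_leb {L : ℝ} (hL : 0 < L) {E : Type*} [NormedAddCommGroup E] [NormedSpace ℝ E]
    (f : ℝ → E) : ∫ x, f x ∂(leb L) = ∫ x in 0..L, f x := by
  rw [intervalIntegral.integral_of_le hL.le, integral_Ioc_eq_integral_Ioo]

theorem intervalIntegrable_iff_integrable_leb {L : ℝ} (hL : 0 < L) {E : Type*}
    [NormedAddCommGroup E] {f : ℝ → E} :
    IntervalIntegrable f volume 0 L ↔ Integrable f (leb L) := by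
  rw [intervalIntegrable_iff_integrableOn_Ioo_of_le hL.le]; rfl

theorem integrable_L2 {L : ℝ} (u : L2 L) : Integrable u (leb L) :=
  (Lp.memLp u).integrable (by norm_num)

theorem intervalIntegrable_L2 {L : ℝ} (hL : 0 < L) (u : L2 L) :
    IntervalIntegrable u volume 0 L :=
  (intervalIntegrable_iff_integrable_leb hL).2 (integrable_L2 u)

/-- A primitive has the integrand as weak derivative. -/
theorem isWeakDeriv_of_primitive {L : ℝ} (hL : 0 < L) {u v : L2 L} {w : ℝ → R3} {c : R3}
    (hu : u =ᵐ[leb L] fun x => c + ∫ s in 0..x, w s) (hv : v =ᵐ[leb L] w) :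
    IsWeakDeriv u v := by
  intro φ h1 h2 h3
  have hw : IntervalIntegrable w volume 0 L :=
    (intervalIntegrable_iff_integrable_leb hL).2 ((integrable_L2 v).congr hv)
  have hz : ∀ x, x ∉ Ioo 0 L → φ x = 0 := fun x hx =>
    image_eq_zero_of_notMem_tsupport fun h => hx (h3 h)
  have key := integral_deriv_smul_primitive hw c (h1.of_le (by simp)) (hz 0 (by simp))
    (hz L (by simp))
  rw [← integral_leb hL, ← integral_leb hL] at key
  have e1 : ∫ x, deriv φ x • u x ∂(leb L)
      = ∫ x, deriv φ x • (c + ∫ s in 0..x, w s) ∂(leb L) :=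
    integral_congr_ae (hu.mono fun x hx => congrArg (deriv φ x • ·) hx)
  have e2 : ∫ x, φ x • v x ∂(leb L) = ∫ x, φ x • w x ∂(leb L) :=
    integral_congr_ae (hv.mono fun x hx => congrArg (φ x • ·) hx)
  rw [e1, key, e2]

/-- The du Bois-Reymond lemma. -/
theorem ae_eq_const_of_integral_deriv_smul_eq_zero {L : ℝ} (hL : 0 < L) {f : ℝ → R3}
    (hf : Integrable f (leb L))
    (h : ∀ φ : ℝ → ℝ, ContDiff ℝ ∞ φ → HasCompactSupport φ → tsupport φ ⊆ Ioo 0 L →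
      ∫ x, deriv φ x • f x ∂(leb L) = 0) : ∃ c : R3, f =ᵐ[leb L] fun _ => c := by
  obtain ⟨χ, hχs, hχc, hχd, hχi⟩ : ∃ χ : ℝ → ℝ, tsupport χ ⊆ Ioo 0 L ∧ HasCompactSupport χ ∧
      ContDiff ℝ ∞ χ ∧ ∫ x, χ x = 1 := by
    let B : ContDiffBump (L / 2) := ⟨L / 8, L / 4, by linarith, by linarith⟩
    refine ⟨B.normed volume, ?_, B.hasCompactSupport_normed, B.contDiff_normed,
      B.integral_normed⟩
    rw [B.tsupport_normed_eq, Real.closedBall_eq_Icc]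
    intro x hx
    constructor
    · have := hx.1; change L / 2 - L / 4 ≤ x at this; linarith
    · have := hx.2; change x ≤ L / 2 + L / 4 at this; linarith
  set c : R3 := ∫ x, χ x • f x ∂(leb L) with hc
  refine ⟨c, ?_⟩
  have hfc : Integrable (fun x => f x - c) (leb L) := hf.sub (integrable_const c)
  have hloc : LocallyIntegrableOn (fun x => f x - c) (Ioo 0 L) volume :=
    IntegrableOn.locallyIntegrableOn hfc
  have hbs : ∀ ψ : ℝ → ℝ, ContDiff ℝ ∞ ψ → HasCompactSupport ψ →
      ∀ g : ℝ → R3, Integrable g (leb L) → Integrable (fun x => ψ x • g x) (leb L) := by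
    intro ψ hψ hψc g hg
    obtain ⟨C, hC⟩ := hψ.continuous.bounded_above_of_compact_support hψc
    exact hg.bdd_smul C hψ.continuous.aestronglyMeasurable (Filter.Eventually.of_forall hC)
  have := isOpen_Ioo.ae_eq_zero_of_integral_contDiff_smul_eq_zero hloc (fun ψ hψ hψc hψs => by
    set I : ℝ := ∫ x, ψ x with hI
    -- Subtracting `I * χ` makes `θ` mean-free, so its primitive `φ` again has compact support in
    -- the open interval and may be used in the hypothesis. The term `I * χ` then produces the
    -- constant `c`.
    set θ : ℝ → ℝ := fun x => ψ x - I * χ x with hθ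
    have hθd : ContDiff ℝ ∞ θ := hψ.sub (contDiff_const.mul hχd)
    set φ : ℝ → ℝ := fun x => ∫ s in 0..x, θ s with hφ
    have hφ' : ∀ x, HasDerivAt φ (θ x) x := fun x =>
      intervalIntegral.integral_hasDerivAt_right (hθd.continuous.intervalIntegrable _ _)
        hθd.continuous.stronglyMeasurable.stronglyMeasurableAtFilter hθd.continuous.continuousAt
    have hdφ : deriv φ = θ := funext fun x => (hφ' x).deriv
    have hφd : ContDiff ℝ ∞ φ := by
      rw [contDiff_infty_iff_deriv]
      exact ⟨fun x => (hφ' x).differentiableAt, hdφ ▸ hθd⟩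
    have hK : IsCompact (tsupport ψ ∪ tsupport χ) := hψc.isCompact.union hχc.isCompact
    have hKs : tsupport ψ ∪ tsupport χ ⊆ Ioo 0 L := union_subset hψs hχs
    obtain ⟨a, b, ha, hab, hb, hKab⟩ : ∃ a b, 0 < a ∧ a ≤ b ∧ b < L ∧
        tsupport ψ ∪ tsupport χ ⊆ Icc a b := by
      have hne : (tsupport ψ ∪ tsupport χ).Nonempty := by
        by_contra hcon
        -- The union of supports is nonempty even if `ψ = 0`, because `χ` has integral one.
        rw [not_nonempty_iff_eq_empty, union_empty_iff] at hcon
        have : χ = 0 := tsupport_eq_empty_iff.1 hcon.2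
        simp [this] at hχi
      have h1 := hKs (hK.sInf_mem hne)
      have h2 := hKs (hK.sSup_mem hne)
      exact ⟨_, _, h1.1, csInf_le_csSup hne hK.bddBelow hK.bddAbove, h2.2,
        fun x hx => ⟨csInf_le hK.bddBelow hx, le_csSup hK.bddAbove hx⟩⟩
    have hθ0 : ∀ x, x ∉ Icc a b → θ x = 0 := by
      intro x hx
      have h1 : ψ x = 0 := image_eq_zero_of_notMem_tsupport fun h => hx (hKab (Or.inl h))
      have h2 : χ x = 0 := image_eq_zero_of_notMem_tsupport fun h => hx (hKab (Or.inr h))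
      simp [hθ, h1, h2]
    have hθint : ∫ x, θ x = 0 := by
      rw [hθ, integral_sub (hψ.continuous.integrable_of_hasCompactSupport hψc)
        ((hχd.continuous.integrable_of_hasCompactSupport hχc).const_mul _),
        integral_const_mul, hχi, mul_one, sub_self]
    have hφ0 : ∀ x, x ∉ Icc a b → φ x = 0 := by
      intro x hx
      rcases lt_or_ge x a with hxa | hxa
      · rw [hφ]
        refine intervalIntegral.integral_zero_ae (Eventually.of_forall fun s hs => hθ0 s ?_)
        intro hs'
        have : s ≤ max 0 x := hs.2
        have := max_lt ha hxa
        linarith [hs'.1]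
      · have hxb : b < x := by
          by_contra hcon
          exact hx ⟨hxa, not_lt.1 hcon⟩
        change ∫ s in 0..x, θ s = 0
        rw [intervalIntegral.integral_of_le (by linarith), ← hθint]
        refine setIntegral_eq_integral_of_forall_compl_eq_zero fun s hs => hθ0 s fun hs' => hs ?_
        exact ⟨by linarith [hs'.1], by linarith [hs'.2]⟩
    have hφt : tsupport φ ⊆ Icc a b := by
      refine closure_minimal (fun x hx => ?_) isClosed_Icc
      by_contra hcon
      exact hx (hφ0 x hcon)
    have hφc : HasCompactSupport φ := isCompact_Icc.of_isClosed_subset (isClosed_tsupport _) hφt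
    have e1 := h φ hφd hφc (hφt.trans (Icc_subset_Ioo ha hb))
    rw [hdφ] at e1
    have hI' : I = ∫ x, ψ x ∂(leb L) := by
      rw [hI]
      symm
      refine setIntegral_eq_integral_of_forall_compl_eq_zero fun s hs => ?_
      exact image_eq_zero_of_notMem_tsupport fun h => hs (hψs h)
    have e2 : ∫ x, ψ x • (f x - c) = ∫ x, ψ x • (f x - c) ∂(leb L) := by
      symm
      refine setIntegral_eq_integral_of_forall_compl_eq_zero fun s hs => ?_
      rw [image_eq_zero_of_notMem_tsupport fun h => hs (hψs h), zero_smul]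
    rw [e2]
    simp only [hθ, sub_smul, mul_smul] at e1
    rw [integral_sub (hbs ψ hψ hψc f hf) (Integrable.fun_smul I (hbs χ hχd hχc f hf)),
      integral_smul] at e1
    simp only [smul_sub]
    rw [integral_sub (hbs ψ hψ hψc f hf) (hbs ψ hψ hψc _ (integrable_const c)),
      integral_smul_const, ← hI']
    exact e1)
  rw [EventuallyEq, ae_restrict_iff' measurableSet_Ioo]
  filter_upwards [this] with x hx hx'
  exact sub_eq_zero.1 (hx hx')

/-- A weakly differentiable function is a primitive of its weak derivative. -/
theorem IsWeakDeriv.exists_ae_eq_primitive {L : ℝ} (hL : 0 < L) {u v : L2 L}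
    (h : IsWeakDeriv u v) : ∃ c : R3, u =ᵐ[leb L] fun x => c + ∫ s in 0..x, v s := by
  have hv := intervalIntegrable_L2 hL v
  have hcont : ContinuousOn (fun x => ∫ s in 0..x, v s) (uIcc 0 L) := by
    simpa using continuousOn_primitive hv 0
  have hpi : Integrable (fun x => ∫ s in 0..x, v s) (leb L) :=
    (intervalIntegrable_iff_integrable_leb hL).1 hcont.intervalIntegrable
  obtain ⟨c, hc⟩ := ae_eq_const_of_integral_deriv_smul_eq_zero hL ((integrable_L2 u).sub hpi)
    (fun φ h1 h2 h3 => by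
      have hz : ∀ x, x ∉ Ioo 0 L → φ x = 0 := fun x hx =>
        image_eq_zero_of_notMem_tsupport fun h => hx (h3 h)
      have key := integral_deriv_smul_primitive hv 0 (h1.of_le (by simp)) (hz 0 (by simp))
        (hz L (by simp))
      rw [← integral_leb hL, ← integral_leb hL] at key
      simp only [zero_add] at key
      simp only [Pi.sub_apply, smul_sub]
      rw [integral_sub, h φ h1 h2 h3, key, sub_self]
      · exact integrable_smul_of_test (h1.continuous_deriv (by simp)) h2.deriv u
      · obtain ⟨C, hC⟩ := (h1.continuous_deriv (by simp)).bounded_above_of_compact_support h2.deriv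
        exact hpi.bdd_smul C (h1.continuous_deriv (by simp)).aestronglyMeasurable
          (Filter.Eventually.of_forall hC))
  refine ⟨c, ?_⟩
  filter_upwards [hc] with x hx
  rw [← hx]
  simp

/-- Functions that are continuous on `[0,L]` and agree almost everywhere agree on `[0,L]`. -/
theorem eqOn_Icc_of_ae_eq {L : ℝ} (hL : 0 < L) {E : Type*} [NormedAddCommGroup E] {f g : ℝ → E}
    (hf : ContinuousOn f (Icc 0 L)) (hg : ContinuousOn g (Icc 0 L)) (h : f =ᵐ[leb L] g) :
    EqOn f g (Icc 0 L) := by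
  have h1 : EqOn f g (Ioo 0 L) :=
    Measure.eqOn_of_ae_eq h (hf.mono Ioo_subset_Icc_self) (hg.mono Ioo_subset_Icc_self)
      (by rw [interior_Ioo]; exact subset_closure)
  refine h1.of_subset_closure hf hg Ioo_subset_Icc_self ?_
  rw [closure_Ioo hL.ne]


/-! ### The corrected Sadowsky density -/

/-- The parameter at which the quadratic forms `(1 - l²) α² + (2 + 2l) β²`, `l ∈ [0,1]`, attain
their maximum. -/
def lam (α β : ℝ) : ℝ := if |β| ≤ |α| then β ^ 2 / α ^ 2 else 1

theorem lam_nonneg (α β : ℝ) : 0 ≤ lam α β := by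
  unfold lam; split_ifs <;> positivity

theorem lam_le_one (α β : ℝ) : lam α β ≤ 1 := by
  unfold lam
  split_ifs with h
  · exact div_le_one_of_le₀ (sq_le_sq.2 h) (sq_nonneg _)
  · exact le_rfl

theorem Qbar_eq (α β : ℝ) :
    Qbar α β = (1 - lam α β ^ 2) * α ^ 2 + (2 + 2 * lam α β) * β ^ 2 := by
  unfold Qbar lam
  split_ifs with h
  · rcases eq_or_ne α 0 with rfl | h0
    · have : β = 0 := by simpa using h
      simp [this]
    · field_simp
      ring
  · ring

/-- The forms are concave in `l`, with critical point `β²/α²`. The gap is `(l α² - β²)²/α²` on the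
first branch and at least `(1 - l)² β²` on the second. Everything about `Qbar` below comes from this
envelope rather than from its two branches. -/
theorem quad_le_Qbar {l : ℝ} (h0 : 0 ≤ l) (h1 : l ≤ 1) (α β : ℝ) :
    (1 - l ^ 2) * α ^ 2 + (2 + 2 * l) * β ^ 2 ≤ Qbar α β := by
  unfold Qbar
  split_ifs with h
  · rcases eq_or_ne α 0 with rfl | ha
    · have : β = 0 := by simpa using h
      simp [this]
    · rw [le_div_iff₀ (by positivity)]
      nlinarith [sq_nonneg (l * α ^ 2 - β ^ 2)]
  · have hb : α ^ 2 ≤ β ^ 2 := sq_le_sq.2 (not_le.1 h).le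
    nlinarith [mul_nonneg (sub_nonneg.2 h1) (sub_nonneg.2 h1), sq_nonneg α, sq_nonneg β,
      mul_le_mul_of_nonneg_left hb (by nlinarith : 0 ≤ 1 - l ^ 2), mul_nonneg
        (mul_nonneg (sub_nonneg.2 h1) (sub_nonneg.2 h1)) (sq_nonneg β)]

theorem Qbar_nonneg (α β : ℝ) : 0 ≤ Qbar α β :=
  le_trans (by positivity) (quad_le_Qbar le_rfl zero_le_one α β)

theorem sq_add_le_Qbar (α β : ℝ) : α ^ 2 + 2 * β ^ 2 ≤ Qbar α β := by
  simpa using quad_le_Qbar le_rfl zero_le_one α β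

theorem Qbar_le (α β : ℝ) : Qbar α β ≤ α ^ 2 + 4 * β ^ 2 := by
  rw [Qbar_eq]
  nlinarith [mul_nonneg (sq_nonneg (lam α β)) (sq_nonneg α),
    mul_nonneg (sub_nonneg.2 (lam_le_one α β)) (sq_nonneg β)]

/-- The parameter optimal at `(α, β)` is a competitor at `(α', β')`, so only one quadratic form has
to be compared at two points. Its coefficients lie in `[0,1]` and `[0,4]`. -/
theorem Qbar_sub_le (α β α' β' : ℝ) :
    Qbar α β - Qbar α' β' ≤ |α ^ 2 - α' ^ 2| + 4 * |β ^ 2 - β' ^ 2| := by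
  have h := quad_le_Qbar (lam_nonneg α β) (lam_le_one α β) α' β'
  have h0 := lam_nonneg α β
  have h1 := lam_le_one α β
  rw [Qbar_eq α β]
  have e1 : (1 - lam α β ^ 2) * (α ^ 2 - α' ^ 2) ≤ |α ^ 2 - α' ^ 2| := by
    calc _ ≤ (1 - lam α β ^ 2) * |α ^ 2 - α' ^ 2| :=
          mul_le_mul_of_nonneg_left (le_abs_self _) (by nlinarith)
      _ ≤ 1 * |α ^ 2 - α' ^ 2| := mul_le_mul_of_nonneg_right (by nlinarith) (abs_nonneg _)
      _ = _ := one_mul _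
  have e2 : (2 + 2 * lam α β) * (β ^ 2 - β' ^ 2) ≤ 4 * |β ^ 2 - β' ^ 2| := by
    calc _ ≤ (2 + 2 * lam α β) * |β ^ 2 - β' ^ 2| :=
          mul_le_mul_of_nonneg_left (le_abs_self _) (by nlinarith)
      _ ≤ 4 * |β ^ 2 - β' ^ 2| := mul_le_mul_of_nonneg_right (by nlinarith) (abs_nonneg _)
  linarith

theorem abs_Qbar_sub_le (α β α' β' : ℝ) :
    |Qbar α β - Qbar α' β'| ≤ |α ^ 2 - α' ^ 2| + 4 * |β ^ 2 - β' ^ 2| := by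
  refine abs_sub_le_iff.2 ⟨Qbar_sub_le _ _ _ _, ?_⟩
  rw [abs_sub_comm, abs_sub_comm (β ^ 2)]
  exact Qbar_sub_le _ _ _ _

theorem continuous_Qbar : Continuous fun p : ℝ × ℝ => Qbar p.1 p.2 := by
  rw [continuous_iff_continuousAt]
  intro p
  rw [ContinuousAt, tendsto_iff_dist_tendsto_zero]
  refine squeeze_zero (fun _ => dist_nonneg) (fun q => (Real.dist_eq _ _).trans_le
    (abs_Qbar_sub_le q.1 q.2 p.1 p.2)) ?_
  have : Continuous fun q : ℝ × ℝ => |q.1 ^ 2 - p.1 ^ 2| + 4 * |q.2 ^ 2 - p.2 ^ 2| := by fun_prop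
  simpa using this.tendsto p

/-- Homogeneity of degree two makes a time change with density `ρ` turn the energy density into
`Qbar / ρ`. -/
theorem Qbar_mul (c α β : ℝ) : Qbar (c * α) (c * β) = c ^ 2 * Qbar α β := by
  rcases eq_or_ne c 0 with rfl | hc
  · simp [Qbar]
  · unfold Qbar
    simp only [abs_mul, mul_le_mul_iff_right₀ (abs_pos.2 hc)]
    split_ifs
    · rcases eq_or_ne α 0 with rfl | ha
      · simp
      · field_simp
    · ring

/-- The supporting quadratic form at `(p,q)` bounds the density from below by a linear
expression. -/
theorem Qbar_add_le {E : Type*} [NormedAddCommGroup E] [InnerProductSpace ℝ E] (p q p' q' : E) :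
    Qbar ‖p‖ ‖q‖ + 2 * (1 - lam ‖p‖ ‖q‖ ^ 2) * inner ℝ p (p' - p)
      + 2 * (2 + 2 * lam ‖p‖ ‖q‖) * inner ℝ q (q' - q) ≤ Qbar ‖p'‖ ‖q'‖ := by
  have h0 := lam_nonneg ‖p‖ ‖q‖
  have h1 := lam_le_one ‖p‖ ‖q‖
  refine le_trans ?_ (quad_le_Qbar h0 h1 ‖p'‖ ‖q'‖)
  have key : ∀ u v : E, ‖u‖ ^ 2 + 2 * inner ℝ u (v - u) ≤ ‖v‖ ^ 2 := by
    intro u v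
    have := norm_add_sq_real u (v - u)
    rw [add_sub_cancel] at this
    nlinarith [sq_nonneg ‖v - u‖]
  rw [Qbar_eq]
  nlinarith [mul_le_mul_of_nonneg_left (key p p') (by nlinarith : 0 ≤ 1 - lam ‖p‖ ‖q‖ ^ 2),
    mul_le_mul_of_nonneg_left (key q q') (by linarith : 0 ≤ 2 + 2 * lam ‖p‖ ‖q‖)]

/-- Since `r + s + |r - s|` is twice the maximum of `r` and `s`, the exact modulus reproduces
`Qbar`. For `M ≥ 0` the map `M ↦ M + 4s²/(r + s + M)` is Lipschitz with constant `1 + 4`, because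
`s/(r + s + M) ≤ 1`; the prefactor one half leaves `5/2`. -/
theorem abs_regularized_sub_Qbar_le {m : ℝ → ℝ → ℝ} {δ c : ℝ} (h0 : ∀ x, 0 ≤ m δ x)
    (hc : ∀ x, |m δ x - abs x| ≤ c * δ) (α β : ℝ) :
    |1 / 2 * (α ^ 2 + 5 * β ^ 2 + psi m δ (α ^ 2) (β ^ 2)) - Qbar α β| ≤ 5 / 2 * (c * δ) := by
  set r := α ^ 2 with hr
  set s := β ^ 2 with hs
  set M := m δ (r - s) with hM
  have hr0 : 0 ≤ r := sq_nonneg _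
  have hs0 : 0 ≤ s := sq_nonneg _
  have hM0 : 0 ≤ M := h0 _
  have hMc : |M - abs (r - s)| ≤ c * δ := hc _
  have hQ : Qbar α β = 1 / 2 * (r + 5 * s + (abs (r - s) + 4 * s ^ 2 / (r + s + abs (r - s)))) := by
    unfold Qbar
    simp only [← sq_le_sq, ← hr, ← hs]
    split_ifs with h
    · rw [abs_of_nonneg (sub_nonneg.2 h)]
      rcases eq_or_lt_of_le hr0 with h' | h'
      · have : s = 0 := by linarith
        simp [← h', this]
      · rw [show r + s + (r - s) = 2 * r by ring]
        field_simp
        ring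
    · have h' := not_le.1 h
      rw [abs_of_neg (by linarith)]
      have : 0 < s := by linarith
      rw [show r + s + -(r - s) = 2 * s by ring]
      field_simp
      ring
  have hdiff : |4 * s ^ 2 / (r + s + M) - 4 * s ^ 2 / (r + s + abs (r - s))| ≤ 4 * (c * δ) := by
    rcases eq_or_lt_of_le hs0 with h' | h'
    · rw [← h']
      simp only [ne_eq, OfNat.ofNat_ne_zero, not_false_eq_true, zero_pow, mul_zero, zero_div,
        sub_self, abs_zero]
      linarith [abs_nonneg (M - abs (r - s))]
    · have hA : 0 < r + s + M := by linarith
      have hB : 0 < r + s + abs (r - s) := by linarith [abs_nonneg (r - s)]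
      have e : 4 * s ^ 2 / (r + s + M) - 4 * s ^ 2 / (r + s + abs (r - s))
          = 4 * (s / (r + s + M)) * (s / (r + s + abs (r - s))) * (abs (r - s) - M) := by
        field_simp
        ring
      have q1 : s / (r + s + M) ≤ 1 := (div_le_one hA).2 (by linarith)
      have q2 : s / (r + s + abs (r - s)) ≤ 1 := (div_le_one hB).2 (by linarith [abs_nonneg (r - s)])
      have p1 : 0 ≤ s / (r + s + M) := by positivity
      have p2 : 0 ≤ s / (r + s + abs (r - s)) := by positivity
      rw [e, abs_mul, abs_of_nonneg (by positivity), abs_sub_comm (abs (r - s))]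
      have : s / (r + s + M) * (s / (r + s + abs (r - s))) ≤ 1 := mul_le_one₀ q1 p2 q2
      nlinarith [abs_nonneg (M - abs (r - s)), mul_le_mul_of_nonneg_right this
        (abs_nonneg (M - abs (r - s)))]
  rw [hQ, psi, ← hM]
  rw [abs_le] at *
  constructor <;> linarith [hMc.1, hMc.2, hdiff.1, hdiff.2]


/-! ### Change of the independent variable -/

/-- A density that is bounded from below defines a change of variables of the real line. -/
theorem exists_changeOfVariables {ρ : ℝ → ℝ} (hρ : ∀ z, 1 / 2 ≤ ρ z)
    (hi : ∀ a b, IntervalIntegrable ρ volume a b) :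
    ∃ ψ : ℝ ≃o ℝ, (∀ z, ψ z = ∫ s in 0..z, ρ s) ∧
      MeasurePreserving ψ (volume.withDensity fun z => ENNReal.ofReal (ρ z)) volume := by
  set F : ℝ → ℝ := fun z => ∫ s in 0..z, ρ s with hF
  have hsub : ∀ a b, F b - F a = ∫ s in a..b, ρ s := fun a b =>
    intervalIntegral.integral_interval_sub_left (hi _ _) (hi _ _)
  have hlow : ∀ a b, a ≤ b → 1 / 2 * (b - a) ≤ F b - F a := by
    intro a b hab
    rw [hsub]
    have := intervalIntegral.integral_mono_on hab (intervalIntegrable_const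
      (c := (1 / 2 : ℝ))) (hi a b) (fun z _ => hρ z)
    rw [intervalIntegral.integral_const, smul_eq_mul] at this
    linarith
  have hmono : StrictMono F := by
    intro a b hab
    have := hlow a b hab.le
    linarith
  have hF0 : F 0 = 0 := intervalIntegral.integral_same
  have hcont : Continuous F := intervalIntegral.continuous_primitive hi 0
  -- The lower bound on the density gives linear growth in both directions.
  have hsurj : Function.Surjective F := by
    refine hcont.surjective ?_ ?_
    · refine tendsto_atTop_mono' atTop ?_ (tendsto_id.const_mul_atTop (by norm_num : (0:ℝ) < 1 / 2))
      filter_upwards [eventually_ge_atTop 0] with z hz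
      have := hlow 0 z hz
      simp only [id]
      linarith
    · refine tendsto_atBot_mono' atBot ?_ (tendsto_id.const_mul_atBot (by norm_num : (0:ℝ) < 1 / 2))
      filter_upwards [eventually_le_atBot 0] with z hz
      have := hlow z 0 hz
      simp only [id]
      linarith
  set ψ : ℝ ≃o ℝ := hmono.orderIsoOfSurjective F hsurj with hψ
  have hψF : ∀ z, ψ z = F z := fun z => rfl
  have hmeas : Measurable ψ := ψ.toHomeomorph.continuous.measurable
  refine ⟨ψ, hψF, hmeas, ?_⟩
  symm
  refine Real.measure_ext_Ioo_rat fun a b => ?_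
  rw [Measure.map_apply hmeas measurableSet_Ioo,
    OrderIso.preimage_Ioo, withDensity_apply _ measurableSet_Ioo, Real.volume_Ioo]
  rcases le_total (b : ℝ) (a : ℝ) with hab | hab
  · rw [Ioo_eq_empty (not_lt.2 (ψ.symm.monotone hab)), ENNReal.ofReal_of_nonpos (by linarith)]
    simp
  · have hle := ψ.symm.monotone hab
    have hint : Integrable ρ (volume.restrict (Ioo (ψ.symm a) (ψ.symm b))) :=
      (intervalIntegrable_iff_integrableOn_Ioo_of_le hle).1 (hi _ _)
    rw [← ofReal_integral_eq_lintegral_ofReal hint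
      (Eventually.of_forall fun z => by have := hρ z; change 0 ≤ ρ z; linarith),
      ← integral_Ioc_eq_integral_Ioo, ← intervalIntegral.integral_of_le hle, ← hsub,
      ← hψF, ← hψF, ψ.apply_symm_apply, ψ.apply_symm_apply]

theorem OrderIso.measurableEmbedding_real (ψ : ℝ ≃o ℝ) : MeasurableEmbedding ψ :=
  ψ.toHomeomorph.measurableEmbedding

theorem integral_changeOfVariables {ρ : ℝ → ℝ} (hm : Measurable ρ) (hρ : ∀ z, 1 / 2 ≤ ρ z)
    {ψ : ℝ ≃o ℝ} (hψ : MeasurePreserving ψ (volume.withDensity fun z => ENNReal.ofReal (ρ z)) volume)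
    {E : Type*} [NormedAddCommGroup E] [NormedSpace ℝ E] (f : ℝ → E) {a b : ℝ} (hab : a ≤ b) :
    ∫ x in ψ a..ψ b, f x = ∫ z in a..b, ρ z • f (ψ z) := by
  rw [intervalIntegral.integral_of_le (ψ.monotone hab), intervalIntegral.integral_of_le hab,
    ← hψ.setIntegral_preimage_emb (OrderIso.measurableEmbedding_real ψ), OrderIso.preimage_Ioc,
    ψ.symm_apply_apply, ψ.symm_apply_apply, restrict_withDensity measurableSet_Ioc,
    integral_withDensity_eq_integral_toReal_smul hm.ennreal_ofReal
      (Eventually.of_forall fun _ => ENNReal.ofReal_lt_top)]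
  refine integral_congr_ae (Eventually.of_forall fun z => ?_)
  simp only
  rw [ENNReal.toReal_ofReal (by linarith [hρ z])]

/-- Lebesgue measure is the image under `ψ` of a measure that is absolutely continuous with respect
to Lebesgue measure, so null sets in the old parameter become null sets in the new one. -/
theorem ae_changeOfVariables {ρ : ℝ → ℝ} {ψ : ℝ ≃o ℝ}
    (hψ : MeasurePreserving ψ (volume.withDensity fun z => ENNReal.ofReal (ρ z)) volume)
    {P : ℝ → Prop} (h : ∀ᵐ z, P (ψ z)) : ∀ᵐ x, P x := by
  rw [← hψ.map_eq, (OrderIso.measurableEmbedding_real ψ).ae_map_iff]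
  exact withDensity_absolutelyContinuous _ _ h


/-- Least squares approximation by finitely many square-integrable functions. -/
theorem exists_leastSquares {α ι : Type*} [MeasurableSpace α] [Fintype ι] {μ : Measure α}
    {f : ι → α → ℝ} {G : α → ℝ} (hf : ∀ i, MemLp (f i) 2 μ) (hG : MemLp G 2 μ) :
    ∃ c : ι → ℝ, ∀ j, ∫ x, (G x - ∑ i, c i * f i x) * f j x ∂μ = 0 := by
  set e : ι → Lp ℝ 2 μ := fun i => (hf i).toLp (f i) with he
  set S : Submodule ℝ (Lp ℝ 2 μ) := Submodule.span ℝ (range e) with hS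
  have : FiniteDimensional ℝ S := FiniteDimensional.span_of_finite ℝ (finite_range e)
  set g : Lp ℝ 2 μ := hG.toLp G with hg
  have hmem : S.starProjection g ∈ S := Submodule.starProjection_apply_mem S g
  obtain ⟨c, hc⟩ := (Submodule.mem_span_range_iff_exists_fun ℝ).1 hmem
  refine ⟨c, fun j => ?_⟩
  have hj : inner ℝ (g - S.starProjection g) (e j) = 0 :=
    Submodule.starProjection_inner_eq_zero g (e j) (Submodule.subset_span (mem_range_self j))
  have hcoe : (∑ i, c i • e i : Lp ℝ 2 μ) =ᵐ[μ] fun x => ∑ i, c i * f i x := by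
    have h1 : ∀ s : Finset ι, (∑ i ∈ s, c i • e i : Lp ℝ 2 μ) =ᵐ[μ] fun x => ∑ i ∈ s, c i * f i x := by
      intro s
      induction s using Finset.cons_induction with
      | empty =>
        simp only [Finset.sum_empty]
        exact Lp.coeFn_zero ℝ 2 μ
      | cons a s ha ih =>
        rw [Finset.sum_cons]
        filter_upwards [Lp.coeFn_add (c a • e a) (∑ i ∈ s, c i • e i), ih, Lp.coeFn_smul (c a) (e a),
          (hf a).coeFn_toLp] with x h1 h2 h3 h4
        rw [h1, Pi.add_apply, h2, h3, Finset.sum_cons, Pi.smul_apply, he]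
        simp only [h4, smul_eq_mul]
    exact h1 Finset.univ
  rw [L2.inner_def] at hj
  rw [← hj]
  refine integral_congr_ae ?_
  filter_upwards [Lp.coeFn_sub g (S.starProjection g), hG.coeFn_toLp, (hf j).coeFn_toLp,
    hc ▸ hcoe] with x h1 h2 h3 h4
  rw [h1, Pi.sub_apply, hg, h2, h4, he, h3]
  simp [mul_comm]


/-! ### Framed curves and their approximation by Lipschitz continuous ones -/

/-- An orthonormal pair `(t,b)` of curves on `[0,L]` with square-integrable derivatives `(p,q)`
that satisfies the ribbon constraint `t · b' = 0`. -/
structure IsRibbonCurve (L : ℝ) (t b p q : ℝ → R3) : Prop where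
  meas_p : StronglyMeasurable p
  meas_q : StronglyMeasurable q
  memLp_p : MemLp p 2 (leb L)
  memLp_q : MemLp q 2 (leb L)
  cont_t : Continuous t
  cont_b : Continuous b
  eq_t : ∀ x ∈ Icc 0 L, t x = t 0 + ∫ s in 0..x, p s
  eq_b : ∀ x ∈ Icc 0 L, b x = b 0 + ∫ s in 0..x, q s
  norm_t : ∀ x ∈ Icc 0 L, ‖t x‖ = 1
  norm_b : ∀ x ∈ Icc 0 L, ‖b x‖ = 1
  inner_t_b : ∀ x ∈ Icc 0 L, inner ℝ (t x) (b x) = 0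
  inner_t_q : ∀ᵐ x ∂(leb L), inner ℝ (t x) (q x) = 0

theorem integral_congr_Ioo {E : Type*} [NormedAddCommGroup E] [NormedSpace ℝ E] {f g : ℝ → E}
    {a b : ℝ} (hab : a ≤ b) (h : ∀ x ∈ Ioo a b, f x = g x) :
    ∫ x in a..b, f x = ∫ x in a..b, g x := by
  rw [intervalIntegral.integral_of_le hab, intervalIntegral.integral_of_le hab,
    integral_Ioc_eq_integral_Ioo, integral_Ioc_eq_integral_Ioo]
  exact setIntegral_congr_fun measurableSet_Ioo h

theorem integrable_Qbar {L : ℝ} {p q : ℝ → R3} (hp : MemLp p 2 (leb L)) (hq : MemLp q 2 (leb L)) :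
    Integrable (fun x => Qbar ‖p x‖ ‖q x‖) (leb L) := by
  have h1 := hp.integrable_norm_pow two_ne_zero
  have h2 := hq.integrable_norm_pow two_ne_zero
  refine (h1.add (h2.const_mul 4)).mono' ?_ (Eventually.of_forall fun x => ?_)
  · exact continuous_Qbar.comp_aestronglyMeasurable
      (hp.aestronglyMeasurable.norm.prodMk hq.aestronglyMeasurable.norm)
  · rw [Real.norm_of_nonneg (Qbar_nonneg _ _)]
    exact Qbar_le _ _

/-- The density is `1 + l (G - s)`, with `s` the `L²` projection of the speed `G` onto the span of
`1` and the components of `t`. Orthogonality of the residual preserves `∫ 1` and `∫ t`, that is, the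
parameter interval and the endpoint of `y`. As `s` is bounded and `G ≥ 0`, a small `l` keeps the
density close to or above one while it still dominates a multiple of `G`. -/
theorem exists_timeChange_density {L : ℝ} (hL : 0 < L) {t : ℝ → R3} (ht : Continuous t)
    {G : ℝ → ℝ} (hG : MemLp G 2 (leb L)) (hGm : StronglyMeasurable G) (hG0 : ∀ x, 0 ≤ G x)
    {e η : ℝ} (he : 0 ≤ e) (hη : 0 < η) :
    ∃ (κ M : ℝ) (ρ : ℝ → ℝ), 0 < κ ∧ e / κ ≤ e + η ∧ 0 < M ∧ Measurable ρ ∧ (∀ z, 1 / 2 ≤ ρ z) ∧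
      (∀ z ∈ Ioo 0 L, κ ≤ ρ z) ∧ (∀ z ∈ Ioo 0 L, G z ≤ M * ρ z) ∧
      (∀ a b, IntervalIntegrable ρ volume a b) ∧ ∫ z in 0..L, ρ z = L ∧
      ∫ z in 0..L, ρ z • t z = ∫ z in 0..L, t z := by
  set f : Fin 4 → ℝ → ℝ := Fin.cons (fun _ => 1) (fun i x => t x i) with hf
  have hfc : ∀ i, Continuous (f i) := by
    intro i
    refine Fin.cases ?_ (fun j => ?_) i
    · exact continuous_const
    · simp only [hf, Fin.cons_succ]
      fun_prop
  have hfL : ∀ i, MemLp (f i) 2 (leb L) := by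
    intro i
    obtain ⟨C, hC⟩ := isCompact_Icc.exists_bound_of_continuousOn (hfc i).continuousOn (s := Icc 0 L)
    refine MemLp.of_bound (hfc i).aestronglyMeasurable C ?_
    refine (ae_restrict_iff' measurableSet_Ioo).2 (Eventually.of_forall fun x hx => ?_)
    exact hC x (Ioo_subset_Icc_self hx)
  obtain ⟨c, hc⟩ := exists_leastSquares hfL hG
  set s : ℝ → ℝ := fun x => ∑ i, c i * f i x with hs
  have hsc : Continuous s := continuous_finsetSum _ fun i _ => (hfc i).const_mul (c i)
  obtain ⟨C, hC⟩ := isCompact_Icc.exists_bound_of_continuousOn hsc.continuousOn (s := Icc 0 L)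
  have hC0 : 0 ≤ C := (norm_nonneg _).trans (hC 0 ⟨le_rfl, hL.le⟩)
  have hC' : ∀ x ∈ Ioo 0 L, s x ≤ C := fun x hx =>
    (le_abs_self _).trans (hC x (Ioo_subset_Icc_self hx))
  -- Two smallness conditions are needed: `l C ≤ 1/2` for the lower bound of `ρ`, and `2 l C e ≤ η`,
  -- which together give `e / (1 - l C) ≤ e + η`.
  set l : ℝ := η / (2 * (C + 1) * (e + η + 1)) with hl
  have hl0 : 0 < l := by positivity
  have hlC : l * C ≤ 1 / 2 := by
    rw [hl, div_mul_eq_mul_div, div_le_iff₀ (by positivity)]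
    nlinarith [mul_nonneg hC0 he, mul_nonneg hη.le hC0]
  have hlCe : 2 * (l * C) * e ≤ η := by
    have : 2 * (l * C) * e = η * (2 * C * e) / (2 * (C + 1) * (e + η + 1)) := by
      rw [hl]; ring
    rw [this, div_le_iff₀ (by positivity)]
    refine mul_le_mul_of_nonneg_left ?_ hη.le
    nlinarith [mul_nonneg hC0 he, mul_nonneg hη.le hC0]
  have hGi : Integrable G (leb L) := hG.integrable (by norm_num)
  have hsi : Integrable s (leb L) :=
    (intervalIntegrable_iff_integrable_leb hL).1 (hsc.intervalIntegrable _ _)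
  have hi0 : Integrable (fun z => G z - s z) (leb L) := hGi.sub hsi
  set ρ : ℝ → ℝ := fun z => 1 + (Ioo 0 L).indicator (fun z => l * (G z - s z)) z with hρ
  have hρI : ∀ z ∈ Ioo 0 L, ρ z = 1 + l * (G z - s z) := fun z hz => by
    simp only [hρ, indicator_of_mem hz]
  have hκ : ∀ z ∈ Ioo 0 L, 1 - l * C ≤ ρ z := by
    intro z hz
    rw [hρI z hz]
    nlinarith [mul_nonneg hl0.le (hG0 z), mul_le_mul_of_nonneg_left (hC' z hz) hl0.le]
  -- The speed bound with `M = l⁻¹` reads `l G ≤ 1 + l (G - s)`, which holds because `l s ≤ l C <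
  -- 1`.
  refine ⟨1 - l * C, l⁻¹, ρ, by linarith, ?_, by positivity, ?_, ?_, hκ, ?_, ?_, ?_, ?_⟩
  · rw [div_le_iff₀ (by linarith)]
    nlinarith [mul_nonneg (mul_nonneg hl0.le hC0) he]
  · exact measurable_const.add
      (((hGm.measurable.sub hsc.measurable).const_mul l).indicator measurableSet_Ioo)
  · intro z
    by_cases hz : z ∈ Ioo 0 L
    · linarith [hκ z hz]
    · simp only [hρ, indicator_of_notMem hz]
      norm_num
  · intro z hz
    rw [hρI z hz, inv_mul_eq_div, le_div_iff₀ hl0]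
    nlinarith [mul_le_mul_of_nonneg_left (hC' z hz) hl0.le]
  · intro a b
    refine intervalIntegrable_const.add ?_
    exact ((integrable_indicator_iff measurableSet_Ioo).2 (hi0.const_mul l)).intervalIntegrable
  · rw [integral_congr_Ioo hL.le hρI, ← integral_leb hL, integral_add (integrable_const _)
      (hi0.const_mul l), integral_const_mul]
    have := hc 0
    simp only [hf, Fin.cons_zero, mul_one] at this
    rw [this, integral_leb hL, intervalIntegral.integral_const]
    simp
  · have h1 : ∀ z ∈ Ioo 0 L, ρ z • t z = t z + l • ((G z - s z) • t z) := fun z hz => by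
      rw [hρI z hz, add_smul, one_smul, mul_smul]
    have hii : IntervalIntegrable (fun z => (G z - s z) • t z) volume 0 L :=
      ((intervalIntegrable_iff_integrable_leb hL).2 hi0).smul_continuousOn ht.continuousOn
    have hii' : IntervalIntegrable (fun z => l • ((G z - s z) • t z)) volume 0 L := hii.smul l
    rw [integral_congr_Ioo hL.le h1, intervalIntegral.integral_add (ht.intervalIntegrable _ _) hii',
      intervalIntegral.integral_smul]
    have : ∫ z in 0..L, (G z - s z) • t z = 0 := by
      ext i
      rw [intervalIntegral_apply hii, ← integral_leb hL]
      simpa [hf] using hc i.succ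
    rw [this, smul_zero, add_zero]

/-- Unit length, orthogonality and `t · b' = 0` are invariant under reparametrization, so a time
change regularizes the curve without any projection back to the constraints. -/
theorem IsRibbonCurve.exists_bounded {L : ℝ} (hL : 0 < L) {t b p q : ℝ → R3}
    (h : IsRibbonCurve L t b p q) {η : ℝ} (hη : 0 < η) :
    ∃ (K : ℝ) (t' b' p' q' : ℝ → R3), IsRibbonCurve L t' b' p' q' ∧
      (∀ x, ‖p' x‖ ≤ K) ∧ (∀ x, ‖q' x‖ ≤ K) ∧ t' 0 = t 0 ∧ t' L = t L ∧ b' 0 = b 0 ∧ b' L = b L ∧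
      ∫ x in 0..L, t' x = ∫ x in 0..L, t x ∧
      ∫ x, Qbar ‖p' x‖ ‖q' x‖ ∂(leb L) ≤ ∫ x, Qbar ‖p x‖ ‖q x‖ ∂(leb L) + η := by
  have hQi := integrable_Qbar h.memLp_p h.memLp_q
  obtain ⟨κ, M, ρ, hκ0, hκ, hM, hρm, hρ2, hρκ, hρM, hρi, hρL, hρt⟩ :=
    exists_timeChange_density hL h.cont_t (G := fun x => ‖p x‖ + ‖q x‖)
      (h.memLp_p.norm.add h.memLp_q.norm) (h.meas_p.norm.add h.meas_q.norm)
      (fun x => by positivity) (integral_nonneg fun x => Qbar_nonneg ‖p x‖ ‖q x‖) hη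
  obtain ⟨ψ, hψ, hψm⟩ := exists_changeOfVariables hρ2 hρi
  have hρ0 : ∀ z, 0 < ρ z := fun z => by linarith [hρ2 z]
  have hψ0 : ψ 0 = 0 := by rw [hψ, intervalIntegral.integral_same]
  have hψL : ψ L = L := by rw [hψ, hρL]
  have hφ0 : ψ.symm 0 = 0 := by rw [OrderIso.symm_apply_eq, hψ0]
  have hφL : ψ.symm L = L := by rw [OrderIso.symm_apply_eq, hψL]
  have hφc : Continuous ψ.symm := ψ.symm.toHomeomorph.continuous
  have hφI : ∀ x ∈ Icc 0 L, ψ.symm x ∈ Icc 0 L := fun x hx =>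
    ⟨hφ0 ▸ ψ.symm.monotone hx.1, (ψ.symm.monotone hx.2).trans_eq hφL⟩
  -- Chain rule for `ψ.symm`: the derivative is divided by `ρ`. The indicator makes the bound by `M`
  -- hold on the whole line, since the estimate of `G` by `ρ` is only available on `(0,L)`.
  set D : (ℝ → R3) → ℝ → R3 := fun w x =>
    (ρ (ψ.symm x))⁻¹ • (Ioo 0 L).indicator w (ψ.symm x) with hD
  have hDm : ∀ w : ℝ → R3, StronglyMeasurable w → StronglyMeasurable (D w) := fun w hw =>
    ((hρm.comp hφc.measurable).inv.stronglyMeasurable).smul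
      ((hw.indicator measurableSet_Ioo).comp_measurable hφc.measurable)
  have hDψ : ∀ w : ℝ → R3, ∀ z ∈ Ioo 0 L, D w (ψ z) = (ρ z)⁻¹ • w z := fun w z hz => by
    simp only [hD, ψ.symm_apply_apply, indicator_of_mem hz]
  have hDb : ∀ w : ℝ → R3, (∀ x, ‖w x‖ ≤ ‖p x‖ + ‖q x‖) → ∀ x, ‖D w x‖ ≤ M := by
    intro w hw x
    by_cases hx : ψ.symm x ∈ Ioo 0 L
    · simp only [hD, indicator_of_mem hx, norm_smul, norm_inv, Real.norm_of_nonneg (hρ0 _).le]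
      rw [inv_mul_le_iff₀ (hρ0 _), mul_comm]
      exact (hw _).trans (hρM _ hx)
    · simp only [hD, indicator_of_notMem hx, smul_zero, norm_zero]
      exact hM.le
  have hp : ∀ x, ‖D p x‖ ≤ M := hDb p fun x => by linarith [norm_nonneg (q x)]
  have hq : ∀ x, ‖D q x‖ ≤ M := hDb q fun x => by linarith [norm_nonneg (p x)]
  have hDL : ∀ w : ℝ → R3, StronglyMeasurable w → (∀ x, ‖D w x‖ ≤ M) → MemLp (D w) 2 (leb L) :=
    fun w hw hb => MemLp.of_bound (hDm w hw).aestronglyMeasurable M (Eventually.of_forall hb)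
  have hDi : ∀ w : ℝ → R3, ∀ x ∈ Icc 0 L, ∫ s in 0..x, D w s = ∫ s in 0..ψ.symm x, w s := by
    intro w x hx
    have h1 := hφI x hx
    have h2 := integral_changeOfVariables hρm hρ2 hψm (D w) h1.1
    rw [hψ0, ψ.apply_symm_apply] at h2
    rw [h2]
    refine integral_congr_Ioo h1.1 fun z hz => ?_
    rw [hDψ w z ⟨hz.1, hz.2.trans_le h1.2⟩, smul_inv_smul₀ (hρ0 z).ne']
  refine ⟨M, t ∘ ψ.symm, b ∘ ψ.symm, D p, D q, ?_, hp, hq, ?_, ?_, ?_, ?_, ?_, ?_⟩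
  · exact
    { meas_p := hDm p h.meas_p
      meas_q := hDm q h.meas_q
      memLp_p := hDL p h.meas_p hp
      memLp_q := hDL q h.meas_q hq
      cont_t := h.cont_t.comp hφc
      cont_b := h.cont_b.comp hφc
      eq_t := fun x hx => by
        rw [Function.comp_apply, Function.comp_apply, hφ0, h.eq_t _ (hφI x hx), hDi p x hx]
      eq_b := fun x hx => by
        rw [Function.comp_apply, Function.comp_apply, hφ0, h.eq_b _ (hφI x hx), hDi q x hx]
      norm_t := fun x hx => h.norm_t _ (hφI x hx)
      norm_b := fun x hx => h.norm_b _ (hφI x hx)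
      inner_t_b := fun x hx => h.inner_t_b _ (hφI x hx)
      inner_t_q := by
        rw [ae_restrict_iff' measurableSet_Ioo]
        refine ae_changeOfVariables hψm ?_
        filter_upwards [(ae_restrict_iff' measurableSet_Ioo).1 h.inner_t_q] with z hz hz'
        have hz1 : z ∈ Ioo 0 L :=
          ⟨ψ.lt_iff_lt.1 (hψ0.symm ▸ hz'.1), ψ.lt_iff_lt.1 (hψL.symm ▸ hz'.2)⟩
        rw [hDψ q z hz1, Function.comp_apply, ψ.symm_apply_apply, inner_smul_right, hz hz1,
          mul_zero] }
  · rw [Function.comp_apply, hφ0]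
  · rw [Function.comp_apply, hφL]
  · rw [Function.comp_apply, hφ0]
  · rw [Function.comp_apply, hφL]
  · have h2 := integral_changeOfVariables hρm hρ2 hψm (t ∘ ψ.symm) hL.le
    rw [hψ0, hψL] at h2
    rw [h2, ← hρt]
    simp
  · have h2 := integral_changeOfVariables hρm hρ2 hψm (fun x => Qbar ‖D p x‖ ‖D q x‖) hL.le
    rw [hψ0, hψL] at h2
    refine le_trans ?_ hκ
    rw [integral_leb hL, h2, ← integral_leb hL, ← integral_div]
    -- The change of variables contributes a factor `ρ` and homogeneity a factor `ρ⁻²`, so the new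
    -- energy is `∫ Qbar / ρ`, at most the old one divided by `κ`.
    refine integral_mono_of_nonneg (Eventually.of_forall fun z =>
      smul_nonneg (hρ0 z).le (Qbar_nonneg _ _)) (hQi.div_const κ) ?_
    refine (ae_restrict_iff' measurableSet_Ioo).2 (Eventually.of_forall fun z hz => ?_)
    simp only
    rw [hDψ p z hz, hDψ q z hz, norm_smul, norm_smul, Qbar_mul, norm_inv,
      Real.norm_of_nonneg (hρ0 z).le, smul_eq_mul,
      show ρ z * ((ρ z)⁻¹ ^ 2 * Qbar ‖p z‖ ‖q z‖) = Qbar ‖p z‖ ‖q z‖ / ρ z by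
        have := (hρ0 z).ne'
        field_simp]
    exact div_le_div_of_nonneg_left (Qbar_nonneg _ _) hκ0 (hρκ z hz)


/-! ### Partitionings and piecewise defined functions -/

namespace Mesh

variable {L : ℝ} (T : Mesh L)

theorem node_lt (j : Fin T.N) : T.node j.castSucc < T.node j.succ :=
  T.strictMono j.castSucc_lt_succ

theorem len_pos (j : Fin T.N) : 0 < T.len j := sub_pos.2 (T.node_lt j)

theorem len_le_size (j : Fin T.N) : T.len j ≤ T.size :=
  le_ciSup (finite_range T.len).bddAbove j

theorem node_nonneg (j : Fin (T.N + 1)) : 0 ≤ T.node j := by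
  rw [← T.first]
  exact T.strictMono.monotone (Fin.zero_le j)

theorem node_le (j : Fin (T.N + 1)) : T.node j ≤ L := by
  conv_rhs => rw [← T.last]
  exact T.strictMono.monotone (Fin.le_last j)

theorem node_mem_Icc (j : Fin (T.N + 1)) : T.node j ∈ Icc 0 L := ⟨T.node_nonneg j, T.node_le j⟩

theorem Icc_subset (j : Fin T.N) : Icc (T.node j.castSucc) (T.node j.succ) ⊆ Icc 0 L :=
  Icc_subset_Icc (T.node_nonneg _) (T.node_le _)

theorem len_le (j : Fin T.N) : T.len j ≤ L := by
  have h1 := T.node_nonneg j.castSucc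
  have h2 := T.node_le j.succ
  unfold len
  linarith

theorem exists_mem_Ico {x : ℝ} (hx : x ∈ Ico 0 L) :
    ∃ j : Fin T.N, x ∈ Ico (T.node j.castSucc) (T.node j.succ) := by
  have key : ∀ i : Fin (T.N + 1), x < T.node i →
      ∃ j : Fin T.N, x ∈ Ico (T.node j.castSucc) (T.node j.succ) := by
    intro i
    induction i using Fin.induction with
    | zero => intro h; rw [T.first] at h; exact absurd hx.1 (not_le.2 h)
    | succ j ih =>
      intro h
      rcases lt_or_ge x (T.node j.castSucc) with h' | h'
      · exact ih h'
      · exact ⟨j, h', h⟩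
  exact key (Fin.last _) (by rw [T.last]; exact hx.2)

/-- The piecewise function that equals `f j` on the `j`-th element. -/
def piecewise (f : Fin T.N → ℝ → R3) (x : ℝ) : R3 :=
  ∑ j, (Ico (T.node j.castSucc) (T.node j.succ)).indicator (f j) x

theorem piecewise_eq (f : Fin T.N → ℝ → R3) {j : Fin T.N} {x : ℝ}
    (hx : x ∈ Ico (T.node j.castSucc) (T.node j.succ)) : T.piecewise f x = f j x := by
  unfold piecewise
  rw [Finset.sum_eq_single j]
  · exact indicator_of_mem hx _
  · intro i _ hij
    refine indicator_of_notMem (fun hi => ?_) _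
    rcases lt_or_gt_of_ne hij with h | h
    · have h1 : T.node i.succ ≤ T.node j.castSucc :=
        T.strictMono.monotone (Fin.succ_le_castSucc_iff.2 h)
      linarith [hi.2, hx.1]
    · have h1 : T.node j.succ ≤ T.node i.castSucc :=
        T.strictMono.monotone (Fin.succ_le_castSucc_iff.2 h)
      linarith [hx.2, hi.1]
  · simp

theorem intervalIntegrable_of_subset {w : ℝ → R3} (hw : IntervalIntegrable w volume 0 L) {a b : ℝ}
    (ha : a ∈ Icc 0 L) (hb : b ∈ Icc 0 L) : IntervalIntegrable w volume a b :=
  hw.mono_set (uIcc_subset_uIcc (Icc_subset_uIcc ha) (Icc_subset_uIcc hb))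

/-- A primitive of a piecewise function, computed on the elements. -/
theorem primitive_eq {w g : ℝ → R3} (hw : IntervalIntegrable w volume 0 L)
    {f F : Fin T.N → ℝ → R3}
    (hwf : ∀ j, ∀ x ∈ Ioo (T.node j.castSucc) (T.node j.succ), w x = f j x)
    (hF : ∀ j x, HasDerivAt (F j) (f j x) x) (hf : ∀ j, Continuous (f j))
    (h0 : ∀ j, F j (T.node j.castSucc) = g (T.node j.castSucc))
    (h1 : ∀ j, F j (T.node j.succ) = g (T.node j.succ)) (j : Fin T.N) {x : ℝ}
    (hx : x ∈ Icc (T.node j.castSucc) (T.node j.succ)) :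
    g 0 + ∫ s in 0..x, w s = F j x := by
  have hloc : ∀ j, ∀ x ∈ Icc (T.node j.castSucc) (T.node j.succ),
      ∫ s in T.node j.castSucc..x, w s = F j x - F j (T.node j.castSucc) := by
    intro j x hx
    rw [integral_congr_Ioo hx.1 fun s hs => hwf j s ⟨hs.1, hs.2.trans_le hx.2⟩]
    exact intervalIntegral.integral_eq_sub_of_hasDerivAt (fun s _ => hF j s)
      ((hf j).intervalIntegrable _ _)
  have hL : (0 : ℝ) ∈ Icc 0 L := ⟨le_rfl, (T.node_nonneg 0).trans (T.node_le 0)⟩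
  have hstep : ∀ j, ∀ x ∈ Icc (T.node j.castSucc) (T.node j.succ),
      ∫ s in 0..x, w s = (∫ s in 0..T.node j.castSucc, w s) + (F j x - g (T.node j.castSucc)) := by
    intro j x hx
    rw [← h0 j, ← hloc j x hx]
    exact (intervalIntegral.integral_add_adjacent_intervals
      (intervalIntegrable_of_subset hw hL (T.node_mem_Icc _))
      (intervalIntegrable_of_subset hw (T.node_mem_Icc _) (T.Icc_subset j hx))).symm
  -- The element formulas match `g` at both ends, so the primitive telescopes to `g` at every node.
  have hnode : ∀ i : Fin (T.N + 1), ∫ s in 0..T.node i, w s = g (T.node i) - g 0 := by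
    intro i
    induction i using Fin.induction with
    | zero => rw [T.first, intervalIntegral.integral_same, sub_self]
    | succ j ih =>
      rw [hstep j _ ⟨(T.node_lt j).le, le_rfl⟩, ih, h1 j]
      abel
  rw [hstep j x hx, hnode]
  abel

end Mesh

/-! ### Cubic Hermite interpolation on one element -/

/-- The second derivative of the cubic Hermite interpolant on `[a,c]` of a function with first
derivative `ta` and `tc` at the endpoints and difference quotient `m`. -/
def hermiteDD (a c : ℝ) (ta tc m : R3) (x : ℝ) : R3 :=
  (c - a)⁻¹ • (tc - ta) + (6 * (a + c - 2 * x) * ((c - a) ^ 2)⁻¹) • (m - (1 / 2 : ℝ) • (ta + tc))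

/-- The first derivative of the cubic Hermite interpolant. -/
def hermiteD (a c : ℝ) (ta tc m : R3) (x : ℝ) : R3 :=
  ta + ((x - a) * (c - a)⁻¹) • (tc - ta)
    + (6 * (x - a) * (c - x) * ((c - a) ^ 2)⁻¹) • (m - (1 / 2 : ℝ) • (ta + tc))

/-- The cubic Hermite interpolant with value `ya` at `a`. -/
def hermite (a c : ℝ) (ya ta tc m : R3) (x : ℝ) : R3 :=
  ya + (x - a) • ta + ((x - a) ^ 2 * (2 * (c - a))⁻¹) • (tc - ta)
    + ((3 * (x - a) ^ 2 * (c - a) - 2 * (x - a) ^ 3) * ((c - a) ^ 2)⁻¹)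
      • (m - (1 / 2 : ℝ) • (ta + tc))

theorem continuous_hermiteDD (a c : ℝ) (ta tc m : R3) : Continuous (hermiteDD a c ta tc m) := by
  unfold hermiteDD; fun_prop

theorem hasDerivAt_hermiteD (a c : ℝ) (ta tc m : R3) (x : ℝ) :
    HasDerivAt (hermiteD a c ta tc m) (hermiteDD a c ta tc m x) x := by
  unfold hermiteD hermiteDD
  have h1 : HasDerivAt (fun x : ℝ => (x - a) * (c - a)⁻¹) (c - a)⁻¹ x := by
    simpa using ((hasDerivAt_id x).sub_const a).mul_const (c - a)⁻¹
  have h2 : HasDerivAt (fun x : ℝ => 6 * (x - a) * (c - x) * ((c - a) ^ 2)⁻¹)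
      (6 * (a + c - 2 * x) * ((c - a) ^ 2)⁻¹) x := by
    have := ((((hasDerivAt_id x).sub_const a).const_mul 6).mul
      ((hasDerivAt_id x).const_sub c)).mul_const ((c - a) ^ 2)⁻¹
    refine this.congr_deriv ?_
    simp only [id]
    ring
  exact ((h1.smul_const _).const_add ta).add (h2.smul_const _)

theorem continuous_hermiteD (a c : ℝ) (ta tc m : R3) : Continuous (hermiteD a c ta tc m) := by
  unfold hermiteD; fun_prop

theorem hasDerivAt_hermite {a c : ℝ} (hac : a < c) (ya ta tc m : R3) (x : ℝ) :
    HasDerivAt (hermite a c ya ta tc m) (hermiteD a c ta tc m x) x := by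
  unfold hermite hermiteD
  have hc : c - a ≠ 0 := (sub_pos.2 hac).ne'
  have h0 : HasDerivAt (fun x : ℝ => x - a) 1 x := (hasDerivAt_id x).sub_const a
  have h1 : HasDerivAt (fun x : ℝ => (x - a) ^ 2 * (2 * (c - a))⁻¹) ((x - a) * (c - a)⁻¹) x := by
    refine ((h0.pow 2).mul_const _).congr_deriv ?_
    field_simp
    norm_num
    ring
  have h2 : HasDerivAt
      (fun x : ℝ => (3 * (x - a) ^ 2 * (c - a) - 2 * (x - a) ^ 3) * ((c - a) ^ 2)⁻¹)
      (6 * (x - a) * (c - x) * ((c - a) ^ 2)⁻¹) x := by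
    refine (((((h0.pow 2).const_mul 3).mul_const (c - a)).sub
      ((h0.pow 3).const_mul 2)).mul_const _).congr_deriv ?_
    simp only [Nat.cast_ofNat, Nat.add_one_sub_one, pow_one, mul_one]
    ring
  have h3 := (((h0.smul_const ta).const_add ya).add (h1.smul_const (tc - ta))).add
    (h2.smul_const (m - (1 / 2 : ℝ) • (ta + tc)))
  refine h3.congr_deriv ?_
  rw [one_smul]

theorem hermiteD_left (a c : ℝ) (ta tc m : R3) : hermiteD a c ta tc m a = ta := by
  simp [hermiteD]

theorem hermiteD_right {a c : ℝ} (hac : a < c) (ta tc m : R3) : hermiteD a c ta tc m c = tc := by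
  have hc : c - a ≠ 0 := (sub_pos.2 hac).ne'
  simp [hermiteD, mul_inv_cancel₀ hc]

theorem hermite_left (a c : ℝ) (ya ta tc m : R3) : hermite a c ya ta tc m a = ya := by
  simp [hermite]

theorem hermite_right {a c : ℝ} (hac : a < c) (ya ta tc m : R3) :
    hermite a c ya ta tc m c = ya + (c - a) • m := by
  have hc : c - a ≠ 0 := (sub_pos.2 hac).ne'
  unfold hermite
  rw [show (c - a) ^ 2 * (2 * (c - a))⁻¹ = (c - a) / 2 by field_simp,
    show (3 * (c - a) ^ 2 * (c - a) - 2 * (c - a) ^ 3) * ((c - a) ^ 2)⁻¹ = c - a by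
      field_simp; ring]
  module

theorem exists_monomial_eq (a : ℝ) (A B C D : R3) :
    ∃ c : Fin (3 + 1) → R3, ∀ x : ℝ,
      A + (x - a) • B + (x - a) ^ 2 • C + (x - a) ^ 3 • D = ∑ i : Fin (3 + 1), x ^ (i : ℕ) • c i := by
  refine ⟨![A - a • B + a ^ 2 • C - a ^ 3 • D, B - (2 * a) • C + (3 * a ^ 2) • D,
    C - (3 * a) • D, D], fun x => ?_⟩
  rw [Fin.sum_univ_four]
  simp only [Matrix.cons_val]
  norm_num
  module

theorem exists_hermite_eq (a c : ℝ) (ya ta tc m : R3) :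
    ∃ k : Fin (3 + 1) → R3, ∀ x : ℝ,
      hermite a c ya ta tc m x = ∑ i : Fin (3 + 1), x ^ (i : ℕ) • k i := by
  obtain ⟨k, hk⟩ := exists_monomial_eq a ya ta
    ((2 * (c - a))⁻¹ • (tc - ta) + (3 * (c - a) * ((c - a) ^ 2)⁻¹) • (m - (1 / 2 : ℝ) • (ta + tc)))
    ((-2 * ((c - a) ^ 2)⁻¹) • (m - (1 / 2 : ℝ) • (ta + tc)))
  refine ⟨k, fun x => ?_⟩
  rw [← hk, hermite]
  module

/-- Approximation by an affine function on an element controls the difference quotient and the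
second derivative of the Hermite interpolant. -/
theorem norm_interpolant_sub_le {a c τ : ℝ} (hac : a < c) {t : ℝ → R3}
    (ht : Continuous t) {A P : R3} (h : ∀ s ∈ Icc a c, ‖t s - (A + (s - a) • P)‖ ≤ τ) :
    ‖(c - a)⁻¹ • (t c - t a) - P‖ ≤ 2 * τ / (c - a) ∧
    ∀ x ∈ Icc a c, ‖hermiteDD a c (t a) (t c) ((c - a)⁻¹ • ∫ s in a..c, t s) x - P‖
      ≤ 14 * τ / (c - a) := by
  have hd : 0 < c - a := sub_pos.2 hac
  have hd' := hd.ne'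
  set r : ℝ → R3 := fun s => t s - (A + (s - a) • P) with hr
  have hrc : Continuous r := by fun_prop
  have ha := h a ⟨le_rfl, hac.le⟩
  have hc := h c ⟨hac.le, le_rfl⟩
  -- The interpolation reproduces affine functions, so only the remainder `r` contributes to either
  -- error.
  have e1 : (c - a)⁻¹ • (t c - t a) - P = (c - a)⁻¹ • (r c - r a) := by
    simp only [hr, sub_self, zero_smul]
    rw [show t c - (A + (c - a) • P) - (t a - (A + 0)) = (t c - t a) - (c - a) • P by module,
      smul_sub _ (t c - t a), inv_smul_smul₀ hd']
  have n1 : ‖(c - a)⁻¹ • (t c - t a) - P‖ ≤ 2 * τ / (c - a) := by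
    rw [e1, norm_smul, norm_inv, Real.norm_of_nonneg hd.le, inv_mul_eq_div]
    gcongr
    calc _ ≤ ‖r c‖ + ‖r a‖ := norm_sub_le _ _
      _ ≤ _ := by linarith
  refine ⟨n1, fun x hx => ?_⟩
  have hint : ∫ s in a..c, t s
      = (∫ s in a..c, r s) + ((c - a) • A + ((c - a) ^ 2 / 2) • P) := by
    have : ∀ s, t s = r s + (A + (s - a) • P) := fun s => by simp [hr]
    have h1 : ∫ s in a..c, (s - a) = (c - a) ^ 2 / 2 := by
      rw [intervalIntegral.integral_comp_sub_right (fun s => s), integral_id]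
      ring
    have hl : Continuous fun s : ℝ => (s - a) • P := by fun_prop
    have hl' : Continuous fun s : ℝ => A + (s - a) • P := by fun_prop
    rw [intervalIntegral.integral_congr fun s _ => this s, intervalIntegral.integral_add
      (hrc.intervalIntegrable _ _) (hl'.intervalIntegrable _ _),
      intervalIntegral.integral_add intervalIntegrable_const (hl.intervalIntegrable _ _),
      intervalIntegral.integral_smul_const, h1, intervalIntegral.integral_const]
  -- The left side is the error of the trapezoidal rule for the mean of `t`; it vanishes on affine
  -- functions.
  have e2 : (c - a)⁻¹ • (∫ s in a..c, t s) - (1 / 2 : ℝ) • (t a + t c)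
      = (c - a)⁻¹ • (∫ s in a..c, r s) - (1 / 2 : ℝ) • (r a + r c) := by
    rw [hint, smul_add, smul_add, smul_smul, smul_smul, inv_mul_cancel₀ hd',
      show (c - a)⁻¹ * ((c - a) ^ 2 / 2) = (c - a) / 2 by field_simp]
    simp only [hr]
    module
  have n2 : ‖(c - a)⁻¹ • (∫ s in a..c, t s) - (1 / 2 : ℝ) • (t a + t c)‖ ≤ 2 * τ := by
    rw [e2]
    have k1 : ‖∫ s in a..c, r s‖ ≤ τ * (c - a) := by
      have := intervalIntegral.norm_integral_le_of_norm_le_const (a := a) (b := c) (f := r) (C := τ)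
        (fun s hs => by
          rw [uIoc_of_le hac.le] at hs
          exact h s ⟨hs.1.le, hs.2⟩)
      rwa [abs_of_pos hd] at this
    calc _ ≤ ‖(c - a)⁻¹ • ∫ s in a..c, r s‖ + ‖(1 / 2 : ℝ) • (r a + r c)‖ := norm_sub_le _ _
      _ ≤ τ + τ := by
        gcongr
        · rw [norm_smul, norm_inv, Real.norm_of_nonneg hd.le, inv_mul_le_iff₀ hd]
          linarith
        · rw [norm_smul, Real.norm_of_nonneg (by norm_num : (0:ℝ) ≤ 1 / 2)]
          linarith [norm_add_le (r a) (r c)]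
      _ = 2 * τ := by ring
  have n3 : |6 * (a + c - 2 * x) * ((c - a) ^ 2)⁻¹| ≤ 6 / (c - a) := by
    rw [abs_mul, abs_mul, abs_of_pos (by positivity : (0:ℝ) < ((c - a) ^ 2)⁻¹),
      abs_of_pos (by norm_num : (0:ℝ) < 6)]
    have : |a + c - 2 * x| ≤ c - a := by
      rw [abs_le]
      constructor <;> linarith [hx.1, hx.2]
    calc 6 * |a + c - 2 * x| * ((c - a) ^ 2)⁻¹ ≤ 6 * (c - a) * ((c - a) ^ 2)⁻¹ := by gcongr
      _ = 6 / (c - a) := by field_simp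
  unfold hermiteDD
  rw [add_sub_right_comm]
  -- The constant is `14 = 2 + 6 · 2`: the slope error plus the coefficient bound `n3` times the
  -- trapezoidal error.
  calc _ ≤ ‖(c - a)⁻¹ • (t c - t a) - P‖ + _ := norm_add_le _ _
    _ ≤ 2 * τ / (c - a) + 6 / (c - a) * (2 * τ) := by
      refine add_le_add n1 ?_
      rw [norm_smul]
      exact mul_le_mul n3 n2 (norm_nonneg _) (by positivity)
    _ = 14 * τ / (c - a) := by ring


/-! ### Interpolation of framed curves -/

theorem memLp_of_continuousOn {L : ℝ} {f : ℝ → R3} (hf : ContinuousOn f (Icc 0 L)) :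
    MemLp f 2 (leb L) := by
  obtain ⟨C, hC⟩ := isCompact_Icc.exists_bound_of_continuousOn hf
  refine MemLp.of_bound ((hf.mono Ioo_subset_Icc_self).aestronglyMeasurable measurableSet_Ioo) C ?_
  refine (ae_restrict_iff' measurableSet_Ioo).2 (Eventually.of_forall fun x hx => ?_)
  exact hC x (Ioo_subset_Icc_self hx)

/-- Elements of `V` with prescribed highest derivatives and initial values. -/
theorem exists_V {L : ℝ} (hL : 0 < L) (y0 t0 b0 : R3) {p q : ℝ → R3} (hp : MemLp p 2 (leb L))
    (hq : MemLp q 2 (leb L)) :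
    ∃ v : V L, (v.y =ᵐ[leb L] fun x => y0 + ∫ s in 0..x, (t0 + ∫ r in 0..s, p r)) ∧
      (v.dy =ᵐ[leb L] fun x => t0 + ∫ s in 0..x, p s) ∧ v.ddy =ᵐ[leb L] p ∧
      (v.b =ᵐ[leb L] fun x => b0 + ∫ s in 0..x, q s) ∧ v.db =ᵐ[leb L] q := by
  have hpi : IntervalIntegrable p volume 0 L :=
    (intervalIntegrable_iff_integrable_leb hL).2 (hp.integrable (by norm_num))
  have hqi : IntervalIntegrable q volume 0 L :=
    (intervalIntegrable_iff_integrable_leb hL).2 (hq.integrable (by norm_num))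
  have ht := continuousOn_primitive hpi t0
  have hy := continuousOn_primitive ht.intervalIntegrable y0
  have hb := continuousOn_primitive hqi b0
  rw [uIcc_of_le hL.le] at ht hy hb
  have htL := memLp_of_continuousOn ht
  have hyL := memLp_of_continuousOn hy
  have hbL := memLp_of_continuousOn hb
  refine ⟨(⟨WithLp.toLp 2 ![hyL.toLp _, htL.toLp _, hp.toLp _], ?_⟩,
    ⟨WithLp.toLp 2 ![hbL.toLp _, hq.toLp _], ?_⟩), hyL.coeFn_toLp, htL.coeFn_toLp, hp.coeFn_toLp,
    hbL.coeFn_toLp, hq.coeFn_toLp⟩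
  · refine Fin.forall_fin_two.2 ⟨?_, ?_⟩
    · exact isWeakDeriv_of_primitive hL hyL.coeFn_toLp htL.coeFn_toLp
    · exact isWeakDeriv_of_primitive hL htL.coeFn_toLp hp.coeFn_toLp
  · refine Fin.forall_fin_one.2 ?_
    exact isWeakDeriv_of_primitive hL hbL.coeFn_toLp hq.coeFn_toLp

/-- The right endpoint is left out of the bound because piecewise functions are defined on half-open
elements; it is a null set for the integral. -/
theorem norm_sub_le_of_primitive {L K : ℝ} {t p : ℝ → R3} (hp : MemLp p 2 (leb L)) (hL : 0 < L)
    (ht : ∀ x ∈ Icc 0 L, t x = t 0 + ∫ s in 0..x, p s) (hK : ∀ x ∈ Ico 0 L, ‖p x‖ ≤ K) {r s : ℝ}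
    (hr : r ∈ Icc 0 L) (hs : s ∈ Icc 0 L) : ‖t s - t r‖ ≤ K * |s - r| := by
  have hpi : IntervalIntegrable p volume 0 L :=
    (intervalIntegrable_iff_integrable_leb hL).2 (hp.integrable (by norm_num))
  have h0 : (0 : ℝ) ∈ Icc 0 L := ⟨le_rfl, hL.le⟩
  have e : t s - t r = ∫ x in r..s, p x := by
    rw [ht s hs, ht r hr, add_sub_add_left_eq_sub]
    exact intervalIntegral.integral_interval_sub_left
      (Mesh.intervalIntegrable_of_subset hpi h0 hs) (Mesh.intervalIntegrable_of_subset hpi h0 hr)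
  rw [e]
  refine intervalIntegral.norm_integral_le_of_norm_le_const_ae ?_
  have : ∀ᵐ x, x ≠ L := by simp [ae_iff, measure_singleton]
  filter_upwards [this] with x hx hx'
  have := uIoc_subset_uIcc hx'
  have h1 : x ∈ Icc 0 L := (uIcc_subset_Icc hr hs) this
  exact hK x ⟨h1.1, lt_of_le_of_ne h1.2 hx⟩

namespace Mesh

variable {L : ℝ} (T : Mesh L)

theorem exists_node_eq (hL : 0 < L) (i : Fin (T.N + 1)) :
    ∃ j : Fin T.N, i = j.castSucc ∨ i = j.succ := by
  have hN : 0 < T.N := by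
    rcases Nat.eq_zero_or_pos T.N with h | h
    · exfalso
      have h1 : Fin.last T.N = 0 := Fin.ext h
      have h2 := T.last
      rw [h1, T.first] at h2
      exact hL.ne h2
    · exact h
  refine Fin.cases ⟨⟨0, hN⟩, Or.inl rfl⟩ (fun j => ⟨j, Or.inr rfl⟩) i

theorem memLp_piecewise {f : Fin T.N → ℝ → R3} (hf : ∀ j, Continuous (f j)) :
    MemLp (T.piecewise f) 2 (leb L) := by
  unfold piecewise
  exact memLp_finsetSum _ fun j _ =>
    (memLp_of_continuousOn (hf j).continuousOn).indicator measurableSet_Ico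

theorem integrable_piecewise {f : Fin T.N → ℝ → R3} (hf : ∀ j, Continuous (f j)) :
    Integrable (T.piecewise f) := by
  unfold piecewise
  refine integrable_finsetSum _ fun j _ => ?_
  exact (integrable_indicator_iff measurableSet_Ico).2
    ((hf j).integrableOn_Icc.mono_set Ico_subset_Icc_self)

/-- The second derivative of the piecewise cubic Hermite interpolant of a function with first
derivative `t`. -/
def interpDD (t : ℝ → R3) : ℝ → R3 :=
  T.piecewise fun j => hermiteDD (T.node j.castSucc) (T.node j.succ) (t (T.node j.castSucc))
    (t (T.node j.succ)) ((T.node j.succ - T.node j.castSucc)⁻¹ •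
      ∫ s in T.node j.castSucc..T.node j.succ, t s)

/-- The derivative of the piecewise linear interpolant of `b`. -/
def interpD (b : ℝ → R3) : ℝ → R3 :=
  T.piecewise fun j _ => (T.node j.succ - T.node j.castSucc)⁻¹ •
    (b (T.node j.succ) - b (T.node j.castSucc))

theorem memLp_interpDD (t : ℝ → R3) : MemLp (T.interpDD t) 2 (leb L) :=
  T.memLp_piecewise fun _ => continuous_hermiteDD _ _ _ _ _

theorem memLp_interpD (b : ℝ → R3) : MemLp (T.interpD b) 2 (leb L) :=
  T.memLp_piecewise fun _ => continuous_const

theorem integrable_interpDD (t : ℝ → R3) : Integrable (T.interpDD t) :=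
  T.integrable_piecewise fun _ => continuous_hermiteDD _ _ _ _ _

theorem integrable_interpD (b : ℝ → R3) : Integrable (T.interpD b) :=
  T.integrable_piecewise fun _ => continuous_const

theorem primitive_interpDD (t : ℝ → R3) (j : Fin T.N) {x : ℝ}
    (hx : x ∈ Icc (T.node j.castSucc) (T.node j.succ)) :
    t 0 + ∫ s in 0..x, T.interpDD t s
      = hermiteD (T.node j.castSucc) (T.node j.succ) (t (T.node j.castSucc))
        (t (T.node j.succ)) ((T.node j.succ - T.node j.castSucc)⁻¹ •
          ∫ s in T.node j.castSucc..T.node j.succ, t s) x :=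
  T.primitive_eq (T.integrable_interpDD t).intervalIntegrable
    (fun _ _ hx => T.piecewise_eq _ ⟨hx.1.le, hx.2⟩) (fun _ _ => hasDerivAt_hermiteD _ _ _ _ _ _)
    (fun _ => continuous_hermiteDD _ _ _ _ _) (fun _ => hermiteD_left _ _ _ _ _)
    (fun j => hermiteD_right (T.node_lt j) _ _ _) j hx

theorem primitive_interpD (b : ℝ → R3) (j : Fin T.N) {x : ℝ}
    (hx : x ∈ Icc (T.node j.castSucc) (T.node j.succ)) :
    b 0 + ∫ s in 0..x, T.interpD b s
      = b (T.node j.castSucc) + (x - T.node j.castSucc) •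
        (T.node j.succ - T.node j.castSucc)⁻¹ • (b (T.node j.succ) - b (T.node j.castSucc)) :=
  T.primitive_eq (T.integrable_interpD b).intervalIntegrable
    (F := fun j x => b (T.node j.castSucc) + (x - T.node j.castSucc) •
        (T.node j.succ - T.node j.castSucc)⁻¹ • (b (T.node j.succ) - b (T.node j.castSucc)))
    (fun _ _ hx => T.piecewise_eq _ ⟨hx.1.le, hx.2⟩)
    (fun j x => by
      have := (((hasDerivAt_id x).sub_const (T.node j.castSucc)).smul_const
        ((T.node j.succ - T.node j.castSucc)⁻¹ •
          (b (T.node j.succ) - b (T.node j.castSucc)))).const_add (b (T.node j.castSucc))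
      rwa [one_smul] at this)
    (fun _ => continuous_const) (fun _ => by simp)
    (fun j => by
      rw [smul_inv_smul₀ (sub_pos.2 (T.node_lt j)).ne', add_sub_cancel]) j hx

theorem continuous_primitive_interpDD (t : ℝ → R3) :
    Continuous fun x => t 0 + ∫ s in 0..x, T.interpDD t s :=
  continuous_const.add (intervalIntegral.continuous_primitive
    (fun _ _ => (T.integrable_interpDD t).intervalIntegrable) 0)

theorem continuous_primitive_interpD (b : ℝ → R3) :
    Continuous fun x => b 0 + ∫ s in 0..x, T.interpD b s :=
  continuous_const.add (intervalIntegral.continuous_primitive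
    (fun _ _ => (T.integrable_interpD b).intervalIntegrable) 0)

/-- The difference quotient fed into the Hermite formula is the mean of `t`, that is, the quotient
of `y` itself. The interpolant therefore matches `y` at the right end of each element and the pieces
fit together. -/
theorem second_primitive_interpDD {t : ℝ → R3} (ht : Continuous t) (y0 : R3) (j : Fin T.N) {x : ℝ}
    (hx : x ∈ Icc (T.node j.castSucc) (T.node j.succ)) :
    y0 + ∫ s in 0..x, (t 0 + ∫ r in 0..s, T.interpDD t r)
      = hermite (T.node j.castSucc) (T.node j.succ)
        (y0 + ∫ s in 0..T.node j.castSucc, t s) (t (T.node j.castSucc))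
        (t (T.node j.succ)) ((T.node j.succ - T.node j.castSucc)⁻¹ •
          ∫ s in T.node j.castSucc..T.node j.succ, t s) x := by
  have := T.primitive_eq (g := fun x => y0 + ∫ s in 0..x, t s)
    ((T.continuous_primitive_interpDD t).intervalIntegrable 0 L)
    (fun _ _ hx => T.primitive_interpDD t _ ⟨hx.1.le, hx.2.le⟩)
    (fun j x => hasDerivAt_hermite (T.node_lt j) (y0 + ∫ s in 0..T.node j.castSucc, t s) _ _ _ x)
    (fun _ => continuous_hermiteD _ _ _ _ _) (fun _ => hermite_left _ _ _ _ _ _)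
    (fun j => by
      rw [hermite_right (T.node_lt j), smul_inv_smul₀ (sub_pos.2 (T.node_lt j)).ne', add_assoc,
        intervalIntegral.integral_add_adjacent_intervals (ht.intervalIntegrable _ _)
          (ht.intervalIntegrable _ _)]) j hx
  rw [← this, intervalIntegral.integral_same, add_zero]

theorem primitive_interpDD_node (hL : 0 < L) (t : ℝ → R3) (i : Fin (T.N + 1)) :
    t 0 + ∫ s in 0..T.node i, T.interpDD t s = t (T.node i) := by
  obtain ⟨j, rfl | rfl⟩ := T.exists_node_eq hL i
  · rw [T.primitive_interpDD t j ⟨le_rfl, (T.node_lt j).le⟩, hermiteD_left]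
  · rw [T.primitive_interpDD t j ⟨(T.node_lt j).le, le_rfl⟩, hermiteD_right (T.node_lt j)]

theorem primitive_interpD_node (hL : 0 < L) (b : ℝ → R3) (i : Fin (T.N + 1)) :
    b 0 + ∫ s in 0..T.node i, T.interpD b s = b (T.node i) := by
  obtain ⟨j, rfl | rfl⟩ := T.exists_node_eq hL i
  · rw [T.primitive_interpD b j ⟨le_rfl, (T.node_lt j).le⟩, sub_self, zero_smul, add_zero]
  · rw [T.primitive_interpD b j ⟨(T.node_lt j).le, le_rfl⟩,
      smul_inv_smul₀ (sub_pos.2 (T.node_lt j)).ne', add_sub_cancel]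

theorem second_primitive_interpDD_node (hL : 0 < L) {t : ℝ → R3} (ht : Continuous t) (y0 : R3)
    (i : Fin (T.N + 1)) :
    y0 + ∫ s in 0..T.node i, (t 0 + ∫ r in 0..s, T.interpDD t r)
      = y0 + ∫ s in 0..T.node i, t s := by
  obtain ⟨j, rfl | rfl⟩ := T.exists_node_eq hL i
  · rw [T.second_primitive_interpDD ht y0 j ⟨le_rfl, (T.node_lt j).le⟩, hermite_left]
  · rw [T.second_primitive_interpDD ht y0 j ⟨(T.node_lt j).le, le_rfl⟩,
      hermite_right (T.node_lt j), smul_inv_smul₀ (sub_pos.2 (T.node_lt j)).ne', add_assoc,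
      intervalIntegral.integral_add_adjacent_intervals (ht.intervalIntegrable _ _)
        (ht.intervalIntegrable _ _)]

theorem isSpline_second_primitive {t : ℝ → R3} (ht : Continuous t) (y0 : R3) :
    IsSpline T 3 1 fun x => y0 + ∫ s in 0..x, (t 0 + ∫ r in 0..s, T.interpDD t r) := by
  constructor
  · refine ContDiff.contDiffOn ?_
    have hc := T.continuous_primitive_interpDD t
    have hd : ∀ x, HasDerivAt (fun x => y0 + ∫ s in 0..x, (t 0 + ∫ r in 0..s, T.interpDD t r))
        (t 0 + ∫ r in 0..x, T.interpDD t r) x := fun x =>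
      (intervalIntegral.integral_hasDerivAt_right (hc.intervalIntegrable _ _)
        hc.stronglyMeasurable.stronglyMeasurableAtFilter hc.continuousAt).const_add y0
    rw [Nat.cast_one, contDiff_one_iff_deriv]
    refine ⟨fun x => (hd x).differentiableAt, ?_⟩
    rw [funext fun x => (hd x).deriv]
    exact hc
  · intro j
    obtain ⟨k, hk⟩ := exists_hermite_eq (T.node j.castSucc) (T.node j.succ)
        (y0 + ∫ s in 0..T.node j.castSucc, t s) (t (T.node j.castSucc))
        (t (T.node j.succ)) ((T.node j.succ - T.node j.castSucc)⁻¹ •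
          ∫ s in T.node j.castSucc..T.node j.succ, t s)
    exact ⟨k, fun x hx => (T.second_primitive_interpDD ht y0 j hx).trans (hk x)⟩

theorem isSpline_primitive_interpD (b : ℝ → R3) :
    IsSpline T 1 0 fun x => b 0 + ∫ s in 0..x, T.interpD b s := by
  constructor
  · rw [Nat.cast_zero, contDiffOn_zero]
    exact (T.continuous_primitive_interpD b).continuousOn
  · intro j
    set D := (T.node j.succ - T.node j.castSucc)⁻¹ • (b (T.node j.succ) - b (T.node j.castSucc))
      with hD
    refine ⟨![b (T.node j.castSucc) - T.node j.castSucc • D, D], fun x hx => ?_⟩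
    refine (T.primitive_interpD b j hx).trans ?_
    rw [Fin.sum_univ_two, ← hD]
    simp only [Matrix.cons_val]
    norm_num
    module

variable {t b p q : ℝ → R3} {K : ℝ}

/-- The interpolation error of the highest derivatives at a point of an element on which the
functions are nearly affine. -/
theorem norm_interpDD_sub_le (ht : Continuous t) {j : Fin T.N} {x : ℝ}
    (hx : x ∈ Ico (T.node j.castSucc) (T.node j.succ)) {A P : R3} {e : ℝ}
    (h : ∀ s ∈ Icc (T.node j.castSucc) (T.node j.succ),
      ‖t s - (A + (s - T.node j.castSucc) • P)‖ ≤ e * T.len j) :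
    ‖T.interpDD t x - P‖ ≤ 14 * e ∧ ‖T.interpD t x - P‖ ≤ 2 * e := by
  have hl := (T.len_pos j).ne'
  obtain ⟨h1, h2⟩ := norm_interpolant_sub_le (T.node_lt j) ht h
  change _ ≤ 2 * (e * T.len j) / T.len j at h1
  have h2' := h2 x (Ico_subset_Icc_self hx)
  change _ ≤ 14 * (e * T.len j) / T.len j at h2'
  rw [← mul_assoc, mul_div_cancel_right₀ _ hl] at h1 h2'
  rw [interpDD, interpD, T.piecewise_eq _ hx, T.piecewise_eq _ hx]
  exact ⟨h2', h1⟩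

/-- A Lipschitz function is within `K` times the element length of a constant, so the affine
estimate applies with slope `P = 0`. The resulting bounds do not depend on the mesh and serve as
majorants. -/
theorem norm_interp_le (ht : Continuous t)
    (hK : ∀ r ∈ Icc 0 L, ∀ s ∈ Icc 0 L, ‖t s - t r‖ ≤ K * |s - r|) (hK0 : 0 ≤ K) {x : ℝ}
    (hx : x ∈ Ico 0 L) : ‖T.interpDD t x‖ ≤ 14 * K ∧ ‖T.interpD t x‖ ≤ 2 * K := by
  obtain ⟨j, hj⟩ := T.exists_mem_Ico hx
  have := T.norm_interpDD_sub_le ht hj (A := t (T.node j.castSucc)) (P := 0) (e := K)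
    (fun s hs => by
      rw [smul_zero, add_zero]
      refine (hK _ (T.node_mem_Icc _) s (T.Icc_subset j hs)).trans ?_
      gcongr
      rw [abs_of_nonneg (sub_nonneg.2 hs.1)]
      unfold len
      linarith [hs.2])
  simpa using this

end Mesh

/-- At points of differentiability the derivatives of the interpolants converge. -/
theorem tendsto_interp {L : ℝ} {T : ℕ → Mesh L}
    (hT : Tendsto (fun n => (T n).size) atTop (𝓝 0)) {t : ℝ → R3} (ht : Continuous t) {x : ℝ}
    (hx : x ∈ Ico 0 L) {P : R3} (hd : HasDerivAt t P x) :
    Tendsto (fun n => (T n).interpDD t x) atTop (𝓝 P) ∧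
      Tendsto (fun n => (T n).interpD t x) atTop (𝓝 P) := by
  have key : ∀ e > 0, ∀ᶠ n in atTop, ‖(T n).interpDD t x - P‖ ≤ 14 * e ∧
      ‖(T n).interpD t x - P‖ ≤ 2 * e := by
    intro e he
    rw [hasDerivAt_iff_isLittleO] at hd
    obtain ⟨d, hd0, hd1⟩ := Metric.eventually_nhds_iff.1 (hd.def he)
    filter_upwards [hT.eventually (gt_mem_nhds hd0)] with n hn
    obtain ⟨j, hj⟩ := (T n).exists_mem_Ico hx
    have hlen := (T n).len_le_size j
    have hs' : ∀ s ∈ Icc ((T n).node j.castSucc) ((T n).node j.succ), |s - x| ≤ (T n).len j := by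
      intro s hs
      unfold Mesh.len
      rw [abs_le]
      constructor <;> linarith [hs.1, hs.2, hj.1, hj.2]
    -- The constant is chosen so that the affine function, written with base point at the left node,
    -- is the tangent of `t` at `x`.
    refine (T n).norm_interpDD_sub_le ht hj (A := t x - (x - (T n).node j.castSucc) • P)
      fun s hs => ?_
    have h1 := hd1 (y := s) (by rw [Real.dist_eq]; linarith [hs' s hs])
    rw [show t s - (t x - (x - (T n).node j.castSucc) • P + (s - (T n).node j.castSucc) • P)
      = t s - t x - (s - x) • P by module]
    refine h1.trans ?_
    rw [Real.norm_eq_abs]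
    exact mul_le_mul_of_nonneg_left (hs' s hs) he.le
  constructor
  · rw [Metric.tendsto_nhds]
    intro e he
    filter_upwards [key (e / 28) (by positivity)] with n hn
    rw [dist_eq_norm]
    linarith [hn.1]
  · rw [Metric.tendsto_nhds]
    intro e he
    filter_upwards [key (e / 4) (by positivity)] with n hn
    rw [dist_eq_norm]
    linarith [hn.2]

theorem ae_hasDerivAt_of_primitive {L : ℝ} (hL : 0 < L) {t p : ℝ → R3} (hp : MemLp p 2 (leb L))
    (ht : ∀ x ∈ Icc 0 L, t x = t 0 + ∫ s in 0..x, p s) :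
    ∀ᵐ x ∂(leb L), HasDerivAt t (p x) x := by
  have hpi : IntervalIntegrable p volume 0 L :=
    (intervalIntegrable_iff_integrable_leb hL).2 (hp.integrable (by norm_num))
  rw [ae_restrict_iff' measurableSet_Ioo]
  filter_upwards [hpi.ae_hasDerivAt_integral] with x hx hx'
  have h1 := (hx (Icc_subset_uIcc (Ioo_subset_Icc_self hx')) 0 left_mem_uIcc).const_add (t 0)
  refine h1.congr_of_eventuallyEq ?_
  filter_upwards [isOpen_Ioo.mem_nhds hx'] with s hs
  exact ht s (Ioo_subset_Icc_self hs)


/-- Interpolants of a framed curve with bounded derivatives that have its boundary values are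
discretely admissible and satisfy the constraints up to the mesh-size. -/
theorem IsRibbonCurve.exists_interpolant {L : ℝ} (hL : 0 < L) {W : Type*} [NormedAddCommGroup W]
    [NormedSpace ℝ W] {Lbc : V L →L[ℝ] W} {lbc : W}
    (hLbc : ∀ v w : V L, SameBoundaryValues v w → Lbc v = Lbc w) {w : V L} (hw : Lbc w = lbc)
    {t b p q : ℝ → R3} (h : IsRibbonCurve L t b p q) {K : ℝ} (hp : ∀ x, ‖p x‖ ≤ K)
    (hq : ∀ x, ‖q x‖ ≤ K) {y0 yL : R3} (hwy : HasEndpointValues w.y y0 yL)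
    (hwt : HasEndpointValues w.dy (t 0) (t L)) (hwb : HasEndpointValues w.b (b 0) (b L))
    (hyL : yL = y0 + ∫ x in 0..L, t x) (T : Mesh L) :
    ∃ v ∈ discreteAdmissible Lbc lbc T, v.ddy =ᵐ[leb L] T.interpDD t ∧ v.db =ᵐ[leb L] T.interpD b ∧
      ∀ᵐ x ∂(leb L),
        |inner ℝ (v.dy x) (v.b x)| ≤ (14 * K * (1 + 2 * K * L) + 2 * K) * T.size ∧
        |inner ℝ (v.dy x) (v.db x)| ≤ 15 * K ^ 2 * T.size := by
  have hK0 : 0 ≤ K := (norm_nonneg _).trans (hp 0)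
  have htK : ∀ r ∈ Icc 0 L, ∀ s ∈ Icc 0 L, ‖t s - t r‖ ≤ K * |s - r| := fun r hr s hs =>
    norm_sub_le_of_primitive h.memLp_p hL h.eq_t (fun x _ => hp x) hr hs
  have hbK : ∀ r ∈ Icc 0 L, ∀ s ∈ Icc 0 L, ‖b s - b r‖ ≤ K * |s - r| := fun r hr s hs =>
    norm_sub_le_of_primitive h.memLp_q hL h.eq_b (fun x _ => hq x) hr hs
  obtain ⟨v, vy, vdy, vddy, vb, vdb⟩ := exists_V hL y0 (t 0) (b 0) (T.memLp_interpDD t)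
    (T.memLp_interpD b)
  set th : ℝ → R3 := fun x => t 0 + ∫ s in 0..x, T.interpDD t s with hth
  set bh : ℝ → R3 := fun x => b 0 + ∫ s in 0..x, T.interpD b s with hbh
  set yh : ℝ → R3 := fun x => y0 + ∫ s in 0..x, th s with hyh
  have htc : Continuous th := T.continuous_primitive_interpDD t
  have hbc : Continuous bh := T.continuous_primitive_interpD b
  have hyd : ∀ x, HasDerivAt yh (th x) x := fun x =>
    (intervalIntegral.integral_hasDerivAt_right (htc.intervalIntegrable _ _)
        htc.stronglyMeasurable.stronglyMeasurableAtFilter htc.continuousAt).const_add y0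
  have hyc : Continuous yh := continuous_iff_continuousAt.2 fun x => (hyd x).continuousAt
  have htn : ∀ i, th (T.node i) = t (T.node i) := T.primitive_interpDD_node hL t
  have hbn : ∀ i, bh (T.node i) = b (T.node i) := T.primitive_interpD_node hL b
  have hyn : ∀ i, yh (T.node i) = y0 + ∫ s in 0..T.node i, t s :=
    T.second_primitive_interpDD_node hL h.cont_t y0
  refine ⟨v, ⟨⟨yh, bh, T.isSpline_second_primitive h.cont_t y0, T.isSpline_primitive_interpD b, vy,
    vb, fun j => ⟨?_, ?_⟩⟩, ?_⟩, vddy, vdb, ?_⟩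
  · rw [(hyd _).hasDerivWithinAt.derivWithin (uniqueDiffOn_Icc hL _ (T.node_mem_Icc j)), htn,
      h.norm_t _ (T.node_mem_Icc j), one_pow]
  · rw [hbn, h.norm_b _ (T.node_mem_Icc j), one_pow]
  -- Both `0` and `L` are nodes, so the interpolants have the endpoint values of the curve, which
  -- are those of `w`; `hyL` supplies the value of `y` at `L`.
  · rw [← hw]
    refine hLbc v w ⟨⟨y0, yL, ⟨yh, hyc.continuousOn, vy, ?_, ?_⟩, hwy⟩,
      ⟨t 0, t L, ⟨th, htc.continuousOn, vdy, ?_, ?_⟩, hwt⟩,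
      ⟨b 0, b L, ⟨bh, hbc.continuousOn, vb, ?_, ?_⟩, hwb⟩⟩
    · simp [hyh]
    · have := hyn (Fin.last _)
      rw [T.last] at this
      rw [this, hyL]
    · simp [hth]
    · have := htn (Fin.last _)
      rwa [T.last] at this
    · simp [hbh]
    · have := hbn (Fin.last _)
      rwa [T.last] at this
  · have hPb : ∀ x ∈ Ico 0 L, ‖T.interpDD t x‖ ≤ 14 * K := fun x hx =>
      (T.norm_interp_le h.cont_t htK hK0 hx).1
    have hQb : ∀ x ∈ Ico 0 L, ‖T.interpD b x‖ ≤ 2 * K := fun x hx =>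
      (T.norm_interp_le h.cont_b hbK hK0 hx).2
    have hthL : ∀ r ∈ Icc 0 L, ∀ s ∈ Icc 0 L, ‖th s - th r‖ ≤ 14 * K * |s - r| :=
      fun r hr s hs => norm_sub_le_of_primitive (T.memLp_interpDD t) hL
        (fun x _ => by simp [hth]) hPb hr hs
    have hbhL : ∀ r ∈ Icc 0 L, ∀ s ∈ Icc 0 L, ‖bh s - bh r‖ ≤ 2 * K * |s - r| :=
      fun r hr s hs => norm_sub_le_of_primitive (T.memLp_interpD b) hL
        (fun x _ => by simp [hbh]) hQb hr hs
    have hmem : ∀ᵐ x ∂(leb L), x ∈ Ioo 0 L := ae_restrict_mem measurableSet_Ioo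
    filter_upwards [hmem, vdy, vb, vdb] with x hx h1 h2 h3
    rw [h1, h2, h3]
    have hxI := Ioo_subset_Icc_self hx
    obtain ⟨j, hj⟩ := T.exists_mem_Ico (Ioo_subset_Ico_self hx)
    set a := T.node j.castSucc with ha
    set c := T.node j.succ with hc
    have hac : a < c := T.node_lt j
    have hlen : c - a ≤ T.size := T.len_le_size j
    have hlenL : c - a ≤ L := T.len_le j
    have hd : 0 < c - a := sub_pos.2 hac
    have hs0 : 0 ≤ T.size := hd.le.trans hlen
    have haI : a ∈ Icc 0 L := T.node_mem_Icc _
    have hcI : c ∈ Icc 0 L := T.node_mem_Icc _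
    have hxa : |x - a| ≤ c - a := by
      rw [abs_of_nonneg (sub_nonneg.2 hj.1)]
      linarith [hj.2]
    have e1 : ‖th x - t a‖ ≤ 14 * K * (c - a) := by
      have := hthL a haI x hxI
      rw [htn] at this
      exact this.trans (by gcongr)
    have e2 : ‖bh x - b a‖ ≤ 2 * K * (c - a) := by
      have := hbhL a haI x hxI
      rw [hbn] at this
      exact this.trans (by gcongr)
    constructor
    · have n1 : ‖bh x‖ ≤ 1 + 2 * K * L := by
        have k1 := norm_le_norm_add_norm_sub' (bh x) (b a)
        rw [h.norm_b a haI] at k1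
        have k2 : 2 * K * (c - a) ≤ 2 * K * L := by gcongr
        linarith
      -- Orthogonality is exact at the left node, so the defect is controlled by the increments of
      -- both interpolants over the element.
      have k : inner ℝ (th x) (bh x) = inner ℝ (th x - t a) (bh x) + inner ℝ (t a) (bh x - b a) := by
        rw [inner_sub_left, inner_sub_right, h.inner_t_b a haI]
        ring
      rw [k]
      calc _ ≤ |inner ℝ (th x - t a) (bh x)| + |inner ℝ (t a) (bh x - b a)| := abs_add_le _ _
        _ ≤ ‖th x - t a‖ * ‖bh x‖ + ‖t a‖ * ‖bh x - b a‖ :=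
          add_le_add (abs_real_inner_le_norm _ _) (abs_real_inner_le_norm _ _)
        _ ≤ 14 * K * T.size * (1 + 2 * K * L) + 1 * (2 * K * T.size) := by
          rw [h.norm_t a haI]
          gcongr
          · exact e1.trans (by gcongr)
          · exact e2.trans (by gcongr)
        _ = _ := by ring
    · have hqi : IntervalIntegrable q volume 0 L :=
        (intervalIntegrable_iff_integrable_leb hL).2 (h.memLp_q.integrable (by norm_num))
      have hqac : IntervalIntegrable q volume a c := Mesh.intervalIntegrable_of_subset hqi haI hcI
      have h0 : (0 : ℝ) ∈ Icc 0 L := ⟨le_rfl, hL.le⟩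
      have k1 : b c - b a = ∫ s in a..c, q s := by
        rw [h.eq_b c hcI, h.eq_b a haI, add_sub_add_left_eq_sub]
        exact intervalIntegral.integral_interval_sub_left
          (Mesh.intervalIntegrable_of_subset hqi h0 hcI)
          (Mesh.intervalIntegrable_of_subset hqi h0 haI)
      -- The slope of the linear interpolant is the mean of `q` over the element. Under this mean `t
      -- s` is orthogonal to `q s`, leaving only `th x - t s`, which is `O(h)`: `14 K` from the
      -- interpolant and `K` from `t`.
      have k2 : inner ℝ (th x) (T.interpD b x) = (c - a)⁻¹ * ∫ s in a..c, inner ℝ (th x) (q s) := by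
        rw [Mesh.interpD, T.piecewise_eq _ hj, ← ha, ← hc, k1, inner_smul_right]
        congr 1
        exact ((innerSL ℝ (th x)).intervalIntegral_comp_comm hqac).symm
      have k3 : |∫ s in a..c, inner ℝ (th x) (q s)| ≤ 15 * K * (c - a) * K * |c - a| := by
        rw [← Real.norm_eq_abs]
        refine intervalIntegral.norm_integral_le_of_norm_le_const_ae ?_
        have hne : ∀ᵐ x, x ≠ L := by simp [ae_iff, measure_singleton]
        filter_upwards [hne, (ae_restrict_iff' measurableSet_Ioo).1 h.inner_t_q] with s hs1 hs2 hs
        rw [uIoc_of_le hac.le] at hs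
        have hsI : s ∈ Icc 0 L := T.Icc_subset j ⟨hs.1.le, hs.2⟩
        have hs3 := hs2 ⟨haI.1.trans_lt hs.1, lt_of_le_of_ne hsI.2 hs1⟩
        have k4 : inner ℝ (th x) (q s) = inner ℝ (th x - t s) (q s) := by
          rw [inner_sub_left, hs3, sub_zero]
        have k5 : ‖th x - t s‖ ≤ 15 * K * (c - a) := by
          have l1 := htK s hsI a haI
          have l2 : |a - s| ≤ c - a := by
            rw [abs_sub_comm, abs_of_nonneg (by linarith [hs.1])]
            linarith [hs.2]
          calc _ ≤ ‖th x - t a‖ + ‖t a - t s‖ := norm_sub_le_norm_sub_add_norm_sub _ _ _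
            _ ≤ 14 * K * (c - a) + K * (c - a) := add_le_add e1 (l1.trans (by gcongr))
            _ = _ := by ring
        rw [k4, Real.norm_eq_abs]
        calc _ ≤ ‖th x - t s‖ * ‖q s‖ := abs_real_inner_le_norm _ _
          _ ≤ _ := by
            gcongr
            exact hq s
      rw [k2, abs_mul, abs_of_pos (inv_pos.2 hd)]
      rw [abs_of_pos hd] at k3
      calc _ ≤ (c - a)⁻¹ * (15 * K * (c - a) * K * (c - a)) := by gcongr
        _ = 15 * K ^ 2 * (c - a) := by field_simp
        _ ≤ _ := by gcongr


/-! ### Frames -/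

theorem inner_eq_sum (u v : R3) : inner ℝ u v = u 0 * v 0 + u 1 * v 1 + u 2 * v 2 := by
  simp [PiLp.inner_apply, Fin.sum_univ_three, mul_comm]

theorem norm_sq_eq_sum (u : R3) : ‖u‖ ^ 2 = u 0 ^ 2 + u 1 ^ 2 + u 2 ^ 2 := by
  simp [EuclideanSpace.norm_sq_eq, Fin.sum_univ_three]

/-- The third column is determined by the first two: by Lagrange's identity `|t × b|² = |t|²|b|² -
(t · b)²`, which is both its squared length and the determinant. -/
theorem frameMatrix_mem_iff (t b : R3) :
    frameMatrix t b ∈ Matrix.specialOrthogonalGroup (Fin 3) ℝ ↔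
      ‖t‖ = 1 ∧ ‖b‖ = 1 ∧ inner ℝ t b = 0 := by
  have hsq : ∀ u : R3, ‖u‖ = 1 ↔ u 0 ^ 2 + u 1 ^ 2 + u 2 ^ 2 = 1 := fun u => by
    rw [← norm_sq_eq_sum, pow_eq_one_iff_of_nonneg (norm_nonneg u) two_ne_zero]
  rw [hsq, hsq, inner_eq_sum, Matrix.mem_specialOrthogonalGroup_iff,
    Matrix.mem_orthogonalGroup_iff']
  have hentry : (frameMatrix t b)ᵀ * frameMatrix t b = 1 ↔ ∀ i j,
      ((frameMatrix t b)ᵀ * frameMatrix t b) i j = (1 : Matrix (Fin 3) (Fin 3) ℝ) i j :=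
    ⟨fun h i j => by rw [h], fun h => Matrix.ext h⟩
  rw [hentry]
  simp only [Fin.forall_fin_succ, frameMatrix, Matrix.transpose_transpose,
    Matrix.mul_apply, Fin.sum_univ_three, Matrix.det_fin_three,
    cross_apply]
  simp [Matrix.one_apply]
  generalize t 0 = t0
  generalize t 1 = t1
  generalize t 2 = t2
  generalize b 0 = b0
  generalize b 1 = b1
  generalize b 2 = b2
  constructor
  · rintro ⟨⟨⟨h1, h2, h3⟩, ⟨h4, h5, h6⟩, _⟩, _⟩
    exact ⟨by linarith, by linarith, by linarith⟩
  · rintro ⟨h1, h2, h3⟩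
    have hdet : (t1 * b2 - t2 * b1) ^ 2 + (t2 * b0 - t0 * b2) ^ 2 + (t0 * b1 - t1 * b0) ^ 2 = 1 := by
      have : (t1 * b2 - t2 * b1) ^ 2 + (t2 * b0 - t0 * b2) ^ 2 + (t0 * b1 - t1 * b0) ^ 2
        = (t0 ^ 2 + t1 ^ 2 + t2 ^ 2) * (b0 ^ 2 + b1 ^ 2 + b2 ^ 2)
          - (t0 * b0 + t1 * b1 + t2 * b2) ^ 2 := by ring
      rw [this, h1, h2, h3]
      norm_num
    refine ⟨⟨⟨?_, ?_, ?_⟩, ⟨?_, ?_, ?_⟩, ?_, ?_, ?_⟩, ?_⟩ <;> linarith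


/-! ### Continuous representatives -/

theorem integral_congr_leb {L : ℝ} {E : Type*} [NormedAddCommGroup E] [NormedSpace ℝ E]
    {f g : ℝ → E} (h : f =ᵐ[leb L] g) {x : ℝ} (hx : x ∈ Icc 0 L) :
    ∫ s in 0..x, f s = ∫ s in 0..x, g s := by
  rw [intervalIntegral.integral_of_le hx.1, intervalIntegral.integral_of_le hx.1,
    integral_Ioc_eq_integral_Ioo, integral_Ioc_eq_integral_Ioo]
  exact integral_congr_ae (ae_restrict_of_ae_restrict_of_subset (Ioo_subset_Ioo_right hx.2) h)

/-- The continuous representative of a weakly differentiable function. -/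
theorem IsWeakDeriv.exists_continuous {L : ℝ} (hL : 0 < L) {u v : L2 L} (h : IsWeakDeriv u v) :
    ∃ t : ℝ → R3, Continuous t ∧ u =ᵐ[leb L] t ∧
      ∀ x ∈ Icc 0 L, t x = t 0 + ∫ s in 0..x, v s := by
  obtain ⟨c, hc⟩ := h.exists_ae_eq_primitive hL
  -- Extension of the derivative by zero makes the primitive continuous on all of `ℝ`.
  have hi : Integrable ((Ioo 0 L).indicator v) :=
    (integrable_indicator_iff measurableSet_Ioo).2 (integrable_L2 v)
  have heq : ∀ x ∈ Icc 0 L, ∫ s in 0..x, (Ioo 0 L).indicator v s = ∫ s in 0..x, v s :=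
    fun x hx => integral_congr_Ioo hx.1 fun s hs =>
      indicator_of_mem (Ioo_subset_Ioo_right hx.2 hs) _
  refine ⟨fun x => c + ∫ s in 0..x, (Ioo 0 L).indicator v s,
    continuous_const.add (intervalIntegral.continuous_primitive
      (fun _ _ => hi.intervalIntegrable) 0), ?_, fun x hx => ?_⟩
  · filter_upwards [hc, ae_restrict_mem measurableSet_Ioo] with x hx hx'
    rw [hx, heq x (Ioo_subset_Icc_self hx')]
  · simp only [intervalIntegral.integral_same, add_zero, heq x hx]

/-- The continuous functions `y`, `t = y'` and `b` that represent an element of `V`. -/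
structure IsRep {L : ℝ} (v : V L) (y0 : R3) (t b : ℝ → R3) : Prop where
  cont_t : Continuous t
  cont_b : Continuous b
  ae_t : v.dy =ᵐ[leb L] t
  ae_b : v.b =ᵐ[leb L] b
  ae_y : v.y =ᵐ[leb L] fun x => y0 + ∫ s in 0..x, t s
  eq_t : ∀ x ∈ Icc 0 L, t x = t 0 + ∫ s in 0..x, v.ddy s
  eq_b : ∀ x ∈ Icc 0 L, b x = b 0 + ∫ s in 0..x, v.db s

theorem exists_isRep {L : ℝ} (hL : 0 < L) (v : V L) : ∃ y0 t b, IsRep v y0 t b := by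
  have h1 : IsWeakDeriv v.dy v.ddy := v.1.2 1
  have h2 : IsWeakDeriv v.y v.dy := v.1.2 0
  have h3 : IsWeakDeriv v.b v.db := v.2.2 0
  obtain ⟨t, ht, ht', ht''⟩ := h1.exists_continuous hL
  obtain ⟨b, hb, hb', hb''⟩ := h3.exists_continuous hL
  obtain ⟨c, hc⟩ := h2.exists_ae_eq_primitive hL
  refine ⟨c, t, b, ht, hb, ht', hb', ?_, ht'', hb''⟩
  filter_upwards [hc, ae_restrict_mem measurableSet_Ioo] with x hx hx'
  rw [hx, integral_congr_leb ht' (Ioo_subset_Icc_self hx')]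

theorem IsRep.continuous_y {L : ℝ} {v : V L} {y0 : R3} {t b : ℝ → R3} (h : IsRep v y0 t b) :
    Continuous fun x => y0 + ∫ s in 0..x, t s :=
  continuous_const.add (intervalIntegral.continuous_primitive
    (fun _ _ => h.cont_t.intervalIntegrable _ _) 0)

theorem forall_Icc_of_ae {L : ℝ} (hL : 0 < L) {f : ℝ → ℝ} (hf : Continuous f) {c : ℝ}
    (h : ∀ᵐ x ∂(leb L), f x = c) : ∀ x ∈ Icc 0 L, f x = c := fun _ hx =>
  eqOn_Icc_of_ae_eq (g := fun _ => c) hL hf.continuousOn continuousOn_const h hx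

theorem IsRep.frame {L : ℝ} (hL : 0 < L) {W : Type*} [NormedAddCommGroup W]
    [NormedSpace ℝ W] {Lbc : V L →L[ℝ] W} {lbc : W} {v : V L} {y0 : R3} {t b : ℝ → R3}
    (h : IsRep v y0 t b) (hv : v ∈ frames Lbc lbc) :
    ∀ x ∈ Icc 0 L, ‖t x‖ = 1 ∧ ‖b x‖ = 1 ∧ inner ℝ (t x) (b x) = 0 := by
  have hfr : ∀ᵐ x ∂(leb L), ‖t x‖ = 1 ∧ ‖b x‖ = 1 ∧ inner ℝ (t x) (b x) = 0 := by
    filter_upwards [hv.1, h.ae_t, h.ae_b] with x h1 h2 h3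
    rw [← h2, ← h3]
    exact (frameMatrix_mem_iff _ _).1 h1
  exact fun x hx => ⟨forall_Icc_of_ae hL h.cont_t.norm (hfr.mono fun x hx => hx.1) x hx,
    forall_Icc_of_ae hL h.cont_b.norm (hfr.mono fun x hx => hx.2.1) x hx,
    forall_Icc_of_ae hL (h.cont_t.inner h.cont_b) (hfr.mono fun x hx => hx.2.2) x hx⟩

theorem IsRep.isRibbonCurve {L : ℝ} (hL : 0 < L) {W : Type*} [NormedAddCommGroup W]
    [NormedSpace ℝ W] {Lbc : V L →L[ℝ] W} {lbc : W} {v : V L} {y0 : R3} {t b : ℝ → R3}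
    (h : IsRep v y0 t b) (hv : v ∈ ribbons Lbc lbc) : IsRibbonCurve L t b v.ddy v.db :=
  { meas_p := Lp.stronglyMeasurable _
    meas_q := Lp.stronglyMeasurable _
    memLp_p := Lp.memLp _
    memLp_q := Lp.memLp _
    cont_t := h.cont_t
    cont_b := h.cont_b
    eq_t := h.eq_t
    eq_b := h.eq_b
    norm_t := fun x hx => (h.frame hL hv.1 x hx).1
    norm_b := fun x hx => (h.frame hL hv.1 x hx).2.1
    inner_t_b := fun x hx => (h.frame hL hv.1 x hx).2.2
    inner_t_q := by
      filter_upwards [hv.2, h.ae_t] with x h1 h2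
      rw [← h2]
      exact h1 }

/-! ### Energies -/

theorem IsRegularizedModulus.continuous {m : ℝ → ℝ → ℝ} (hm : IsRegularizedModulus m) {δ : ℝ}
    (hδ : 0 ≤ δ) : Continuous (m δ) := by
  rcases eq_or_lt_of_le hδ with rfl | h
  · obtain ⟨c, hc⟩ := hm.uniform
    have : m 0 = fun x => abs x := funext fun x => by
      have := hc 0 le_rfl x
      rw [mul_zero] at this
      exact sub_eq_zero.1 (abs_nonpos_iff.1 this)
    rw [this]
    exact continuous_abs
  · exact (hm.contDiff δ h).continuous

/-- The regularized elastic energy is uniformly close to the elastic energy. -/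
theorem exists_abs_elastic_sub_energy_le {L : ℝ} {m : ℝ → ℝ → ℝ}
    (hm : IsRegularizedModulus m) : ∃ C : ℝ, ∀ δ, 0 ≤ δ → ∀ v : V L,
      |1 / 2 * ∫ x, (‖v.ddy x‖ ^ 2 + 5 * ‖v.db x‖ ^ 2
        + psi m δ (‖v.ddy x‖ ^ 2) (‖v.db x‖ ^ 2)) ∂(leb L) - energy v| ≤ C * δ := by
  obtain ⟨c, hc⟩ := hm.uniform
  refine ⟨5 / 2 * c * (leb L).real univ, fun δ hδ v => ?_⟩
  have hmc := hm.continuous hδ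
  have hpt : ∀ α β : ℝ, |1 / 2 * (α ^ 2 + 5 * β ^ 2 + psi m δ (α ^ 2) (β ^ 2)) - Qbar α β|
      ≤ 5 / 2 * (c * δ) := abs_regularized_sub_Qbar_le (hm.nonneg δ hδ) (hc δ hδ)
  have hQ := integrable_Qbar (Lp.memLp v.ddy) (Lp.memLp v.db)
  set F : ℝ → ℝ := fun x => 1 / 2 * (‖v.ddy x‖ ^ 2 + 5 * ‖v.db x‖ ^ 2
        + psi m δ (‖v.ddy x‖ ^ 2) (‖v.db x‖ ^ 2)) with hF
  have h1 : Measurable fun x => ‖v.ddy x‖ ^ 2 :=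
    (Lp.stronglyMeasurable v.ddy).norm.measurable.pow_const 2
  have h2 : Measurable fun x => ‖v.db x‖ ^ 2 :=
    (Lp.stronglyMeasurable v.db).norm.measurable.pow_const 2
  have hFm : Measurable F := by
    have h3 := hmc.measurable.comp (h1.sub h2)
    have h4 := h3.add (((h2.pow_const 2).const_mul 4).div ((h1.add h2).add h3))
    exact ((h1.add (h2.const_mul 5)).add h4).const_mul (1 / 2)
  have hdiff : Integrable (fun x => F x - Qbar ‖v.ddy x‖ ‖v.db x‖) (leb L) :=
    Integrable.of_bound (hFm.aestronglyMeasurable.sub hQ.aestronglyMeasurable) (5 / 2 * (c * δ))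
      (Eventually.of_forall fun x => hpt _ _)
  -- The regularized density is integrable as a bounded perturbation of `Qbar`.
  have hFi : Integrable F (leb L) := by
    refine (hdiff.add hQ).congr (Eventually.of_forall fun x => ?_)
    simp
  rw [← integral_const_mul, energy, ← integral_sub hFi hQ]
  have := norm_integral_le_of_norm_le_const (μ := leb L)
    (f := fun x => F x - Qbar ‖v.ddy x‖ ‖v.db x‖) (C := 5 / 2 * (c * δ))
    (Eventually.of_forall fun x => hpt _ _)
  calc _ ≤ 5 / 2 * (c * δ) * (leb L).real univ := this
    _ = _ := by ring

theorem penalty_nonneg {L ε₁ ε₂ : ℝ} (h₁ : 0 < ε₁) (h₂ : 0 < ε₂) (v : V L) :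
    0 ≤ penalty ε₁ ε₂ v := by
  unfold penalty
  have k1 : 0 ≤ ∫ x, inner ℝ (v.dy x) (v.b x) ^ 2 ∂(leb L) := integral_nonneg fun x => sq_nonneg _
  have k2 : 0 ≤ ∫ x, inner ℝ (v.dy x) (v.db x) ^ 2 ∂(leb L) := integral_nonneg fun x => sq_nonneg _
  positivity

theorem integral_sq_le {L C : ℝ} {f : ℝ → ℝ} (h : ∀ᵐ x ∂(leb L), |f x| ≤ C) :
    ∫ x, f x ^ 2 ∂(leb L) ≤ C ^ 2 * (leb L).real univ := by
  have := norm_integral_le_of_norm_le_const (μ := leb L) (f := fun x => f x ^ 2) (C := C ^ 2)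
    (h.mono fun x hx => by
      rw [Real.norm_of_nonneg (sq_nonneg _), ← sq_abs]
      gcongr)
  exact (le_abs_self _).trans this

/-- Recovery sequences: every admissible ribbon is approximated in energy by discretely
admissible pairs, provided that the mesh-size is small compared to the penalty parameters. -/
theorem exists_recovery {L : ℝ} (hL : 0 < L) {W : Type*} [NormedAddCommGroup W] [NormedSpace ℝ W]
    {Lbc : V L →L[ℝ] W} {lbc : W}
    (hLbc : ∀ v w : V L, SameBoundaryValues v w → Lbc v = Lbc w)
    {m : ℝ → ℝ → ℝ} (hm : IsRegularizedModulus m) {T : ℕ → Mesh L}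
    (hsize : Tendsto (fun n => (T n).size) atTop (𝓝 0)) {δ ε₁ ε₂ : ℕ → ℝ}
    (hδ : ∀ n, 0 ≤ δ n) (hδ0 : Tendsto δ atTop (𝓝 0))
    (hr₁ : Tendsto (fun n => (T n).size ^ 2 / ε₁ n) atTop (𝓝 0))
    (hr₂ : Tendsto (fun n => (T n).size ^ 2 / ε₂ n) atTop (𝓝 0))
    (hε₁ : ∀ n, 0 < ε₁ n) (hε₂ : ∀ n, 0 < ε₂ n)
    {w : V L} (hw : w ∈ ribbons Lbc lbc) {e : ℝ} (he : 0 < e) :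
    ∃ v : ℕ → V L, (∀ n, v n ∈ discreteAdmissible Lbc lbc (T n)) ∧
      ∀ᶠ n in atTop, penEnergy m (δ n) (ε₁ n) (ε₂ n) (v n) ≤ energy w + e := by
  obtain ⟨y0, t, b, hrep⟩ := exists_isRep hL w
  -- Half of `e` pays for the time change and fixes `K`; the other half absorbs everything that
  -- depends on `n`. Since `K` does not depend on `n`, the interpolation constants are uniform.
  obtain ⟨K, t', b', p, q, h, hp, hq, ht0, htL, hb0, hbL, hti, hE⟩ :=
    (hrep.isRibbonCurve hL hw).exists_bounded hL (η := e / 2) (by positivity)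
  have hwy : HasEndpointValues w.y y0 (y0 + ∫ s in 0..L, t s) :=
    ⟨_, hrep.continuous_y.continuousOn, hrep.ae_y, by simp, rfl⟩
  have hwt : HasEndpointValues w.dy (t' 0) (t' L) :=
    ⟨t, hrep.cont_t.continuousOn, hrep.ae_t, ht0.symm, htL.symm⟩
  have hwb : HasEndpointValues w.b (b' 0) (b' L) :=
    ⟨b, hrep.cont_b.continuousOn, hrep.ae_b, hb0.symm, hbL.symm⟩
  have hK0 : 0 ≤ K := (norm_nonneg _).trans (hp 0)
  choose v hvA hvddy hvdb hvpen using fun n =>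
    h.exists_interpolant hL hLbc hw.1.2 hp hq hwy hwt hwb (by rw [hti]) (T n)
  refine ⟨v, hvA, ?_⟩
  have hEn : Tendsto (fun n => energy (v n)) atTop (𝓝 (∫ x, Qbar ‖p x‖ ‖q x‖ ∂(leb L))) := by
    -- The majorant is the mesh-independent bound on the interpolated derivatives, and pointwise
    -- convergence holds wherever `t'` and `b'` are differentiable, hence almost everywhere.
    refine tendsto_integral_of_dominated_convergence (fun _ => (14 * K) ^ 2 + 4 * (2 * K) ^ 2)
      (fun n => (integrable_Qbar (Lp.memLp _) (Lp.memLp _)).aestronglyMeasurable)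
      (integrable_const _) (fun n => ?_) ?_
    · filter_upwards [hvddy n, hvdb n, ae_restrict_mem measurableSet_Ioo] with x h1 h2 hx
      have k1 := ((T n).norm_interp_le h.cont_t (fun r hr s hs =>
        norm_sub_le_of_primitive h.memLp_p hL h.eq_t (fun x _ => hp x) hr hs) hK0
        (Ioo_subset_Ico_self hx)).1
      have k2 := ((T n).norm_interp_le h.cont_b (fun r hr s hs =>
        norm_sub_le_of_primitive h.memLp_q hL h.eq_b (fun x _ => hq x) hr hs) hK0
        (Ioo_subset_Ico_self hx)).2
      rw [h1, h2, Real.norm_of_nonneg (Qbar_nonneg _ _)]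
      refine (Qbar_le _ _).trans ?_
      gcongr
    · filter_upwards [ae_all_iff.2 hvddy, ae_all_iff.2 hvdb, ae_restrict_mem measurableSet_Ioo,
        ae_hasDerivAt_of_primitive hL h.memLp_p h.eq_t,
        ae_hasDerivAt_of_primitive hL h.memLp_q h.eq_b] with x h1 h2 hx h3 h4
      have k1 := (tendsto_interp hsize h.cont_t (Ioo_subset_Ico_self hx) h3).1.norm
      have k2 := (tendsto_interp hsize h.cont_b (Ioo_subset_Ico_self hx) h4).2.norm
      simp only [h1, h2]
      exact (continuous_Qbar.tendsto (‖p x‖, ‖q x‖)).comp (k1.prodMk_nhds k2)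
  obtain ⟨C, hC⟩ := exists_abs_elastic_sub_energy_le (L := L) hm
  set C₁ := 14 * K * (1 + 2 * K * L) + 2 * K with hC₁
  set ℓ := (leb L).real univ with hℓ
  have hub : ∀ n, penEnergy m (δ n) (ε₁ n) (ε₂ n) (v n) ≤ energy (v n) + C * δ n
      + 1 / 2 * C₁ ^ 2 * ℓ * ((T n).size ^ 2 / ε₁ n)
      + 1 / 2 * (15 * K ^ 2) ^ 2 * ℓ * ((T n).size ^ 2 / ε₂ n) := by
    intro n
    have k1 := (abs_le.1 (hC (δ n) (hδ n) (v n))).2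
    have k2 := integral_sq_le ((hvpen n).mono fun x hx => hx.1)
    have k3 := integral_sq_le ((hvpen n).mono fun x hx => hx.2)
    have p1 := hε₁ n
    have p2 := hε₂ n
    have l1 : 1 / (2 * ε₁ n) * ∫ x, inner ℝ ((v n).dy x) ((v n).b x) ^ 2 ∂(leb L)
        ≤ 1 / 2 * C₁ ^ 2 * ℓ * ((T n).size ^ 2 / ε₁ n) := by
      calc _ ≤ 1 / (2 * ε₁ n) * ((C₁ * (T n).size) ^ 2 * ℓ) := by gcongr
        _ = _ := by field_simp
    have l2 : 1 / (2 * ε₂ n) * ∫ x, inner ℝ ((v n).dy x) ((v n).db x) ^ 2 ∂(leb L)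
        ≤ 1 / 2 * (15 * K ^ 2) ^ 2 * ℓ * ((T n).size ^ 2 / ε₂ n) := by
      calc _ ≤ 1 / (2 * ε₂ n) * ((15 * K ^ 2 * (T n).size) ^ 2 * ℓ) := by gcongr
        _ = _ := by field_simp
    unfold penEnergy penalty
    linarith
  have hlim := ((hEn.add (hδ0.const_mul C)).add (hr₁.const_mul (1 / 2 * C₁ ^ 2 * ℓ))).add
    (hr₂.const_mul (1 / 2 * (15 * K ^ 2) ^ 2 * ℓ))
  simp only [mul_zero, add_zero] at hlim
  have hlt : ∫ x, Qbar ‖p x‖ ‖q x‖ ∂(leb L) < energy w + e := by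
    change _ ≤ energy w + e / 2 at hE
    linarith
  filter_upwards [hlim.eventually (gt_mem_nhds hlt)] with n hn
  exact (hub n).trans hn.le


/-! ### Weak convergence -/

theorem tendsto_of_weak {L : ℝ} {u : ℕ → V L} {v : V L}
    (h : Tendsto (fun n => toWeakSpace ℝ (V L) (u n)) atTop (𝓝 (toWeakSpace ℝ (V L) v)))
    (l : V L →L[ℝ] ℝ) : Tendsto (fun n => l (u n)) atTop (𝓝 (l v)) :=
  ((WeakBilin.eval_continuous (topDualPairing ℝ (V L)).flip l).tendsto _).comp h

theorem inner_toLp {L : ℝ} {f : ℝ → R3} (hf : MemLp f 2 (leb L)) (u : L2 L) :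
    inner ℝ (hf.toLp f) u = ∫ x, inner ℝ (f x) (u x) ∂(leb L) := by
  rw [L2.inner_def]
  refine integral_congr_ae ?_
  filter_upwards [hf.coeFn_toLp] with x hx
  rw [hx]

theorem integrable_inner_of_memLp {L : ℝ} {f : ℝ → R3} (hf : MemLp f 2 (leb L)) (u : L2 L) :
    Integrable (fun x => inner ℝ (f x) (u x)) (leb L) := by
  refine (L2.integrable_inner (𝕜 := ℝ) (hf.toLp f) u).congr ?_
  filter_upwards [hf.coeFn_toLp] with x hx
  rw [hx]

theorem tendsto_integral_inner_of_weak {L : ℝ} {u : ℕ → V L} {v : V L}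
    (h : Tendsto (fun n => toWeakSpace ℝ (V L) (u n)) atTop (𝓝 (toWeakSpace ℝ (V L) v)))
    {f : ℝ → R3} (hf : MemLp f 2 (leb L)) (A : V L →L[ℝ] L2 L) :
    Tendsto (fun n => ∫ x, inner ℝ (f x) (A (u n) x) ∂(leb L)) atTop
      (𝓝 (∫ x, inner ℝ (f x) (A v x) ∂(leb L))) := by
  have := tendsto_of_weak h ((innerSL ℝ (hf.toLp f)).comp A)
  simpa only [ContinuousLinearMap.comp_apply, innerSL_apply_apply, inner_toLp] using this

/-- The components of an element of `V`, as bounded linear operators. -/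
theorem exists_components (L : ℝ) :
    (∃ A : V L →L[ℝ] L2 L, ∀ v, A v = v.dy) ∧ (∃ A : V L →L[ℝ] L2 L, ∀ v, A v = v.ddy) ∧
    (∃ A : V L →L[ℝ] L2 L, ∀ v, A v = v.b) ∧ (∃ A : V L →L[ℝ] L2 L, ∀ v, A v = v.db) :=
  ⟨⟨(PiLp.proj 2 (fun _ : Fin 3 => L2 L) 1).comp
      ((Hk L 2).subtypeL.comp (ContinuousLinearMap.fst ℝ _ _)), fun _ => rfl⟩,
    ⟨(PiLp.proj 2 (fun _ : Fin 3 => L2 L) 2).comp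
      ((Hk L 2).subtypeL.comp (ContinuousLinearMap.fst ℝ _ _)), fun _ => rfl⟩,
    ⟨(PiLp.proj 2 (fun _ : Fin 2 => L2 L) 0).comp
      ((Hk L 1).subtypeL.comp (ContinuousLinearMap.snd ℝ _ _)), fun _ => rfl⟩,
    ⟨(PiLp.proj 2 (fun _ : Fin 2 => L2 L) 1).comp
      ((Hk L 1).subtypeL.comp (ContinuousLinearMap.snd ℝ _ _)), fun _ => rfl⟩⟩

/-- Weak lower semicontinuity of the elastic energy. -/
theorem eventually_energy_le_of_weak {L : ℝ} {u : ℕ → V L} {v : V L}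
    (h : Tendsto (fun n => toWeakSpace ℝ (V L) (u n)) atTop (𝓝 (toWeakSpace ℝ (V L) v)))
    {e : ℝ} (he : 0 < e) : ∀ᶠ n in atTop, energy v ≤ energy (u n) + e := by
  obtain ⟨-, ⟨A, hA⟩, -, ⟨B, hB⟩⟩ := exists_components L
  set l : ℝ → ℝ := fun x => lam ‖v.ddy x‖ ‖v.db x‖ with hl
  have mp : Measurable fun x => ‖v.ddy x‖ := (Lp.stronglyMeasurable v.ddy).norm.measurable
  have mq : Measurable fun x => ‖v.db x‖ := (Lp.stronglyMeasurable v.db).norm.measurable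
  have ml : Measurable l := by
    have : l = fun x => if ‖v.db x‖ ≤ ‖v.ddy x‖ then ‖v.db x‖ ^ 2 / ‖v.ddy x‖ ^ 2 else 1 := by
      funext x
      simp only [hl, lam, abs_norm]
    rw [this]
    exact Measurable.ite (measurableSet_le mq mp) ((mq.pow_const 2).div (mp.pow_const 2))
      measurable_const
  have l0 : ∀ x, 0 ≤ l x := fun x => lam_nonneg _ _
  have l1 : ∀ x, l x ≤ 1 := fun x => lam_le_one _ _
  have hf : MemLp (fun x => (2 * (1 - l x ^ 2)) • v.ddy x) 2 (leb L) := by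
    refine (Lp.memLp v.ddy).of_le_mul (c := 2)
      ((((ml.pow_const 2).const_sub 1).const_mul 2).stronglyMeasurable.smul
        (Lp.stronglyMeasurable v.ddy)).aestronglyMeasurable (Eventually.of_forall fun x => ?_)
    rw [norm_smul, Real.norm_of_nonneg (by nlinarith [l0 x, l1 x])]
    gcongr
    nlinarith [l0 x, l1 x]
  have hg : MemLp (fun x => (2 * (2 + 2 * l x)) • v.db x) 2 (leb L) := by
    refine (Lp.memLp v.db).of_le_mul (c := 8)
      ((((ml.const_mul 2).const_add 2).const_mul 2).stronglyMeasurable.smul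
        (Lp.stronglyMeasurable v.db)).aestronglyMeasurable (Eventually.of_forall fun x => ?_)
    rw [norm_smul, Real.norm_of_nonneg (by nlinarith [l0 x, l1 x])]
    gcongr
    nlinarith [l0 x, l1 x]
  have t1 := tendsto_integral_inner_of_weak h hf A
  have t2 := tendsto_integral_inner_of_weak h hg B
  simp only [hA, hB] at t1 t2
  -- The optimal parameter is frozen at the limit. The resulting lower bound is affine in `u n`,
  -- with `L²` coefficients because `l` takes values in `[0,1]`, so its correction terms vanish
  -- under weak convergence.
  have key : ∀ n, energy v
      + ((∫ x, inner ℝ ((2 * (1 - l x ^ 2)) • v.ddy x) ((u n).ddy x) ∂(leb L))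
        - ∫ x, inner ℝ ((2 * (1 - l x ^ 2)) • v.ddy x) (v.ddy x) ∂(leb L))
      + ((∫ x, inner ℝ ((2 * (2 + 2 * l x)) • v.db x) ((u n).db x) ∂(leb L))
        - ∫ x, inner ℝ ((2 * (2 + 2 * l x)) • v.db x) (v.db x) ∂(leb L)) ≤ energy (u n) := by
    intro n
    have hQ := integrable_Qbar (Lp.memLp v.ddy) (Lp.memLp v.db)
    have i1 := (integrable_inner_of_memLp hf (u n).ddy).sub (integrable_inner_of_memLp hf v.ddy)
    have i2 := (integrable_inner_of_memLp hg (u n).db).sub (integrable_inner_of_memLp hg v.db)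
    rw [← integral_sub (integrable_inner_of_memLp hf _) (integrable_inner_of_memLp hf _),
      ← integral_sub (integrable_inner_of_memLp hg _) (integrable_inner_of_memLp hg _),
      energy, energy]
    have e1 := integral_add hQ i1
    have e2 := integral_add (hQ.add i1) i2
    simp only [Pi.add_apply, Pi.sub_apply] at e1 e2
    rw [← e1, ← e2]
    refine integral_mono ((hQ.add i1).add i2)
      (integrable_Qbar (Lp.memLp (u n).ddy) (Lp.memLp (u n).db)) fun x => ?_
    refine le_trans (le_of_eq ?_) (Qbar_add_le (v.ddy x) (v.db x) ((u n).ddy x) ((u n).db x))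
    simp only [inner_smul_left, inner_sub_right, hl, RCLike.conj_to_real]
    ring
  have t3 := (t1.sub_const (∫ x, inner ℝ ((2 * (1 - l x ^ 2)) • v.ddy x) (v.ddy x) ∂(leb L))).add
    (t2.sub_const (∫ x, inner ℝ ((2 * (2 + 2 * l x)) • v.db x) (v.db x) ∂(leb L)))
  rw [sub_self, sub_self, add_zero] at t3
  filter_upwards [t3.eventually (lt_mem_nhds (neg_lt_zero.2 he))] with n hn
  have := key n
  linarith

/-- Pointwise convergence of continuous representatives. -/
theorem tendsto_primitive_of_weak {L : ℝ} (hL : 0 < L) {t p : ℕ → ℝ → R3} {t' p' : ℝ → R3}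
    (hp : ∀ n, MemLp (p n) 2 (leb L)) (hp' : MemLp p' 2 (leb L))
    (ht : ∀ n, Continuous (t n)) (ht' : Continuous t')
    (he : ∀ n, ∀ x ∈ Icc 0 L, t n x = t n 0 + ∫ s in 0..x, p n s)
    (he' : ∀ x ∈ Icc 0 L, t' x = t' 0 + ∫ s in 0..x, p' s) {M : ℝ}
    (hM : ∀ n, ∀ x ∈ Ico 0 L, ‖t n x‖ ≤ M)
    (hwt : ∀ f : ℝ → R3, MemLp f 2 (leb L) → Tendsto (fun n => ∫ x, inner ℝ (f x) (t n x) ∂(leb L))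
      atTop (𝓝 (∫ x, inner ℝ (f x) (t' x) ∂(leb L))))
    (hwp : ∀ f : ℝ → R3, MemLp f 2 (leb L) → Tendsto (fun n => ∫ x, inner ℝ (f x) (p n x) ∂(leb L))
      atTop (𝓝 (∫ x, inner ℝ (f x) (p' x) ∂(leb L)))) {x : ℝ} (hx : x ∈ Ico 0 L) :
    Tendsto (fun n => t n x) atTop (𝓝 (t' x)) := by
  have h0 : (0 : ℝ) ∈ Ico 0 L := ⟨le_rfl, hL⟩
  -- Increments are pairings of the derivative with an indicator function, hence weakly continuous.
  have hinc : ∀ (τ π : ℝ → R3), MemLp π 2 (leb L) →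
      (∀ x ∈ Icc 0 L, τ x = τ 0 + ∫ s in 0..x, π s) → ∀ c : R3, ∀ x ∈ Ico 0 L,
      inner ℝ c (τ x - τ 0) = ∫ s, inner ℝ ((Ioo 0 x).indicator (fun _ => c) s) (π s) ∂(leb L) := by
    intro τ π hπ hτ c x hx
    have hπi : IntervalIntegrable π volume 0 L :=
      (intervalIntegrable_iff_integrable_leb hL).2 (hπ.integrable (by norm_num))
    have hπx : IntervalIntegrable π volume 0 x := Mesh.intervalIntegrable_of_subset hπi
      (Ico_subset_Icc_self h0) (Ico_subset_Icc_self hx)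
    rw [hτ x (Ico_subset_Icc_self hx), add_sub_cancel_left]
    have e1 : inner ℝ c (∫ s in 0..x, π s) = ∫ s in 0..x, inner ℝ c (π s) :=
      ((innerSL ℝ c).intervalIntegral_comp_comm hπx).symm
    have e2 : (fun s => inner ℝ ((Ioo 0 x).indicator (fun _ => c) s) (π s))
        = (Ioo 0 x).indicator fun s => inner ℝ c (π s) := by
      funext s
      by_cases hs : s ∈ Ioo 0 x
      · simp [hs]
      · simp [hs]
    rw [e1, e2, integral_indicator measurableSet_Ioo, Measure.restrict_restrict measurableSet_Ioo,
      inter_eq_left.2 (Ioo_subset_Ioo_right hx.2.le), intervalIntegral.integral_of_le hx.1,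
      integral_Ioc_eq_integral_Ioo]
  have hdiff : ∀ c : R3, ∀ x ∈ Ico 0 L,
      Tendsto (fun n => inner ℝ c (t n x - t n 0)) atTop (𝓝 (inner ℝ c (t' x - t' 0))) := by
    intro c x hx
    have := hwp ((Ioo 0 x).indicator fun _ => c)
      ((memLp_const c).indicator measurableSet_Ioo)
    rw [← hinc t' p' hp' he' c x hx] at this
    refine this.congr fun n => ?_
    rw [← hinc (t n) (p n) (hp n) (he n) c x hx]
  have hint : ∀ (τ : ℝ → R3), Continuous τ → ∀ c : R3, ∫ x, inner ℝ c (τ x - τ 0) ∂(leb L)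
      = ∫ x, inner ℝ c (τ x) ∂(leb L) - L * inner ℝ c (τ 0) := by
    intro τ hτ c
    have i1 : Integrable (fun x => inner ℝ c (τ x)) (leb L) :=
      (intervalIntegrable_iff_integrable_leb hL).1
        ((continuous_const.inner hτ).intervalIntegrable _ _)
    simp only [inner_sub_right]
    rw [integral_sub i1 (integrable_const _), integral_const]
    congr 1
    simp [Measure.real, hL.le]
  -- The value at `0` is recovered from means: `L` times it equals the integral of the function,
  -- which converges weakly, minus the integral of the increments, which converges by domination.
  have hzero : ∀ c : R3, Tendsto (fun n => inner ℝ c (t n 0)) atTop (𝓝 (inner ℝ c (t' 0))) := by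
    intro c
    have d1 : Tendsto (fun n => ∫ x, inner ℝ c (t n x - t n 0) ∂(leb L)) atTop
        (𝓝 (∫ x, inner ℝ c (t' x - t' 0) ∂(leb L))) := by
      refine tendsto_integral_of_dominated_convergence (fun _ => ‖c‖ * (M + M)) (fun n => ?_)
        (integrable_const _) (fun n => ?_) ?_
      · have hc := ht n
        exact Continuous.aestronglyMeasurable (by fun_prop)
      · filter_upwards [ae_restrict_mem measurableSet_Ioo] with x hx
        refine (norm_inner_le_norm _ _).trans ?_
        gcongr
        exact (norm_sub_le _ _).trans (add_le_add (hM n x (Ioo_subset_Ico_self hx)) (hM n 0 h0))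
      · filter_upwards [ae_restrict_mem measurableSet_Ioo] with x hx
        exact hdiff c x (Ioo_subset_Ico_self hx)
    have d2 := ((hwt (fun _ => c) (memLp_const c)).sub d1).const_mul L⁻¹
    rw [hint t' ht' c, sub_sub_cancel, inv_mul_cancel_left₀ hL.ne'] at d2
    refine d2.congr fun n => ?_
    rw [hint (t n) (ht n) c, sub_sub_cancel, inv_mul_cancel_left₀ hL.ne']
  have hall : ∀ c : R3, Tendsto (fun n => inner ℝ c (t n x)) atTop (𝓝 (inner ℝ c (t' x))) := by
    intro c
    have := (hdiff c x hx).add (hzero c)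
    simpa only [inner_sub_right, sub_add_cancel] using this
  have hcoord : ∀ i : Fin 3, Tendsto (fun n => (t n x - t' x) i) atTop (𝓝 0) := by
    intro i
    have := (hall (EuclideanSpace.single i 1)).sub_const (t' x i)
    simpa [EuclideanSpace.inner_single_left] using this
  rw [tendsto_iff_norm_sub_tendsto_zero]
  have hsq : Tendsto (fun n => ‖t n x - t' x‖ ^ 2) atTop (𝓝 0) := by
    simp only [norm_sq_eq_sum]
    simpa using (((hcoord 0).pow 2).add ((hcoord 1).pow 2)).add ((hcoord 2).pow 2)
  simpa using hsq.sqrt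


/-! ### Limits of discretely admissible pairs -/

/-- Admissibility speaks of some spline representatives; continuous representatives agree on
`[0,L]`, so the nodal conditions transfer to `t` and `b`, with `t` the derivative of the
representative of `y`. -/
theorem norm_eq_one_at_nodes {L : ℝ} (hL : 0 < L) {W : Type*} [NormedAddCommGroup W]
    [NormedSpace ℝ W] {Lbc : V L →L[ℝ] W} {lbc : W} {T : Mesh L} {v : V L}
    (hv : v ∈ discreteAdmissible Lbc lbc T) {y0 : R3} {t b : ℝ → R3} (h : IsRep v y0 t b)
    (j : Fin (T.N + 1)) : ‖t (T.node j)‖ = 1 ∧ ‖b (T.node j)‖ = 1 := by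
  obtain ⟨⟨g, r, hg, hr, hvg, hvr, hn⟩, -⟩ := hv
  have e1 : EqOn g (fun x => y0 + ∫ s in 0..x, t s) (Icc 0 L) :=
    eqOn_Icc_of_ae_eq hL hg.1.continuousOn h.continuous_y.continuousOn (hvg.symm.trans h.ae_y)
  have e2 : EqOn r b (Icc 0 L) :=
    eqOn_Icc_of_ae_eq hL hr.1.continuousOn h.cont_b.continuousOn (hvr.symm.trans h.ae_b)
  have hd : HasDerivAt (fun x => y0 + ∫ s in 0..x, t s) (t (T.node j)) (T.node j) :=
    (intervalIntegral.integral_hasDerivAt_right (h.cont_t.intervalIntegrable _ _)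
      h.cont_t.stronglyMeasurable.stronglyMeasurableAtFilter h.cont_t.continuousAt).const_add y0
  have hj := T.node_mem_Icc j
  have e3 : derivWithin g (Icc 0 L) (T.node j) = t (T.node j) := by
    rw [derivWithin_congr e1 (e1 hj)]
    exact hd.hasDerivWithinAt.derivWithin (uniqueDiffOn_Icc hL _ hj)
  have hnj := hn j
  rw [e3, e2 hj] at hnj
  exact ⟨(pow_eq_one_iff_of_nonneg (norm_nonneg _) two_ne_zero).1 hnj.1,
    (pow_eq_one_iff_of_nonneg (norm_nonneg _) two_ne_zero).1 hnj.2⟩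

/-- A function that is normalized at the nodes is nearly normalized everywhere. -/
theorem abs_norm_sub_one_le {L K : ℝ} (hL : 0 < L) {T : Mesh L} {t : ℝ → R3} {p : L2 L}
    (he : ∀ x ∈ Icc 0 L, t x = t 0 + ∫ s in 0..x, p s)
    (hK : ∫ x, ‖p x‖ ^ 2 ∂(leb L) ≤ K) (hn : ∀ j, ‖t (T.node j)‖ = 1) {x : ℝ} (hx : x ∈ Ico 0 L) :
    |‖t x‖ - 1| ≤ √T.size * (1 + K) := by
  obtain ⟨j, hj⟩ := T.exists_mem_Ico hx
  have hxI := Ico_subset_Icc_self hx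
  have haI := T.node_mem_Icc j.castSucc
  set a := T.node j.castSucc with ha
  have hlen : x - a ≤ T.size := by
    have := T.len_le_size j
    unfold Mesh.len at this
    linarith [hj.2]
  have hs0 : 0 < T.size := (T.len_pos j).trans_le (T.len_le_size j)
  set c := √T.size with hc
  have hc0 : 0 < c := Real.sqrt_pos.2 hs0
  have hcc : c * c = T.size := Real.mul_self_sqrt hs0.le
  have hpi := intervalIntegrable_L2 hL p
  have h0 : (0 : ℝ) ∈ Icc 0 L := ⟨le_rfl, hL.le⟩
  have hpax : IntervalIntegrable p volume a x := Mesh.intervalIntegrable_of_subset hpi haI hxI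
  have e : t x - t a = ∫ s in a..x, p s := by
    rw [he x hxI, he a haI, add_sub_add_left_eq_sub]
    exact intervalIntegral.integral_interval_sub_left
      (Mesh.intervalIntegrable_of_subset hpi h0 hxI) (Mesh.intervalIntegrable_of_subset hpi h0 haI)
  have hsq : Integrable (fun s => ‖p s‖ ^ 2) (leb L) :=
    (Lp.memLp p).integrable_norm_pow two_ne_zero
  have hsqi : IntervalIntegrable (fun s => ‖p s‖ ^ 2) volume 0 L :=
    (intervalIntegrable_iff_integrable_leb hL).2 hsq
  have hsqa : IntervalIntegrable (fun s => ‖p s‖ ^ 2) volume a x :=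
    hsqi.mono_set (uIcc_subset_uIcc (Icc_subset_uIcc haI) (Icc_subset_uIcc hxI))
  have hK0 : 0 ≤ K := (integral_nonneg fun s => sq_nonneg ‖p s‖).trans hK
  have hle : ∫ s in a..x, ‖p s‖ ^ 2 ≤ K := by
    refine le_trans ?_ hK
    rw [integral_leb hL]
    exact intervalIntegral.integral_mono_interval haI.1 hj.1 hxI.2
      (Eventually.of_forall fun s => sq_nonneg ‖p s‖) hsqi
  have main : ‖t x - t a‖ ≤ c * (1 + K) := by
    rw [e]
    calc _ ≤ ∫ s in a..x, ‖p s‖ := intervalIntegral.norm_integral_le_integral_norm hj.1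
      -- Young's inequality with weight `c = √T.size` balances the two terms and replaces the Hölder
      -- estimate for `H¹` functions.
      _ ≤ ∫ s in a..x, (c⁻¹ + c * ‖p s‖ ^ 2) := by
        refine intervalIntegral.integral_mono_on hj.1 hpax.norm
          (intervalIntegrable_const.add (hsqa.const_mul c)) fun s _ => ?_
        have : 0 ≤ c⁻¹ * (1 - c * ‖p s‖) ^ 2 := by positivity
        have e' : c⁻¹ * (1 - c * ‖p s‖) ^ 2 = c⁻¹ - 2 * ‖p s‖ + c * ‖p s‖ ^ 2 := by
          field_simp
          ring
        linarith [norm_nonneg (p s)]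
      _ = (x - a) * c⁻¹ + c * ∫ s in a..x, ‖p s‖ ^ 2 := by
        rw [intervalIntegral.integral_add intervalIntegrable_const (hsqa.const_mul c),
          intervalIntegral.integral_const, intervalIntegral.integral_const_mul, smul_eq_mul]
      _ ≤ (c * c) * c⁻¹ + c * K := by rw [hcc]; gcongr
      _ = c * (1 + K) := by field_simp
  have := (abs_norm_sub_norm_le (t x) (t a)).trans main
  rwa [hn j.castSucc] at this

/-- If `tn` converges boundedly to the unit field `t`, `qn` converges weakly to `q` and `tn · qn`
converges to zero in `L²`, then `t · q = 0`. -/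
theorem ae_inner_eq_zero_of_weak {L M K : ℝ} {tn : ℕ → ℝ → R3} {t : ℝ → R3} {qn : ℕ → L2 L}
    {q : L2 L} (htn : ∀ n, Continuous (tn n)) (ht : Continuous t)
    (bt : ∀ n, ∀ x ∈ Ico 0 L, ‖tn n x‖ ≤ M) (ntv : ∀ x ∈ Ico 0 L, ‖t x‖ = 1)
    (ct : ∀ x ∈ Ico 0 L, Tendsto (fun n => tn n x) atTop (𝓝 (t x)))
    (hKq : ∀ n, ∫ x, ‖qn n x‖ ^ 2 ∂(leb L) ≤ K)
    (hw : ∀ g : ℝ → R3, MemLp g 2 (leb L) →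
      Tendsto (fun n => ∫ x, inner ℝ (g x) (qn n x) ∂(leb L)) atTop
        (𝓝 (∫ x, inner ℝ (g x) (q x) ∂(leb L))))
    (h2 : Tendsto (fun n => ∫ x, inner ℝ (tn n x) (qn n x) ^ 2 ∂(leb L)) atTop (𝓝 0)) :
    ∀ᵐ x ∂(leb L), inner ℝ (t x) (q x) = 0 := by
  have mem : ∀ᵐ x ∂(leb L), x ∈ Ico 0 L :=
    (ae_restrict_mem measurableSet_Ioo).mono fun x hx => Ioo_subset_Ico_self hx
  have hK0 : 0 ≤ K := (integral_nonneg fun s => sq_nonneg ‖qn 0 s‖).trans (hKq 0)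
  set f : ℝ → ℝ := fun x => inner ℝ (t x) (q x) with hf
  have fm : StronglyMeasurable f :=
    ht.stronglyMeasurable.inner (Lp.stronglyMeasurable q)
  have fL : MemLp f 2 (leb L) := by
    refine (Lp.memLp q).of_le fm.aestronglyMeasurable ?_
    filter_upwards [mem] with x hx
    have := abs_real_inner_le_norm (t x) (q x)
    rwa [ntv x hx, one_mul] at this
  have f2 : Integrable (fun x => f x ^ 2) (leb L) := by
    simpa using fL.integrable_norm_pow two_ne_zero
  have ftL : MemLp (fun x => f x • t x) 2 (leb L) := by
    refine fL.of_le (fm.smul ht.stronglyMeasurable).aestronglyMeasurable ?_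
    filter_upwards [mem] with x hx
    rw [norm_smul, ntv x hx, mul_one]
  set F := ∫ x, f x ^ 2 ∂(leb L) with hF
  have hF0 : 0 ≤ F := integral_nonneg fun x => sq_nonneg _
  -- Testing the weak convergence with `f t`, where `f = t · q`, gives the limit `∫ f²`, which has
  -- to be shown to vanish.
  have l1 : Tendsto (fun n => ∫ x, inner ℝ (f x • t x) (qn n x) ∂(leb L)) atTop (𝓝 F) := by
    have := hw _ ftL
    refine this.trans_eq (congrArg _ ?_)
    refine integral_congr_ae (Eventually.of_forall fun x => ?_)
    simp only [inner_smul_left, RCLike.conj_to_real, hf]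
    ring
  have l2 : Tendsto (fun n => ∫ x, f x ^ 2 * ‖tn n x - t x‖ ^ 2 ∂(leb L)) atTop (𝓝 0) := by
    have : Tendsto (fun n => ∫ x, f x ^ 2 * ‖tn n x - t x‖ ^ 2 ∂(leb L)) atTop
        (𝓝 (∫ x, (0 : ℝ) ∂(leb L))) := by
      refine tendsto_integral_of_dominated_convergence (fun x => f x ^ 2 * ((M) + 1) ^ 2)
        (fun n => ?_) (f2.mul_const _) (fun n => ?_) ?_
      · exact ((fm.pow 2).mul
          ((((htn n).sub ht).norm.pow 2).stronglyMeasurable)).aestronglyMeasurable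
      · filter_upwards [mem] with x hx
        rw [Real.norm_of_nonneg (by positivity)]
        gcongr
        refine (norm_sub_le _ _).trans (add_le_add (bt n x hx) (ntv x hx).le)
      · filter_upwards [mem] with x hx
        have := ((((ct x hx).sub_const (t x)).norm).pow 2).const_mul (f x ^ 2)
        simpa using this
    simpa using this
  have zL : ∀ n, Integrable (fun x => inner ℝ (tn n x) (qn n x) ^ 2) (leb L) := by
    intro n
    have : MemLp (fun x => inner ℝ (tn n x) (qn n x)) 2 (leb L) := by
      refine (Lp.memLp (qn n)).of_le_mul (c := M)
        ((htn n).stronglyMeasurable.inner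
          (Lp.stronglyMeasurable (qn n))).aestronglyMeasurable ?_
      filter_upwards [mem] with x hx
      refine (norm_inner_le_norm _ _).trans ?_
      gcongr
      exact bt n x hx
    simpa using this.integrable_norm_pow two_ne_zero
  have gL : ∀ n, Integrable (fun x => f x ^ 2 * ‖tn n x - t x‖ ^ 2) (leb L) := by
    intro n
    refine (f2.mul_const (((M) + 1) ^ 2)).mono' ((fm.pow 2).mul
          ((((htn n).sub ht).norm.pow 2).stronglyMeasurable)).aestronglyMeasurable ?_
    filter_upwards [mem] with x hx
    rw [Real.norm_of_nonneg (by positivity)]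
    gcongr
    refine (norm_sub_le _ _).trans (add_le_add (bt n x hx) (ntv x hx).le)
  -- Replacing `t` by `tn` costs `f (tn - t) · qn`. Young's inequality with weight `c` separates the
  -- merely bounded factors from those vanishing in `L²`; `n → ∞` and then `c → 0` yield `∫ f² = 0`.
  have bound : ∀ c > 0, ∀ n, ∫ x, inner ℝ (f x • t x) (qn n x) ∂(leb L)
      ≤ c * (F + K) + c⁻¹ * ((∫ x, inner ℝ (tn n x) (qn n x) ^ 2 ∂(leb L))
        + ∫ x, f x ^ 2 * ‖tn n x - t x‖ ^ 2 ∂(leb L)) := by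
    intro c hc n
    have q2 : Integrable (fun x => ‖qn n x‖ ^ 2) (leb L) :=
      (Lp.memLp (qn n)).integrable_norm_pow two_ne_zero
    have i1 : Integrable (fun x => c * (f x ^ 2 + ‖qn n x‖ ^ 2)) (leb L) :=
      (f2.add q2).const_mul c
    have i2 : Integrable (fun x => c⁻¹ * (inner ℝ (tn n x) (qn n x) ^ 2
        + f x ^ 2 * ‖tn n x - t x‖ ^ 2)) (leb L) := ((zL n).add (gL n)).const_mul c⁻¹
    calc _ ≤ ∫ x, (c * (f x ^ 2 + ‖qn n x‖ ^ 2) + c⁻¹ * (inner ℝ (tn n x) (qn n x) ^ 2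
        + f x ^ 2 * ‖tn n x - t x‖ ^ 2)) ∂(leb L) := by
          refine integral_mono (integrable_inner_of_memLp ftL _) (i1.add i2) fun x => ?_
          simp only
          set z := inner ℝ (tn n x) (qn n x) with hz
          set g := |f x| * ‖tn n x - t x‖ with hg
          have k1 : inner ℝ (f x • t x) (qn n x)
              = f x * z - f x * inner ℝ (tn n x - t x) (qn n x) := by
            rw [inner_smul_left, inner_sub_left, RCLike.conj_to_real]
            ring
          have k2 : -(f x * inner ℝ (tn n x - t x) (qn n x)) ≤ g * ‖qn n x‖ := by
            refine (neg_le_abs _).trans ?_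
            rw [abs_mul, hg, mul_assoc]
            exact mul_le_mul_of_nonneg_left (abs_real_inner_le_norm _ _) (abs_nonneg _)
          have k3 : g ^ 2 = f x ^ 2 * ‖tn n x - t x‖ ^ 2 := by rw [hg, mul_pow, sq_abs]
          have amgm : ∀ r s : ℝ, 2 * (r * s) ≤ c * r ^ 2 + c⁻¹ * s ^ 2 := by
            intro r s
            have : 0 ≤ c⁻¹ * (c * r - s) ^ 2 := by positivity
            have e' : c⁻¹ * (c * r - s) ^ 2 = c * r ^ 2 - 2 * (r * s) + c⁻¹ * s ^ 2 := by
              field_simp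
              ring
            linarith
          have k4 := amgm (f x) z
          have k5 := amgm ‖qn n x‖ g
          have k6 : 0 ≤ c * f x ^ 2 + c⁻¹ * z ^ 2 := by positivity
          have k7 : 0 ≤ c * ‖qn n x‖ ^ 2 + c⁻¹ * g ^ 2 := by positivity
          rw [k1, ← k3]
          linarith
      _ = c * (F + ∫ x, ‖qn n x‖ ^ 2 ∂(leb L))
          + c⁻¹ * ((∫ x, inner ℝ (tn n x) (qn n x) ^ 2 ∂(leb L))
        + ∫ x, f x ^ 2 * ‖tn n x - t x‖ ^ 2 ∂(leb L)) := by
          rw [integral_add i1 i2, integral_const_mul, integral_const_mul, integral_add f2 q2,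
            integral_add (zL n) (gL n)]
      _ ≤ _ := by
          have := hKq n
          gcongr
  have hFc : ∀ c > 0, F ≤ c * (F + K) := by
    intro c hc
    have := ((h2.add l2).const_mul c⁻¹).const_add (c * (F + K))
    rw [add_zero, mul_zero, add_zero] at this
    exact le_of_tendsto_of_tendsto' l1 this (bound c hc)
  have hFz : F = 0 := by
    refine le_antisymm (le_of_forall_pos_le_add fun e he => ?_) hF0
    have := hFc (e / (F + K + 1)) (by positivity)
    rw [zero_add]
    refine this.trans ?_
    rw [div_mul_eq_mul_div, div_le_iff₀ (by positivity)]
    nlinarith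
  rw [hF, integral_eq_zero_iff_of_nonneg (fun x => sq_nonneg _) f2] at hFz
  filter_upwards [hFz] with x hx
  exact pow_eq_zero_iff two_ne_zero |>.1 hx

/-- Weak convergence in `V` implies pointwise convergence of the continuous representatives. -/
theorem tendsto_rep_of_weak {L M : ℝ} (hL : 0 < L) {u : ℕ → V L} {v : V L}
    (h : Tendsto (fun n => toWeakSpace ℝ (V L) (u n)) atTop (𝓝 (toWeakSpace ℝ (V L) v)))
    {y0 : R3} {t b : ℝ → R3} (hv : IsRep v y0 t b) {yn : ℕ → R3} {tn bn : ℕ → ℝ → R3}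
    (hn : ∀ n, IsRep (u n) (yn n) (tn n) (bn n)) (bt : ∀ n, ∀ x ∈ Ico 0 L, ‖tn n x‖ ≤ M)
    (bb : ∀ n, ∀ x ∈ Ico 0 L, ‖bn n x‖ ≤ M) :
    (∀ x ∈ Ico 0 L, Tendsto (fun n => tn n x) atTop (𝓝 (t x))) ∧
      ∀ x ∈ Ico 0 L, Tendsto (fun n => bn n x) atTop (𝓝 (b x)) := by
  obtain ⟨⟨A, hA⟩, ⟨B, hB⟩, ⟨C, hC⟩, ⟨D, hD⟩⟩ := exists_components L
  have hcong : ∀ (f τ : ℝ → R3) (z : L2 L), z =ᵐ[leb L] τ →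
      ∫ x, inner ℝ (f x) (z x) ∂(leb L) = ∫ x, inner ℝ (f x) (τ x) ∂(leb L) := fun f τ z hz =>
    integral_congr_ae (hz.mono fun x hx => congrArg (inner ℝ (f x)) hx)
  constructor
  · exact fun x hx => tendsto_primitive_of_weak hL (fun n => Lp.memLp (u n).ddy) (Lp.memLp v.ddy)
      (fun n => (hn n).cont_t) hv.cont_t (fun n => (hn n).eq_t) hv.eq_t bt
      (fun f hf => by
        have := tendsto_integral_inner_of_weak h hf A
        simp only [hA] at this
        rw [hcong f t _ hv.ae_t] at this
        exact this.congr fun n => hcong f (tn n) _ (hn n).ae_t)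
      (fun f hf => by
        have := tendsto_integral_inner_of_weak h hf B
        simpa only [hB] using this) hx
  · exact fun x hx => tendsto_primitive_of_weak hL (fun n => Lp.memLp (u n).db) (Lp.memLp v.db)
      (fun n => (hn n).cont_b) hv.cont_b (fun n => (hn n).eq_b) hv.eq_b bb
      (fun f hf => by
        have := tendsto_integral_inner_of_weak h hf C
        simp only [hC] at this
        rw [hcong f b _ hv.ae_b] at this
        exact this.congr fun n => hcong f (bn n) _ (hn n).ae_b)
      (fun f hf => by
        have := tendsto_integral_inner_of_weak h hf D
        simpa only [hD] using this) hx

/-- The boundary condition is preserved under weak convergence. -/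
theorem map_eq_of_weak {L : ℝ} {W : Type*} [NormedAddCommGroup W] [NormedSpace ℝ W]
    {Lbc : V L →L[ℝ] W} {lbc : W} {u : ℕ → V L} {v : V L}
    (h : Tendsto (fun n => toWeakSpace ℝ (V L) (u n)) atTop (𝓝 (toWeakSpace ℝ (V L) v)))
    (hu : ∀ n, Lbc (u n) = lbc) : Lbc v = lbc := by
  -- Functionals on `W` composed with `Lbc` are weakly continuous and separate points.
  refine (SeparatingDual.eq_iff_forall_dual_eq (R := ℝ)).2 fun l => ?_
  have := tendsto_of_weak h (l.comp Lbc)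
  refine tendsto_nhds_unique this ?_
  simp only [ContinuousLinearMap.comp_apply, hu]
  exact tendsto_const_nhds

/-- Weak limits of discretely admissible pairs with bounded energies and vanishing penalty terms
are admissible ribbons. -/
theorem mem_ribbons_of_weak {L : ℝ} (hL : 0 < L) {W : Type*} [NormedAddCommGroup W]
    [NormedSpace ℝ W] {Lbc : V L →L[ℝ] W} {lbc : W} {T : ℕ → Mesh L}
    (hsize : Tendsto (fun n => (T n).size) atTop (𝓝 0)) {u : ℕ → V L} {v : V L}
    (h : Tendsto (fun n => toWeakSpace ℝ (V L) (u n)) atTop (𝓝 (toWeakSpace ℝ (V L) v)))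
    (hu : ∀ n, u n ∈ discreteAdmissible Lbc lbc (T n)) {K : ℝ}
    (hKp : ∀ n, ∫ x, ‖(u n).ddy x‖ ^ 2 ∂(leb L) ≤ K)
    (hKq : ∀ n, ∫ x, ‖(u n).db x‖ ^ 2 ∂(leb L) ≤ K)
    (h1 : Tendsto (fun n => ∫ x, inner ℝ ((u n).dy x) ((u n).b x) ^ 2 ∂(leb L)) atTop (𝓝 0))
    (h2 : Tendsto (fun n => ∫ x, inner ℝ ((u n).dy x) ((u n).db x) ^ 2 ∂(leb L)) atTop (𝓝 0)) :
    v ∈ ribbons Lbc lbc := by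
  obtain ⟨-, -, -, ⟨D, hD⟩⟩ := exists_components L
  obtain ⟨y0, t, b, hv⟩ := exists_isRep hL v
  choose yn tn bn hn using fun n => exists_isRep hL (u n)
  have hK0 : 0 ≤ K := (integral_nonneg fun s => sq_nonneg ‖(u 0).ddy s‖).trans (hKp 0)
  -- This one null sequence bounds the defect of unit length away from the nodes, uniformly in `x`,
  -- and so also gives the uniform bounds on `tn` and `bn`.
  have hst : Tendsto (fun n => √(T n).size * (1 + K)) atTop (𝓝 0) := by
    simpa using hsize.sqrt.mul_const (1 + K)
  obtain ⟨M, hM⟩ := hst.bddAbove_range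
  have hM' : ∀ n, √(T n).size * (1 + K) ≤ M := fun n => hM (mem_range_self n)
  have nt : ∀ n, ∀ x ∈ Ico 0 L, |‖tn n x‖ - 1| ≤ √(T n).size * (1 + K) := fun n x hx =>
    abs_norm_sub_one_le hL (hn n).eq_t (hKp n)
      (fun j => (norm_eq_one_at_nodes hL (hu n) (hn n) j).1) hx
  have nb : ∀ n, ∀ x ∈ Ico 0 L, |‖bn n x‖ - 1| ≤ √(T n).size * (1 + K) := fun n x hx =>
    abs_norm_sub_one_le hL (hn n).eq_b (hKq n)
      (fun j => (norm_eq_one_at_nodes hL (hu n) (hn n) j).2) hx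
  have bt : ∀ n, ∀ x ∈ Ico 0 L, ‖tn n x‖ ≤ 1 + M := fun n x hx => by
    linarith [(abs_le.1 (nt n x hx)).2, hM' n]
  have bb : ∀ n, ∀ x ∈ Ico 0 L, ‖bn n x‖ ≤ 1 + M := fun n x hx => by
    linarith [(abs_le.1 (nb n x hx)).2, hM' n]
  have hM1 : 0 ≤ 1 + M := (norm_nonneg _).trans (bt 0 0 ⟨le_rfl, hL⟩)
  obtain ⟨ct, cb⟩ := tendsto_rep_of_weak hL h hv hn bt bb
  have hnorm : ∀ {τ : ℕ → ℝ → R3} {τ' : ℝ → R3} {x : ℝ},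
      (∀ n, |‖τ n x‖ - 1| ≤ √(T n).size * (1 + K)) →
      Tendsto (fun n => τ n x) atTop (𝓝 (τ' x)) → ‖τ' x‖ = 1 := by
    intro τ τ' x hb hc
    have l1 : Tendsto (fun n => ‖τ n x‖ - 1) atTop (𝓝 0) := by
      rw [tendsto_zero_iff_abs_tendsto_zero]
      exact squeeze_zero (fun n => abs_nonneg _) hb hst
    have l2 := tendsto_nhds_unique l1 (hc.norm.sub_const 1)
    linarith
  have mem : ∀ᵐ x ∂(leb L), x ∈ Ico 0 L :=
    (ae_restrict_mem measurableSet_Ioo).mono fun x hx => Ioo_subset_Ico_self hx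
  have ntv : ∀ x ∈ Ico 0 L, ‖t x‖ = 1 := fun x hx => hnorm (fun n => nt n x hx) (ct x hx)
  have nbv : ∀ x ∈ Ico 0 L, ‖b x‖ = 1 := fun x hx => hnorm (fun n => nb n x hx) (cb x hx)
  have itb : ∀ᵐ x ∂(leb L), inner ℝ (t x) (b x) = 0 := by
    have l1 : Tendsto (fun n => ∫ x, inner ℝ ((u n).dy x) ((u n).b x) ^ 2 ∂(leb L)) atTop
        (𝓝 (∫ x, inner ℝ (t x) (b x) ^ 2 ∂(leb L))) := by
      have : Tendsto (fun n => ∫ x, inner ℝ (tn n x) (bn n x) ^ 2 ∂(leb L)) atTop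
          (𝓝 (∫ x, inner ℝ (t x) (b x) ^ 2 ∂(leb L))) := by
        refine tendsto_integral_of_dominated_convergence (fun _ => ((1 + M) * (1 + M)) ^ 2)
          (fun n => (((hn n).cont_t.inner (hn n).cont_b).pow 2).aestronglyMeasurable)
          (integrable_const _) (fun n => ?_) ?_
        · filter_upwards [mem] with x hx
          rw [Real.norm_of_nonneg (sq_nonneg _), ← sq_abs]
          gcongr
          refine (abs_real_inner_le_norm _ _).trans ?_
          gcongr
          · exact bt n x hx
          · exact bb n x hx
        · filter_upwards [mem] with x hx
          exact ((ct x hx).inner (cb x hx)).pow 2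
      refine this.congr fun n => integral_congr_ae ?_
      filter_upwards [(hn n).ae_t, (hn n).ae_b] with x e1 e2
      rw [e1, e2]
    have l2 := tendsto_nhds_unique l1 h1
    have hcont : Continuous fun x => inner ℝ (t x) (b x) ^ 2 := (hv.cont_t.inner hv.cont_b).pow 2
    rw [integral_eq_zero_iff_of_nonneg (fun x => sq_nonneg _)
      ((intervalIntegrable_iff_integrable_leb hL).1 (hcont.intervalIntegrable _ _))] at l2
    filter_upwards [l2] with x hx
    exact pow_eq_zero_iff two_ne_zero |>.1 hx
  have itq : ∀ᵐ x ∂(leb L), inner ℝ (t x) (v.db x) = 0 := by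
    refine ae_inner_eq_zero_of_weak (fun n => (hn n).cont_t) hv.cont_t bt ntv ct hKq (fun g hg => ?_)
      (h2.congr fun n => ?_)
    · have := tendsto_integral_inner_of_weak h hg D
      simpa only [hD] using this
    · exact integral_congr_ae ((hn n).ae_t.mono fun x hx => by simp only [hx])
  refine ⟨⟨?_, ?_⟩, ?_⟩
  · filter_upwards [mem, hv.ae_t, hv.ae_b, itb] with x hx e1 e2 e3
    rw [e1, e2]
    exact (frameMatrix_mem_iff _ _).2 ⟨ntv x hx, nbv x hx, e3⟩
  · exact map_eq_of_weak h fun n => (hu n).2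
  · filter_upwards [hv.ae_t, itq] with x e1 e2
    rw [e1]
    exact e2


/-! ### Consequences of smooth approximability, and coercivity of the energy -/

theorem norm_sq_eq_integral {L : ℝ} (u : L2 L) : ‖u‖ ^ 2 = ∫ x, ‖u x‖ ^ 2 ∂(leb L) := by
  rw [← real_inner_self_eq_norm_sq, L2.inner_def]
  simp only [real_inner_self_eq_norm_sq]

/-- A limit of smooth approximations is an admissible ribbon. -/
theorem mem_ribbons_of_isSmoothApprox {L : ℝ} (hL : 0 < L) {W : Type*} [NormedAddCommGroup W]
    [NormedSpace ℝ W] {Lbc : V L →L[ℝ] W} {lbc : W} {v : V L} {σ : ℕ → ℝ} {Y : ℕ → Hk L 3}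
    {B : ℕ → Hk L 2} (hσ : Tendsto σ atTop (𝓝 0))
    (h : ∀ n, IsSmoothApprox Lbc lbc v (σ n) (Y n) (B n)) : v ∈ ribbons Lbc lbc := by
  set u : ℕ → V L := fun n => (incl (Y n), incl (B n)) with hu
  have hI : ∀ n, 0 ≤ √(∫ x, inner ℝ (wd (Y n) 1 x) (wd (B n) 1 x) ^ 2 ∂(leb L)) :=
    fun n => Real.sqrt_nonneg _
  have hstrong : Tendsto u atTop (𝓝 v) := by
    refine Tendsto.prodMk_nhds ?_ ?_
    · rw [tendsto_iff_norm_sub_tendsto_zero]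
      refine squeeze_zero (fun n => norm_nonneg _) (fun n => ?_) hσ
      rw [norm_sub_rev]
      linarith [(h n).close, norm_nonneg (v.2 - incl (B n)), hI n]
    · rw [tendsto_iff_norm_sub_tendsto_zero]
      refine squeeze_zero (fun n => norm_nonneg _) (fun n => ?_) hσ
      rw [norm_sub_rev]
      linarith [(h n).close, norm_nonneg (v.1 - incl (Y n)), hI n]
  -- Passing to weak convergence allows the limit lemmas for discrete pairs to be reused.
  have hweak : Tendsto (fun n => toWeakSpace ℝ (V L) (u n)) atTop (𝓝 (toWeakSpace ℝ (V L) v)) :=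
    ((toWeakSpaceCLM ℝ (V L)).continuous.tendsto v).comp hstrong
  obtain ⟨-, -, -, ⟨D, hD⟩⟩ := exists_components L
  obtain ⟨y0, t, b, hv⟩ := exists_isRep hL v
  choose yn tn bn hn using fun n => exists_isRep hL (u n)
  have hfr : ∀ n, ∀ x ∈ Ico 0 L, ‖tn n x‖ = 1 ∧ ‖bn n x‖ = 1 ∧ inner ℝ (tn n x) (bn n x) = 0 :=
    fun n x hx => (hn n).frame hL (h n).frame x (Ico_subset_Icc_self hx)
  have bt : ∀ n, ∀ x ∈ Ico 0 L, ‖tn n x‖ ≤ 1 := fun n x hx => (hfr n x hx).1.le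
  obtain ⟨ct, cb⟩ := tendsto_rep_of_weak hL hweak hv hn bt fun n x hx => (hfr n x hx).2.1.le
  have lfr : ∀ x ∈ Ico 0 L, ‖t x‖ = 1 ∧ ‖b x‖ = 1 ∧ inner ℝ (t x) (b x) = 0 := by
    intro x hx
    have e1 := (ct x hx).norm
    have e2 := (cb x hx).norm
    have e3 := (ct x hx).inner (𝕜 := ℝ) (cb x hx)
    simp only [fun n => (hfr n x hx).1] at e1
    simp only [fun n => (hfr n x hx).2.1] at e2
    simp only [fun n => (hfr n x hx).2.2] at e3
    exact ⟨tendsto_nhds_unique tendsto_const_nhds e1 |>.symm,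
      tendsto_nhds_unique tendsto_const_nhds e2 |>.symm,
      tendsto_nhds_unique tendsto_const_nhds e3 |>.symm⟩
  obtain ⟨K, hK⟩ := ((((D.continuous.tendsto v).comp hstrong).norm).pow 2).bddAbove_range
  have hK' : ∀ n, ∫ x, ‖(u n).db x‖ ^ 2 ∂(leb L) ≤ K := by
    intro n
    rw [← norm_sq_eq_integral, ← hD]
    exact hK (mem_range_self n)
  have h2 : Tendsto (fun n => ∫ x, inner ℝ (tn n x) ((u n).db x) ^ 2 ∂(leb L)) atTop (𝓝 0) := by
    have hσ2 : Tendsto (fun n => σ n ^ 2) atTop (𝓝 0) := by simpa using hσ.pow 2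
    refine squeeze_zero (fun n => integral_nonneg fun x => sq_nonneg _) (fun n => ?_) hσ2
    have e1 : ∫ x, inner ℝ (tn n x) ((u n).db x) ^ 2 ∂(leb L)
        = ∫ x, inner ℝ (wd (Y n) 1 x) (wd (B n) 1 x) ^ 2 ∂(leb L) :=
      integral_congr_ae ((hn n).ae_t.mono fun x hx => by
        simp only [← hx]
        rfl)
    rw [e1, ← Real.sqrt_le_left]
    · linarith [(h n).close, norm_nonneg (v.1 - incl (Y n)), norm_nonneg (v.2 - incl (B n))]
    · linarith [(h n).close, norm_nonneg (v.1 - incl (Y n)), norm_nonneg (v.2 - incl (B n)), hI n]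
  have itq := ae_inner_eq_zero_of_weak (fun n => (hn n).cont_t) hv.cont_t bt
    (fun x hx => (lfr x hx).1) ct hK' (fun g hg => by
      have := tendsto_integral_inner_of_weak hweak hg D
      simpa only [hD] using this) h2
  refine ⟨⟨?_, map_eq_of_weak hweak fun n => (h n).frame.2⟩, ?_⟩
  · filter_upwards [ae_restrict_mem measurableSet_Ioo, hv.ae_t, hv.ae_b] with x hx e1 e2
    rw [e1, e2]
    exact (frameMatrix_mem_iff _ _).2 (lfr x (Ioo_subset_Ico_self hx))
  · filter_upwards [hv.ae_t, itq] with x e1 e2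
    rw [e1]
    exact e2

/-- A unit director has squared `L²` norm exactly `L`. This lower bound removes the regularity
factor from the rate condition, leaving `h²/ε₂ → 0`. -/
theorem le_norm_sq_of_isSmoothApprox {L : ℝ} (hL : 0 < L) {W : Type*} [NormedAddCommGroup W]
    [NormedSpace ℝ W] {Lbc : V L →L[ℝ] W} {lbc : W} {v : V L} {σ : ℝ} {Y : Hk L 3}
    {B : Hk L 2} (h : IsSmoothApprox Lbc lbc v σ Y B) : L ≤ ‖B‖ ^ 2 := by
  have h1 : ‖wd B 0‖ ≤ ‖B‖ := PiLp.norm_apply_le (B : PiLp 2 fun _ : Fin 3 => L2 L) 0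
  have h2 : ‖wd B 0‖ ^ 2 = L := by
    have : ∫ x, ‖wd B 0 x‖ ^ 2 ∂(leb L) = ∫ x, (1 : ℝ) ∂(leb L) := by
      refine integral_congr_ae (h.frame.1.mono fun x hx => ?_)
      have := ((frameMatrix_mem_iff _ _).1 hx).2.1
      change ‖wd B 0 x‖ = 1 at this
      simp only [this, one_pow]
    rw [norm_sq_eq_integral, this, integral_leb hL]
    simp
  calc L = ‖wd B 0‖ ^ 2 := h2.symm
    _ ≤ ‖B‖ ^ 2 := by gcongr

theorem integral_norm_sq_add_le_energy {L : ℝ} (v : V L) :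
    ∫ x, ‖v.ddy x‖ ^ 2 ∂(leb L) + 2 * ∫ x, ‖v.db x‖ ^ 2 ∂(leb L) ≤ energy v := by
  have i1 : Integrable (fun x => ‖v.ddy x‖ ^ 2) (leb L) :=
    (Lp.memLp v.ddy).integrable_norm_pow two_ne_zero
  have i2 : Integrable (fun x => 2 * ‖v.db x‖ ^ 2) (leb L) :=
    ((Lp.memLp v.db).integrable_norm_pow two_ne_zero).const_mul 2
  rw [← integral_const_mul, ← integral_add i1 i2]
  exact integral_mono (i1.add i2) (integrable_Qbar (Lp.memLp v.ddy) (Lp.memLp v.db))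
    fun x => sq_add_le_Qbar _ _


end Ribbon

end


/-! ### Convergence of the almost-minimizers -/

theorem corollary4p3 {L : ℝ} (hL : 0 < L)
    {W : Type*} [NormedAddCommGroup W] [NormedSpace ℝ W]
    -- boundary conditions: a bounded linear operator depending only on boundary values
    (Lbc : Ribbon.V L →L[ℝ] W) (lbc : W)
    (hLbc : ∀ v w : Ribbon.V L, Ribbon.SameBoundaryValues v w → Lbc v = Lbc w)
    -- the family of regularized modulus functions
    (m : ℝ → ℝ → ℝ) (hm : Ribbon.IsRegularizedModulus m)
    -- quasiuniform partitionings
    (T : ℕ → Ribbon.Mesh L)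
    (hT : ∃ c : ℝ, 0 < c ∧ ∀ n j, c * (T n).size ≤ (T n).len j)
    (hsize : Tendsto (fun n => (T n).size) atTop (𝓝 0))
    -- regularization and penalty parameters, tolerances
    (δ ε₁ ε₂ tol : ℕ → ℝ)
    (hδ : ∀ n, 0 ≤ δ n) (hε₁ : ∀ n, 0 < ε₁ n) (hε₂ : ∀ n, 0 < ε₂ n)
    (hδ0 : Tendsto δ atTop (𝓝 0)) (hε₁0 : Tendsto ε₁ atTop (𝓝 0))
    (hε₂0 : Tendsto ε₂ atTop (𝓝 0)) (htol : Tendsto tol atTop (𝓝 0))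
    -- discrete minimizers up to the tolerances
    (u : ℕ → Ribbon.V L)
    (hu : ∀ n, u n ∈ Ribbon.discreteAdmissible Lbc lbc (T n))
    (humin : ∀ n, ∀ w ∈ Ribbon.discreteAdmissible Lbc lbc (T n),
      Ribbon.penEnergy m (δ n) (ε₁ n) (ε₂ n) (u n)
        ≤ Ribbon.penEnergy m (δ n) (ε₁ n) (ε₂ n) w + tol n)
    -- an accumulation point has smooth approximations satisfying the rate condition
    (hreg : ∃ v, Ribbon.IsWeakAccPt u v ∧
      ∃ (σ : ℕ → ℝ) (Y : ℕ → Ribbon.Hk L 3) (B : ℕ → Ribbon.Hk L 2),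
        (∀ n, 0 < σ n) ∧ Tendsto σ atTop (𝓝 0) ∧
        (∀ n, Ribbon.IsSmoothApprox Lbc lbc v (σ n) (Y n) (B n)) ∧
        Tendsto (fun n => (T n).size ^ 2 / ε₁ n + σ n ^ 2 / ε₂ n
          + (T n).size ^ 2 * (‖Y n‖ + ‖B n‖) ^ 2 / ε₂ n) atTop (𝓝 0)) :
    ∀ v, Ribbon.IsWeakAccPt u v →
      v ∈ Ribbon.ribbons Lbc lbc ∧ IsMinOn Ribbon.energy (Ribbon.ribbons Lbc lbc) v := by
  open Ribbon in
  obtain ⟨v₀, -, σ, Y, B, hσ, hσ0, happ, hrate⟩ := hreg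
  have hv₀ : v₀ ∈ ribbons Lbc lbc := mem_ribbons_of_isSmoothApprox hL hσ0 happ
  have hp1 : ∀ n, 0 ≤ (T n).size ^ 2 / ε₁ n := fun n => by have := hε₁ n; positivity
  have hp2 : ∀ n, 0 ≤ σ n ^ 2 / ε₂ n := fun n => by have := hε₂ n; positivity
  have hp3 : ∀ n, 0 ≤ (T n).size ^ 2 * (‖Y n‖ + ‖B n‖) ^ 2 / ε₂ n := fun n => by
    have := hε₂ n; positivity
  have hr₁ : Tendsto (fun n => (T n).size ^ 2 / ε₁ n) atTop (𝓝 0) :=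
    squeeze_zero hp1 (fun n => by linarith [hp2 n, hp3 n]) hrate
  have hr₂ : Tendsto (fun n => (T n).size ^ 2 / ε₂ n) atTop (𝓝 0) := by
    have h3 : Tendsto (fun n => L⁻¹ * ((T n).size ^ 2 * (‖Y n‖ + ‖B n‖) ^ 2 / ε₂ n)) atTop (𝓝 0) := by
      simpa using (squeeze_zero hp3 (fun n => by linarith [hp1 n, hp2 n]) hrate).const_mul L⁻¹
    refine squeeze_zero (fun n => by have := hε₂ n; positivity) (fun n => ?_) h3
    have hB := le_norm_sq_of_isSmoothApprox hL (happ n)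
    have hYB : L ≤ (‖Y n‖ + ‖B n‖) ^ 2 := by nlinarith [norm_nonneg (Y n), norm_nonneg (B n)]
    rw [inv_mul_eq_div, le_div_iff₀ hL, mul_comm, ← mul_div_assoc, mul_comm L]
    have := hε₂ n
    gcongr
  obtain ⟨C, hC⟩ := exists_abs_elastic_sub_energy_le (L := L) hm
  have hCδ : Tendsto (fun n => C * δ n) atTop (𝓝 0) := by simpa using hδ0.const_mul C
  have hsplit : ∀ n, energy (u n) + penalty (ε₁ n) (ε₂ n) (u n)
      ≤ penEnergy m (δ n) (ε₁ n) (ε₂ n) (u n) + C * δ n := by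
    intro n
    have := (abs_le.1 (hC (δ n) (hδ n) (u n))).1
    unfold penEnergy
    linarith
  -- The central comparison. The three thirds of `e` pay for the recovery sequence, the tolerance
  -- and the regularization error. The penalty stays on the left, where it will also give the
  -- constraints in the limit.
  have hcomp : ∀ w ∈ ribbons Lbc lbc, ∀ e > 0, ∀ᶠ n in atTop,
      energy (u n) + penalty (ε₁ n) (ε₂ n) (u n) ≤ energy w + e := by
    intro w hw e he
    obtain ⟨z, hzA, hz⟩ := exists_recovery hL hLbc hm hsize hδ hδ0 hr₁ hr₂ hε₁ hε₂ hw
      (e := e / 3) (by positivity)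
    filter_upwards [hz, htol.eventually (gt_mem_nhds (show 0 < e / 3 by positivity)),
      hCδ.eventually (gt_mem_nhds (show 0 < e / 3 by positivity))] with n h1 h2 h3
    linarith [hsplit n, humin n (z n) (hzA n)]
  set K := energy v₀ + 1 with hK
  -- Comparison with the approximated ribbon bounds energy plus penalty by `K` from `n₀` on; both
  -- terms are nonnegative, so each penalty integral is at most `2 ε K`.
  obtain ⟨n₀, hn₀⟩ := eventually_atTop.1 (hcomp v₀ hv₀ 1 one_pos)
  have hE0 : ∀ n, 0 ≤ energy (u n) := fun n => integral_nonneg fun x => Qbar_nonneg _ _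
  have hpen : ∀ n, 0 ≤ penalty (ε₁ n) (ε₂ n) (u n) := fun n => penalty_nonneg (hε₁ n) (hε₂ n) _
  have hsq : ∀ n, 0 ≤ ∫ x, ‖(u n).ddy x‖ ^ 2 ∂(leb L) ∧ 0 ≤ ∫ x, ‖(u n).db x‖ ^ 2 ∂(leb L) :=
    fun n => ⟨integral_nonneg fun x => sq_nonneg _, integral_nonneg fun x => sq_nonneg _⟩
  have hi1 : ∀ n, 0 ≤ ∫ x, inner ℝ ((u n).dy x) ((u n).b x) ^ 2 ∂(leb L) :=
    fun n => integral_nonneg fun x => sq_nonneg _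
  have hi2 : ∀ n, 0 ≤ ∫ x, inner ℝ ((u n).dy x) ((u n).db x) ^ 2 ∂(leb L) :=
    fun n => integral_nonneg fun x => sq_nonneg _
  have hpb : ∀ n ≥ n₀, ∫ x, inner ℝ ((u n).dy x) ((u n).b x) ^ 2 ∂(leb L) ≤ 2 * ε₁ n * K ∧
      ∫ x, inner ℝ ((u n).dy x) ((u n).db x) ^ 2 ∂(leb L) ≤ 2 * ε₂ n * K := by
    intro n hn
    have h1 := hε₁ n
    have h2 := hε₂ n
    have k := hn₀ n hn
    have k1 : 0 ≤ 1 / (2 * ε₁ n) * ∫ x, inner ℝ ((u n).dy x) ((u n).b x) ^ 2 ∂(leb L) :=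
      mul_nonneg (by positivity) (hi1 n)
    have k2 : 0 ≤ 1 / (2 * ε₂ n) * ∫ x, inner ℝ ((u n).dy x) ((u n).db x) ^ 2 ∂(leb L) :=
      mul_nonneg (by positivity) (hi2 n)
    unfold penalty at k
    have k3 := hE0 n
    constructor
    · have : 1 / (2 * ε₁ n) * ∫ x, inner ℝ ((u n).dy x) ((u n).b x) ^ 2 ∂(leb L) ≤ K := by linarith
      rwa [one_div, inv_mul_le_iff₀ (by positivity)] at this
    · have : 1 / (2 * ε₂ n) * ∫ x, inner ℝ ((u n).dy x) ((u n).db x) ^ 2 ∂(leb L) ≤ K := by linarith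
      rwa [one_div, inv_mul_le_iff₀ (by positivity)] at this
  rintro v ⟨φ, hφ, hφv⟩
  -- Shifting the subsequence by `n₀` makes the bounds valid for every index, as
  -- `mem_ribbons_of_weak` requires.
  have hφn : ∀ n, n₀ ≤ φ (n + n₀) := fun n => (Nat.le_add_left _ _).trans (hφ.id_le _)
  have hφt : Tendsto (fun n => φ (n + n₀)) atTop atTop :=
    hφ.tendsto_atTop.comp (tendsto_add_atTop_nat n₀)
  have hφv' := hφv.comp (tendsto_add_atTop_nat n₀)
  have hb : ∀ n, ∫ x, ‖(u (φ (n + n₀))).ddy x‖ ^ 2 ∂(leb L) ≤ K ∧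
      ∫ x, ‖(u (φ (n + n₀))).db x‖ ^ 2 ∂(leb L) ≤ K := fun n => by
    have k1 := hn₀ _ (hφn n)
    have k2 := integral_norm_sq_add_le_energy (u (φ (n + n₀)))
    have k3 := hpen (φ (n + n₀))
    have k4 := hsq (φ (n + n₀))
    constructor <;> linarith [k4.1, k4.2]
  have he1 : Tendsto (fun n => 2 * ε₁ (φ (n + n₀)) * K) atTop (𝓝 0) := by
    simpa using ((hε₁0.comp hφt).const_mul 2).mul_const K
  have he2 : Tendsto (fun n => 2 * ε₂ (φ (n + n₀)) * K) atTop (𝓝 0) := by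
    simpa using ((hε₂0.comp hφt).const_mul 2).mul_const K
  refine ⟨mem_ribbons_of_weak hL (T := fun n => T (φ (n + n₀))) (hsize.comp hφt) hφv'
    (fun n => hu _) (fun n => (hb n).1) (fun n => (hb n).2)
    (squeeze_zero (fun n => hi1 _) (fun n => (hpb _ (hφn n)).1) he1)
    (squeeze_zero (fun n => hi2 _) (fun n => (hpb _ (hφn n)).2) he2), ?_⟩
  -- Lower semicontinuity and the comparison each cost `e / 2`, and the penalty is dropped by its
  -- sign.
  refine isMinOn_iff.2 fun w hw => le_of_forall_pos_le_add fun e he => ?_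
  have h1 := eventually_energy_le_of_weak hφv (half_pos he)
  have h2 := hφ.tendsto_atTop.eventually (hcomp w hw (e / 2) (half_pos he))
  obtain ⟨n, h3, h4⟩ := (h1.and h2).exists
  linarith [hpen (φ n)]
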